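/- **Conventions.** All graphs are finite. A mixed graph $\widetilde G$ is obtained from a simple graph $G$ (its underlying graph) by orienting some of its edges. Its Hermitian adjacency matrix $H(\widetilde G)$ has $(u,w)$-entry $1$ if $uw$ is an undirected edge, $i$ if $u\to w$ is an arc, $-i$ if $w\to u$ is an arc, and $0$ otherwise; $p(\widetilde G)$ is the number of positive eigenvalues of $H(\widetilde G)$, counted with multiplicity. Connectedness, vertex degrees, cut vertices (vertices whose removal increases the number of components) and pendant vertices (vertices of degree $1$) refer to $G$. Two mixed graphs $\widetilde G_1,\widetilde G_2$ are switching equivalent if, after identifying their vertex sets by a suitable bijection, $H(\widetilde G_2)=Q^{-1}HQ$ for some diagonal matrix $Q$ with diagonal entries in $\{\pm1,\pm i\}$, where $H$ is $H(\widetilde G_1)$ or the Hermitian adjacency matrix of the converse of $\widetilde G_1$ (all arcs reversed). A mixed graph is positive if for every cycle $u_1u_2\cdots u_\ell u_1$ of its underlying graph $h_{u_1u_2}h_{u_2u_3}\cdots h_{u_\ell u_1}=1$, where $h_{uw}$ are the entries of $H$. A mixed complete multipartite graph $\widetilde K_{m_1,\dots,m_x}$ is a mixed graph with underlying graph $K_{m_1,\dots,m_x}$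 ($x\ge2$, all $m_j\ge1$); it is a mixed star if its underlying graph is a star $K_{1,t}$. For $t_1,t_2,t_3\ge1$, $\overrightarrow{C_3}(t_1,t_2,t_3)$ is the mixed complete tripartite graph with classes $A,B,C$ of sizes $t_1,t_2,t_3$ and all edges oriented from $A$ to $B$, from $B$ to $C$ and from $C$ to $A$. $\widetilde G_1\bullet v\bullet\widetilde G_2$ is the mixed graph obtained from disjoint $\widetilde G_1,\widetilde G_2$ by identifying a vertex of $\widetilde G_1$ with a vertex of $\widetilde G_2$ to a vertex $v$. For positive integers $q_1,\dots,q_r,n_1,\dots,n_k$ and $1\le p\le k$, $K(q_1,\dots,q_r;n_1,\dots,n_k;p)$ is the simple graph obtained from the disjoint union of $K_{q_1,\dots,q_r}$ and $K_{n_1,\dots,n_k}$ (with classes $V_1,\dots,V_k$, $|V_j|=n_j$) by adding a new vertex $v$ adjacent to all vertices of $K_{q_1,\dots,q_r}$ and to all vertices of $V_1\cup\dots\cup V_p$. For nonnegative integers $a,b,c$ with $1\le a+b+c\le k$, $K(q_1,\dots,q_r;n_1,\dots,n_k;a^i,b^{-i},c^1,0^{-1},k-a-b-c)$ is the mixed graph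 with underlying graph $K(q_1,\dots,q_r;n_1,\dots,n_k;a+b+c)$ in which the edge between $v$ and $u$ is the arc $v\to u$ for $u\in V_1\cup\dots\cup V_a$, the arc $u\to v$ for $u\in V_{a+1}\cup\dots\cup V_{a+b}$, and all other edges are undirected. **Theorem.** Let $\widetilde G$ be a connected mixed graph with a cut vertex $v$ and without pendant vertices. Then $p(\widetilde G)=2$ if and only if $\widetilde G$ is switching equivalent, by a bijection of the vertex sets under which the cut vertex $v$ of $\widetilde G$ corresponds to the vertex named $v$ below, to one of the following mixed graphs (all $q_j\ge1$ and $n_j\ge1$): (i) $\widetilde K_{m_1,\dots,m_x}\bullet v\bullet\widetilde K_{m'_1,\dots,m'_y}$, where neither of $\widetilde K_{m_1,\dots,m_x}$, $\widetilde K_{m'_1,\dots,m'_y}$ is a mixed star, and each of them is positive or switching equivalent to some $\overrightarrow{C_3}(t_1,t_2,t_3)$. (ii) $K(q_1,\dots,q_r;n_1,\dots,n_k;p)$, where $r\ge2$, $k\ge2$, $1\le p\le k$, satisfying one of the following conditions: (1) $p=1$ and either $n_1=1$ and $k-p\ge2$, or $n_1\ge2$; (2) $p\ge2$ and $k-p\le1$;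 (3) $p\ge2$, $k-p\ge2$ and $\frac1r+\frac1p+\frac1{k-p-1}\ge1$. (iii) $K(q_1,\dots,q_r;n_1,\dots,n_k;a^i,b^{-i},0^1,0^{-1},s)$, where $r\ge2$, $k\ge2$, $a\ge b\ge1$, $s=k-a-b\ge0$, satisfying $a=b=1$ and $r=2$. (iv) $K(q_1,\dots,q_r;n_1,\dots,n_k;a^i,0^{-i},c^1,0^{-1},s)$, where $r\ge2$, $k\ge2$, $a\ge c\ge1$, $s=k-a-c\ge0$, satisfying one of the following conditions: (1) $a=c=1$ and either $s=0$ or $s=1$; (2) $a=c=1$, $s=2$ and either $r=3$ or $r=4$; (3) $a=c=1$, $s=3$ and $r=3$; (4) $a=c=1$, $s\ge2$ and $r=2$; (5) $a=c=2$, $s=0$ and $2\le r\le4$; (6) $a=c=2$, $s=1$ and $r=2$; (7) $a=3$, $s=0$ and $r=c=2$; (8) $a=4$, $c=r=2$ and $s=0$; (9) $a\ge2$, $c=1$ and $\frac{as-1}{a+s}\le\frac1{r-1}$. -/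

import Mathlib

/-- A mixed graph on the vertex set `V`: undirected edges and arcs, with at most one of
`{u, v}`, `u → v`, `v → u` present for every pair of distinct vertices, and no loops. -/
@[ext]
structure MixedGraph (V : Type*) where
  /-- the undirected edges -/
  undirected : SimpleGraph V
  /-- the arcs: `arc u v` means that there is a directed edge from `u` to `v` -/
  arc : V → V → Prop
  arc_asymm : ∀ u v, arc u v → ¬ arc v u
  not_undirected_of_arc : ∀ u v, arc u v → ¬ undirected.Adj u v

namespace MixedGraph

/-- The underlying simple graph. -/
def graph {V : Type*} (G : MixedGraph V) : SimpleGraph V where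
  Adj u v := G.undirected.Adj u v ∨ G.arc u v ∨ G.arc v u
  symm := ⟨fun _ _ h => h.elim (fun h => Or.inl h.symm) (fun h => Or.inr h.symm)⟩
  loopless := ⟨fun u h => h.elim (fun h => G.undirected.irrefl h)
    (fun h => h.elim (fun h => G.arc_asymm u u h h) (fun h => G.arc_asymm u u h h))⟩

/-- A simple graph, seen as a mixed graph without arcs. -/
def ofSimpleGraph {V : Type*} (S : SimpleGraph V) : MixedGraph V where
  undirected := S
  arc _ _ := False
  arc_asymm _ _ h := h.elim
  not_undirected_of_arc _ _ h := h.elim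

/-- The converse of a mixed graph: all arcs are reversed. -/
def converse {V : Type*} (G : MixedGraph V) : MixedGraph V where
  undirected := G.undirected
  arc u v := G.arc v u
  arc_asymm u v h := G.arc_asymm v u h
  not_undirected_of_arc u v h hu := G.not_undirected_of_arc v u h hu.symm

open Classical in
/-- The Hermitian adjacency matrix: `1` for an undirected edge, `i` for an arc `u → v`,
`-i` for an arc `v → u`, and `0` otherwise. -/
noncomputable def herm {V : Type*} (G : MixedGraph V) : Matrix V V ℂ := fun u v =>
  if G.undirected.Adj u v then 1
  else if G.arc u v then Complex.I
  else if G.arc v u then -Complex.I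
  else 0

theorem isHermitian_herm {V : Type*} (G : MixedGraph V) : G.herm.IsHermitian := by
  ext u v
  have h1 := G.arc_asymm u v
  have h2 := G.undirected.adj_comm u v
  simp only [Matrix.conjTranspose_apply, herm]
  split_ifs <;> simp_all

/-- The positive inertia index: the number of positive eigenvalues of the Hermitian adjacency
matrix, counted with multiplicity. -/
noncomputable def posInertia {V : Type*} [Fintype V] [DecidableEq V] (G : MixedGraph V) : ℕ :=
  Nat.card {u : V // 0 < G.isHermitian_herm.eigenvalues u}

/-- `G` is switching equivalent to `G'`, the vertices of the two graphs being matched by `e`: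
after possibly taking the converse of `G`, the matrix of `G'` is `Q⁻¹ H Q` for a diagonal
matrix `Q` with diagonal entries in `{1, -1, i, -i}`. -/
def SwitchingEquivVia {V W : Type*} (e : V ≃ W) (G : MixedGraph V) (G' : MixedGraph W) : Prop :=
  ∃ Q : V → ℂ, (∀ u, Q u = 1 ∨ Q u = -1 ∨ Q u = Complex.I ∨ Q u = -Complex.I) ∧
    ((∀ u w, G'.herm (e u) (e w) = (Q u)⁻¹ * G.herm u w * Q w) ∨
      (∀ u w, G'.herm (e u) (e w) = (Q u)⁻¹ * G.converse.herm u w * Q w))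

/-- `G` is positive: every cycle of the underlying graph has value `1`, where the value of a
cycle is the product of the matrix entries along it. -/
def IsPositive {V : Type*} (G : MixedGraph V) : Prop :=
  ∀ (u : V) (w : G.graph.Walk u u), w.IsCycle →
    (w.darts.map fun d => G.herm d.fst d.snd).prod = 1

/-- The mixed complete tripartite graph with classes of sizes `t 0`, `t 1`, `t 2`, obtained by
blowing up the cyclically oriented triangle. -/
def c3 (t : Fin 3 → ℕ) : MixedGraph (Σ j : Fin 3, Fin (t j)) where
  undirected := ⊥
  arc x y := x.1 + 1 = y.1
  arc_asymm x y h h' := by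
    have key : ∀ i j : Fin 3, i + 1 = j → ¬ j + 1 = i := by decide
    exact key x.1 y.1 h h'
  not_undirected_of_arc _ _ _ h := h

/-- `G` is switching equivalent to some `c3 t` with nonempty classes. -/
def IsC3Type {V : Type*} (G : MixedGraph V) : Prop :=
  ∃ t : Fin 3 → ℕ, (∀ j, 0 < t j) ∧
    ∃ e : V ≃ (Σ j : Fin 3, Fin (t j)), SwitchingEquivVia e G (c3 t)

/-- A mixed star: the underlying graph is a star. -/
def IsMixedStar {V : Type*} (G : MixedGraph V) : Prop :=
  ∃ c : V, G.graph = SimpleGraph.starGraph c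

/-- The vertex set of the graph obtained from graphs on `V` and `W` by identifying the vertex
`a` of the first with the vertex `b` of the second; the common vertex is `Sum.inl a`. -/
abbrev GlueVertex (V : Type*) {W : Type*} (b : W) := V ⊕ {w : W // w ≠ b}

/-- The mixed graph obtained from `M` and `N` by identifying the vertex `a` of `M` with the
vertex `b` of `N`. -/
def glue {V W : Type*} (M : MixedGraph V) (a : V) (N : MixedGraph W) (b : W) :
    MixedGraph (GlueVertex V b) where
  undirected :=
    { Adj := fun x y => match x, y with
        | .inl x, .inl y => M.undirected.Adj x y
        | .inl x, .inr y => x = a ∧ N.undirected.Adj b y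
        | .inr x, .inl y => y = a ∧ N.undirected.Adj x b
        | .inr x, .inr y => N.undirected.Adj x y
      symm := ⟨by
        rintro (x | x) (y | y) h
        · exact h.symm
        · exact ⟨h.1, h.2.symm⟩
        · exact ⟨h.1, h.2.symm⟩
        · exact h.symm⟩
      loopless := ⟨by
        rintro (x | x) h
        · exact M.undirected.irrefl h
        · exact N.undirected.irrefl h⟩ }
  arc x y := match x, y with
    | .inl x, .inl y => M.arc x y
    | .inl x, .inr y => x = a ∧ N.arc b y
    | .inr x, .inl y => y = a ∧ N.arc x b
    | .inr x, .inr y => N.arc x y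
  arc_asymm := by
    rintro (x | x) (y | y) h h'
    · exact M.arc_asymm _ _ h h'
    · exact N.arc_asymm _ _ h.2 h'.2
    · exact N.arc_asymm _ _ h.2 h'.2
    · exact N.arc_asymm _ _ h h'
  not_undirected_of_arc := by
    rintro (x | x) (y | y) h h'
    · exact M.not_undirected_of_arc _ _ h h'
    · exact N.not_undirected_of_arc _ _ h.2 h'.2
    · exact N.not_undirected_of_arc _ _ h.2 h'.2
    · exact N.not_undirected_of_arc _ _ h h'

end MixedGraph

/-- The vertices of `K(q_1, …, q_r; n_1, …, n_k; p)`: the special vertex `none`, the vertices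
of `K_{q_1, …, q_r}` and the vertices of `K_{n_1, …, n_k}`. -/
abbrev KVertex {r k : ℕ} (q : Fin r → ℕ) (n : Fin k → ℕ) : Type :=
  Option ((Σ j : Fin r, Fin (q j)) ⊕ (Σ j : Fin k, Fin (n j)))

/-- The simple graph `K(q_1, …, q_r; n_1, …, n_k; p)`: the disjoint union of `K_{q_1, …, q_r}`
and `K_{n_1, …, n_k}` together with a new vertex `none`, adjacent to all vertices of the former
and to the vertices in the first `p` classes of the latter. -/
def kGraph {r k : ℕ} (q : Fin r → ℕ) (n : Fin k → ℕ) (p : ℕ) : SimpleGraph (KVertex q n) where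
  Adj x y := match x, y with
    | none, none => False
    | none, some (.inl _) => True
    | some (.inl _), none => True
    | none, some (.inr y) => (y.1 : ℕ) < p
    | some (.inr x), none => (x.1 : ℕ) < p
    | some (.inl x), some (.inl y) => x.1 ≠ y.1
    | some (.inr x), some (.inr y) => x.1 ≠ y.1
    | some (.inl _), some (.inr _) => False
    | some (.inr _), some (.inl _) => False
  symm := ⟨by
    rintro (_ | x | x) (_ | y | y) h
    all_goals first
      | exact h
      | exact fun h' => h h'.symm⟩
  loopless := ⟨by
    rintro (_ | x | x) h
    · exact h
    · exact h rfl
    · exact h rfl⟩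

/-- The mixed graph `K(q_1, …, q_r; n_1, …, n_k; a^i, b^{-i}, c^1, 0^{-1}, k-a-b-c)`: its
underlying graph is `K(q_1, …, q_r; n_1, …, n_k; a+b+c)`; the edges from the special vertex to the
first `a` classes of `K_{n_1, …, n_k}` point away from the special vertex (gain `i`), those to the
next `b` classes point towards it (gain `-i`), and all other edges are undirected (gain `1`). -/
def kMixed {r k : ℕ} (q : Fin r → ℕ) (n : Fin k → ℕ) (a b c : ℕ) :
    MixedGraph (KVertex q n) where
  undirected :=
    { Adj := fun x y => match x, y with
        | none, none => False
        | none, some (.inl _) => True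
        | some (.inl _), none => True
        | none, some (.inr y) => a + b ≤ (y.1 : ℕ) ∧ (y.1 : ℕ) < a + b + c
        | some (.inr x), none => a + b ≤ (x.1 : ℕ) ∧ (x.1 : ℕ) < a + b + c
        | some (.inl x), some (.inl y) => x.1 ≠ y.1
        | some (.inr x), some (.inr y) => x.1 ≠ y.1
        | some (.inl _), some (.inr _) => False
        | some (.inr _), some (.inl _) => False
      symm := ⟨by
        rintro (_ | x | x) (_ | y | y) h
        all_goals first
          | exact h
          | exact fun h' => h h'.symm⟩
      loopless := ⟨by
        rintro (_ | x | x) h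
        · exact h
        · exact h rfl
        · exact h rfl⟩ }
  arc x y := match x, y with
    | none, some (.inr y) => (y.1 : ℕ) < a
    | some (.inr x), none => a ≤ (x.1 : ℕ) ∧ (x.1 : ℕ) < a + b
    | _, _ => False
  arc_asymm := by
    rintro (_ | x | x) (_ | y | y) h h'
    all_goals first
      | exact h
      | (dsimp only at h h'; omega)
  not_undirected_of_arc := by
    rintro (_ | x | x) (_ | y | y) h h'
    all_goals first
      | exact h
      | (dsimp only at h h'; omega)

/-- `v` is a cut vertex: its removal increases the number of connected components. -/
def IsCutVertex {V : Type*} (S : SimpleGraph V) (v : V) : Prop :=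
  Nat.card S.ConnectedComponent < Nat.card (S.induce {v}ᶜ).ConnectedComponent

/-- `u` is a pendant vertex: its degree is one. -/
def IsPendant {V : Type*} (S : SimpleGraph V) (u : V) : Prop :=
  (S.neighborSet u).ncard = 1

/-! Inertia is handled through the form f ↦ ⟨f, Hf⟩: `PosGe H d` exhibits d orthogonal positive
vectors, `PosLe H d` makes the form nonpositive on the kernel of d functionals, and the spectral
theorem ties both to `posInertia`. Without pendant vertices every component of G − v contains an
edge, and an edge carries a positive vector. So p ≥ 2 always holds, and p = 2 means that `PosGe`
fails for 3; then G − v has exactly two components S and S'.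

An edge of S' uses up one positive direction. Hence a vector on S that is orthogonal to a positive
vector on S and has nonnegative form lies in the kernel of the whole of H
(`mulVec_eq_zero_of_maximal`, `IsSplit.isHyperbolicOn`). Tested on explicit vectors, this makes
nonadjacent vertices of S have proportional rows and rules out triangles of gain −1. Up to
switching, S is therefore complete multipartite or a blow-up of a triangle of gain ±i
(`isBalancedOn_or_isTriangularOn`), and so is S'.

What remains is a Schur complement at v. If z lives on S and e_v + z is orthogonal to all vectors on
S (`IsReduction`), then (Hz)_v is the contribution of S, and the contributions of S and S' must add
up to at most 0 (`reduction_nonpos`). A triangular block contributes 0; a k-partite block with gains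
x_j from v contributes Σ|x_j|² − |Σ x_j|²/(k − 1). If some block contributes 0, then S ∪ {v} and S'
∪ {v} both have positive inertia at most one, which is the glued family. Otherwise one contribution
is negative; this forces all r gains of that block to be equal, with value −r/(r − 1), and the other
block has to satisfy `SchurBound`. In terms of the numbers of gains i, −i, 1, −1, 0 this is an
integer inequality, and solving it gives the other families.

Conversely, two functionals suffice for each graph of the list. The form of a glued graph is the sum
of two forms of positive index at most one; for the others one completes the square in each block
(`multipartite_join_le`) and the `SchurBound` inequality finishes. -/

/-! ### Sesquilinear forms and the positive inertia index. -/

section InertiaIndex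

variable {V W : Type*} [Fintype V] [Fintype W]

/-- The sesquilinear form of a matrix. -/
noncomputable def hform (H : Matrix V V ℂ) (f g : V → ℂ) : ℂ := star f ⬝ᵥ H.mulVec g

theorem hform_eq_sum (H : Matrix V V ℂ) (f g : V → ℂ) :
    hform H f g = ∑ u, ∑ w, star (f u) * H u w * g w := by
  simp only [hform, dotProduct, Matrix.mulVec, Finset.mul_sum, Pi.star_apply, mul_assoc]

theorem hform_add_left (H : Matrix V V ℂ) (f f' g : V → ℂ) :
    hform H (f + f') g = hform H f g + hform H f' g := by
  simp [hform, add_dotProduct]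

theorem hform_add_right (H : Matrix V V ℂ) (f g g' : V → ℂ) :
    hform H f (g + g') = hform H f g + hform H f g' := by
  simp [hform, Matrix.mulVec_add, dotProduct_add]

theorem hform_smul_left (H : Matrix V V ℂ) (c : ℂ) (f g : V → ℂ) :
    hform H (c • f) g = star c * hform H f g := by
  simp [hform, smul_dotProduct]

theorem hform_smul_right (H : Matrix V V ℂ) (c : ℂ) (f g : V → ℂ) :
    hform H f (c • g) = c * hform H f g := by
  simp [hform, Matrix.mulVec_smul, dotProduct_smul]

theorem hform_sum_left {ι : Type*} (H : Matrix V V ℂ) (s : Finset ι) (f : ι → V → ℂ)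
    (g : V → ℂ) : hform H (∑ i ∈ s, f i) g = ∑ i ∈ s, hform H (f i) g := by
  simp [hform, sum_dotProduct]

theorem hform_sum_right {ι : Type*} (H : Matrix V V ℂ) (s : Finset ι) (f : V → ℂ)
    (g : ι → V → ℂ) : hform H f (∑ i ∈ s, g i) = ∑ i ∈ s, hform H f (g i) := by
  simp [hform, Matrix.mulVec_sum, dotProduct_sum]

theorem hform_single_single [DecidableEq V] (H : Matrix V V ℂ) (u w : V) (a b : ℂ) :
    hform H (Pi.single u a) (Pi.single w b) = star a * H u w * b := by
  rw [hform_eq_sum]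
  rw [Finset.sum_eq_single u, Finset.sum_eq_single w] <;> simp +contextual

theorem hform_single_left [DecidableEq V] (H : Matrix V V ℂ) (u : V) (a : ℂ) (z : V → ℂ) :
    hform H (Pi.single u a) z = star a * H.mulVec z u := by
  have h : star (Pi.single u a : V → ℂ) = Pi.single u (star a) := by
    ext w; by_cases h : w = u <;> simp [h]
  rw [hform, h, single_dotProduct]

theorem star_hform {H : Matrix V V ℂ} (hH : H.IsHermitian) (f g : V → ℂ) :
    star (hform H f g) = hform H g f := by
  rw [hform_eq_sum, hform_eq_sum, Finset.sum_comm, star_sum]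
  refine Finset.sum_congr rfl fun u _ => ?_
  rw [star_sum]
  refine Finset.sum_congr rfl fun w _ => ?_
  have := hH.apply u w
  rw [← this]
  simp only [star_mul', star_star]
  ring

/-- There are `d` pairwise orthogonal vectors on which the form of `H` is positive. -/
def PosGe (H : Matrix V V ℂ) (d : ℕ) : Prop :=
  ∃ f : Fin d → V → ℂ, (∀ i j, i ≠ j → hform H (f i) (f j) = 0) ∧
    ∀ i, 0 < (hform H (f i) (f i)).re

/-- The form of `H` is nonpositive on the common kernel of `d` linear functionals. -/
def PosLe (H : Matrix V V ℂ) (d : ℕ) : Prop :=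
  ∃ L : (V → ℂ) →ₗ[ℂ] (Fin d → ℂ), ∀ f, L f = 0 → (hform H f f).re ≤ 0

theorem hform_combination {H : Matrix V V ℂ} {d : ℕ} {f : Fin d → V → ℂ}
    (ho : ∀ i j, i ≠ j → hform H (f i) (f j) = 0) (c : Fin d → ℂ) :
    hform H (∑ i, c i • f i) (∑ i, c i • f i)
      = ∑ i, (Complex.normSq (c i) : ℂ) * hform H (f i) (f i) := by
  rw [hform_sum_left]
  refine Finset.sum_congr rfl fun i _ => ?_
  rw [hform_sum_right, Finset.sum_eq_single i]
  · rw [hform_smul_left, hform_smul_right, Complex.normSq_eq_conj_mul_self]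
    simp only [Complex.star_def]
    ring
  · intro j _ hj
    rw [hform_smul_left, hform_smul_right, ho i j hj.symm]; simp
  · simp

/-- By dimension, some nonzero combination of the d + 1 vectors is killed by the d functionals,
while orthogonality makes its form a positive sum. Linear independence of the vectors is not needed.
-/
theorem PosLe.not_posGe {H : Matrix V V ℂ} {d : ℕ} (h : PosLe H d) : ¬ PosGe H (d + 1) := by
  rintro ⟨f, ho, hp⟩
  obtain ⟨L, hL⟩ := h
  let T : (Fin (d + 1) → ℂ) →ₗ[ℂ] (Fin d → ℂ) := L ∘ₗ Fintype.linearCombination ℂ f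
  have hk : LinearMap.ker T ≠ ⊥ := LinearMap.ker_ne_bot_of_finrank_lt (by simp)
  obtain ⟨c, hc, hc0⟩ := (Submodule.ne_bot_iff _).1 hk
  have h1 := hL (∑ i, c i • f i) (by
    simpa [T, Fintype.linearCombination_apply] using LinearMap.mem_ker.1 hc)
  rw [hform_combination ho, Complex.re_sum] at h1
  have h2 : 0 < ∑ i, ((Complex.normSq (c i) : ℂ) * hform H (f i) (f i)).re := by
    obtain ⟨j, hj⟩ := Function.ne_iff.1 hc0
    refine Finset.sum_pos' (fun i _ => ?_) ⟨j, Finset.mem_univ _, ?_⟩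
    · rw [Complex.re_ofReal_mul]
      exact mul_nonneg (Complex.normSq_nonneg _) (hp i).le
    · rw [Complex.re_ofReal_mul]
      exact mul_pos (Complex.normSq_pos.2 hj) (hp j)
  linarith

theorem PosGe.map {H : Matrix V V ℂ} {H' : Matrix W W ℂ} {d : ℕ} (h : PosGe H' d)
    (T : (W → ℂ) → V → ℂ) (hT : ∀ f g, hform H (T f) (T g) = hform H' f g) : PosGe H d := by
  obtain ⟨f, ho, hp⟩ := h
  refine ⟨fun i => T (f i), fun i j hij => ?_, fun i => ?_⟩
  · rw [hT, ho i j hij]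
  · rw [hT]; exact hp i

theorem PosGe.map_star {H : Matrix V V ℂ} {H' : Matrix W W ℂ} {d : ℕ} (h : PosGe H' d)
    (T : (W → ℂ) → V → ℂ) (hT : ∀ f g, hform H (T f) (T g) = star (hform H' f g)) :
    PosGe H d := by
  obtain ⟨f, ho, hp⟩ := h
  refine ⟨fun i => T (f i), fun i j hij => ?_, fun i => ?_⟩
  · rw [hT, ho i j hij, star_zero]
  · rw [hT]; simpa using hp i

/-! ### Comparison with eigenvalues. -/

section Spectral

variable [DecidableEq V] {H : Matrix V V ℂ} (hH : H.IsHermitian)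

theorem hform_eigenvectorBasis (i j : V) :
    hform H (hH.eigenvectorBasis i).ofLp (hH.eigenvectorBasis j).ofLp
      = if i = j then (hH.eigenvalues j : ℂ) else 0 := by
  have h1 := hH.mulVec_eigenvectorBasis j
  rw [hform, h1]
  have h2 := orthonormal_iff_ite.1 hH.eigenvectorBasis.orthonormal i j
  rw [EuclideanSpace.inner_eq_star_dotProduct, dotProduct_comm] at h2
  rw [dotProduct_smul, h2]
  split_ifs <;> simp

theorem PosGe.of_eigenvalues {d : ℕ} (hd : d ≤ Nat.card {u : V // 0 < hH.eigenvalues u}) :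
    PosGe H d := by
  rw [Nat.card_eq_fintype_card] at hd
  let e := (Fintype.equivFin {u : V // 0 < hH.eigenvalues u}).symm
  refine ⟨fun i => (hH.eigenvectorBasis (e (Fin.castLE hd i)).1).ofLp, fun i j hij => ?_,
    fun i => ?_⟩
  · rw [hform_eigenvectorBasis, if_neg]
    intro h
    exact hij (Fin.castLE_injective hd (e.injective (Subtype.ext h)))
  · rw [hform_eigenvectorBasis, if_pos rfl]
    simpa using (e (Fin.castLE hd i)).2

theorem PosLe.of_eigenvalues {d : ℕ} (hd : Nat.card {u : V // 0 < hH.eigenvalues u} ≤ d) :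
    PosLe H d := by
  rw [Nat.card_eq_fintype_card] at hd
  let e := Fintype.equivFin {u : V // 0 < hH.eigenvalues u}
  let b := hH.eigenvectorBasis
  let L : (V → ℂ) →ₗ[ℂ] (Fin d → ℂ) :=
    { toFun := fun f i => if h : (i : ℕ) < Fintype.card {u : V // 0 < hH.eigenvalues u} then
        b.repr (WithLp.toLp 2 f) (e.symm ⟨i, h⟩) else 0
      map_add' := fun f g => by
        ext i; by_cases h : (i : ℕ) < Fintype.card {u : V // 0 < hH.eigenvalues u} <;> simp [h]
      map_smul' := fun c f => by
        ext i; by_cases h : (i : ℕ) < Fintype.card {u : V // 0 < hH.eigenvalues u} <;> simp [h] }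
  refine ⟨L, fun f hf => ?_⟩
  have hz : ∀ u, 0 < hH.eigenvalues u → b.repr (WithLp.toLp 2 f) u = 0 := by
    intro u hu
    have h1 := congrFun hf ⟨e ⟨u, hu⟩, lt_of_lt_of_le (e ⟨u, hu⟩).2 hd⟩
    simpa [L] using h1
  have hf' : f = ∑ u, b.repr (WithLp.toLp 2 f) u • (b u).ofLp := by
    have h1 := b.sum_repr (WithLp.toLp 2 f)
    have h2 := congrArg WithLp.ofLp h1
    simpa using h2.symm
  have : hform H f f = ∑ u, (Complex.normSq (b.repr (WithLp.toLp 2 f) u) : ℂ)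
      * (hH.eigenvalues u : ℂ) := by
    conv_lhs => rw [hf']
    rw [hform_sum_left]
    refine Finset.sum_congr rfl fun u _ => ?_
    rw [hform_sum_right, Finset.sum_eq_single u]
    · rw [hform_smul_left, hform_smul_right, hform_eigenvectorBasis, if_pos rfl,
        Complex.normSq_eq_conj_mul_self]
      simp only [Complex.star_def]
      ring
    · intro w _ hw
      rw [hform_smul_left, hform_smul_right, hform_eigenvectorBasis, if_neg hw.symm]; simp
    · simp
  rw [this, Complex.re_sum]
  refine Finset.sum_nonpos fun u _ => ?_
  rw [Complex.re_ofReal_mul, Complex.ofReal_re]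
  rcases lt_or_ge 0 (hH.eigenvalues u) with h | h
  · rw [hz u h]; simp
  · exact mul_nonpos_of_nonneg_of_nonpos (Complex.normSq_nonneg _) h

end Spectral

theorem MixedGraph.posGe_iff [DecidableEq V] (G : MixedGraph V) (d : ℕ) :
    PosGe G.herm d ↔ d ≤ G.posInertia := by
  refine ⟨fun h => ?_, fun h => PosGe.of_eigenvalues G.isHermitian_herm h⟩
  by_contra! hlt
  obtain ⟨d, rfl⟩ : ∃ d', d = d' + 1 := ⟨d - 1, by omega⟩
  exact (PosLe.of_eigenvalues G.isHermitian_herm (d := d) (by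
    have : G.posInertia ≤ d := by omega
    exact this)).not_posGe h

/-- A vector orthogonal to a maximal family of positive vectors on which the form is nonnegative
lies in the kernel. -/
theorem mulVec_eq_zero_of_maximal [DecidableEq V] {H : Matrix V V ℂ} (hH : H.IsHermitian) {d : ℕ}
    (hd : ¬ PosGe H (d + 1)) {f : Fin d → V → ℂ}
    (ho : ∀ i j, i ≠ j → hform H (f i) (f j) = 0) (hp : ∀ i, 0 < (hform H (f i) (f i)).re)
    {z : V → ℂ} (hz : ∀ i, hform H (f i) z = 0) (hq : 0 ≤ (hform H z z).re) :
    H.mulVec z = 0 := by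
  by_contra hne
  obtain ⟨x, hx⟩ := Function.ne_iff.1 hne
  -- The part of e_x orthogonal to the family. As z is orthogonal to the family too, pairing `g`
  -- with z still reads off the entry (Hz)_x.
  let g : V → ℂ := Pi.single x 1 - ∑ i, (hform H (f i) (Pi.single x 1) / hform H (f i) (f i)) • f i
  have hfg : ∀ j, hform H (f j) g = 0 := by
    intro j
    have hjj : hform H (f j) (f j) ≠ 0 := fun h => by
      have := hp j; rw [h] at this; simp at this
    simp only [g]
    rw [sub_eq_add_neg, hform_add_right, ← neg_one_smul ℂ, hform_smul_right, hform_sum_right,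
      Finset.sum_eq_single j]
    · rw [hform_smul_right]; field_simp; ring
    · intro i _ hi
      rw [hform_smul_right, ho j i hi.symm, mul_zero]
    · simp
  have hzf : ∀ i, hform H z (f i) = 0 := fun i => by rw [← star_hform hH, hz, star_zero]
  have hgz : hform H g z = H.mulVec z x := by
    simp only [g]
    rw [sub_eq_add_neg, hform_add_left, ← neg_one_smul ℂ, hform_smul_left, hform_sum_left,
      Finset.sum_eq_zero, hform_single_left]
    · simp
    · intro i _
      rw [hform_smul_left, hz, mul_zero]
  set m := H.mulVec z x with hm
  have hm0 : 0 < Complex.normSq m := Complex.normSq_pos.2 hx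
  -- Moving z a little in the direction m·g increases the form to first order by 2t|m|². The chosen
  -- t keeps the second-order term from cancelling this, so a further positive vector appears.
  obtain ⟨t, ht0, ht⟩ : ∃ t : ℝ, 0 < t ∧ 0 < 2 * t * Complex.normSq m
      + t ^ 2 * Complex.normSq m * (hform H g g).re := by
    refine ⟨1 / (1 + |(hform H g g).re|), by positivity, ?_⟩
    have h1 : -|(hform H g g).re| ≤ (hform H g g).re := neg_abs_le _
    set A := |(hform H g g).re|
    have hA : 0 ≤ A := abs_nonneg _
    have h2 : 2 * (1 / (1 + A)) * Complex.normSq m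
        + (1 / (1 + A)) ^ 2 * Complex.normSq m * (hform H g g).re
        = Complex.normSq m * (2 * (1 + A) + (hform H g g).re) / (1 + A) ^ 2 := by
      field_simp
    rw [h2]
    apply div_pos _ (by positivity)
    apply mul_pos hm0
    linarith
  let y : V → ℂ := z + ((t : ℂ) * m) • g
  have hy : 0 < (hform H y y).re := by
    have hzg : hform H z g = star m := by rw [← hgz, star_hform hH]
    have : hform H y y = hform H z z + ((2 * t * Complex.normSq m : ℝ) : ℂ)
        + ((t ^ 2 * Complex.normSq m : ℝ) : ℂ) * hform H g g := by
      simp only [y]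
      rw [hform_add_left, hform_add_right, hform_add_right, hform_smul_left, hform_smul_left,
        hform_smul_right, hform_smul_right, hzg, hgz]
      push_cast
      rw [Complex.normSq_eq_conj_mul_self]
      simp only [star_mul', Complex.star_def, Complex.conj_ofReal]
      ring
    rw [this, Complex.add_re, Complex.add_re, Complex.re_ofReal_mul, Complex.ofReal_re]
    linarith
  have hfy : ∀ i, hform H (f i) y = 0 := fun i => by
    simp only [y]
    rw [hform_add_right, hform_smul_right, hz, hfg]; simp
  refine hd ⟨Fin.snoc f y, fun i j => ?_, fun i => ?_⟩
  · refine Fin.lastCases ?_ (fun i => ?_) i <;> refine Fin.lastCases ?_ (fun j => ?_) j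
    · simp
    · intro _
      simp only [Fin.snoc_last, Fin.snoc_castSucc]
      rw [← star_hform hH, hfy, star_zero]
    · intro _
      simpa using hfy i
    · intro hij
      simpa using ho i j (fun h => hij (by rw [h]))
  · refine Fin.lastCases ?_ (fun i => ?_) i
    · simpa using hy
    · simpa using hp i

end InertiaIndex

/-! ### Fourth roots of unity. -/

section FourthRoots

/-- `z` is one of `1`, `-1`, `i`, `-i`. -/
def IsFourthRoot (z : ℂ) : Prop := z = 1 ∨ z = -1 ∨ z = Complex.I ∨ z = -Complex.I

namespace IsFourthRoot

theorem one : IsFourthRoot 1 := Or.inl rfl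

theorem I : IsFourthRoot Complex.I := Or.inr (Or.inr (Or.inl rfl))

theorem neg {z : ℂ} (hz : IsFourthRoot z) : IsFourthRoot (-z) := by
  rcases hz with rfl | rfl | rfl | rfl <;> simp [IsFourthRoot]

theorem mul {z w : ℂ} (hz : IsFourthRoot z) (hw : IsFourthRoot w) : IsFourthRoot (z * w) := by
  rcases hz with rfl | rfl | rfl | rfl <;> rcases hw with rfl | rfl | rfl | rfl <;>
    simp [IsFourthRoot]

theorem star {z : ℂ} (hz : IsFourthRoot z) : IsFourthRoot (star z) := by
  rcases hz with rfl | rfl | rfl | rfl <;> simp [IsFourthRoot]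

theorem ne_zero {z : ℂ} (hz : IsFourthRoot z) : z ≠ 0 := by
  rcases hz with rfl | rfl | rfl | rfl <;> simp

theorem mul_star {z : ℂ} (hz : IsFourthRoot z) : z * Star.star z = 1 := by
  rcases hz with rfl | rfl | rfl | rfl <;> simp

theorem star_mul {z : ℂ} (hz : IsFourthRoot z) : Star.star z * z = 1 := by
  rw [mul_comm, hz.mul_star]

theorem inv_eq {z : ℂ} (hz : IsFourthRoot z) : z⁻¹ = Star.star z :=
  inv_eq_of_mul_eq_one_right hz.mul_star

/-- Conceptually, every fourth root of unity is 1 modulo 1 + i, so a sum of three of them is odd.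
This turns a kernel relation on a triangle into the vanishing of one of its three terms. -/
theorem add_add_ne_zero {x y z : ℂ} (hx : IsFourthRoot x) (hy : IsFourthRoot y)
    (hz : IsFourthRoot z) : x + y + z ≠ 0 := by
  intro h
  have h1 := congrArg Complex.re h
  have h2 := congrArg Complex.im h
  rcases hx with rfl | rfl | rfl | rfl <;> rcases hy with rfl | rfl | rfl | rfl <;>
    rcases hz with rfl | rfl | rfl | rfl <;> (try norm_num at h1) <;> (try norm_num at h2)

end IsFourthRoot

end FourthRoots

/-! ### Structure of a connected block with a single positive direction. -/

section GainMatrix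

variable {V : Type*}

/-- Hermitian matrices with zero diagonal and entries in `{0, ±1, ±i}`. -/
structure IsGainMatrix (H : Matrix V V ℂ) : Prop where
  isHermitian : H.IsHermitian
  entry : ∀ u w, H u w = 0 ∨ IsFourthRoot (H u w)
  diag : ∀ u, H u u = 0

/-- Any two non-adjacent vertices of `S` have proportional rows. -/
def HasTwins (H : Matrix V V ℂ) (S : Set V) : Prop :=
  ∀ u ∈ S, ∀ w ∈ S, H u w = 0 → ∃ c, IsFourthRoot c ∧ ∀ x, H u x = c * H w x

/-- The vertex set `S` is connected. -/
def IsConnectedOn (H : Matrix V V ℂ) (S : Set V) : Prop :=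
  ∀ A : Set V, (∃ u ∈ S, u ∈ A) → (∀ u ∈ S, u ∈ A → ∀ w ∈ S, H u w ≠ 0 → w ∈ A) → S ⊆ A

/-- Among the vectors supported on `S`, those that are orthogonal to a positive vector and on which
the form is nonnegative lie in the kernel. -/
def IsHyperbolicOn [Fintype V] (H : Matrix V V ℂ) (S : Set V) : Prop :=
  ∀ f z : V → ℂ, (∀ x ∉ S, f x = 0) → (∀ x ∉ S, z x = 0) → 0 < (hform H f f).re →
    hform H f z = 0 → 0 ≤ (hform H z z).re → H.mulVec z = 0

/-- On `S`, the matrix is switching equivalent to the adjacency matrix of a graph. -/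
def IsBalancedOn (H : Matrix V V ℂ) (S : Set V) : Prop :=
  ∃ s : V → ℂ, (∀ u, IsFourthRoot (s u)) ∧
    ∀ u ∈ S, ∀ w ∈ S, H u w = 0 ∨ H u w = s u * star (s w)

/-- The entries of the Hermitian matrix of a triangle with gains `τ`, `τ`, `τ`. -/
def triangleEntry (τ : ℂ) (j l : Fin 3) : ℂ :=
  if j = l then 0 else if j + 1 = l then τ else -τ

/-- On `S`, the matrix is, up to switching, a blow-up of a triangle of gain `±i`. -/
structure IsTriangularOn (H : Matrix V V ℂ) (S : Set V) (u : Fin 3 → V) (s : Fin 3 → ℂ)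
    (τ : ℂ) : Prop where
  mem : ∀ j, u j ∈ S
  unit : ∀ j, IsFourthRoot (s j)
  gain : τ = Complex.I ∨ τ = -Complex.I
  entry : ∀ j l, H (u j) (u l) = s j * star (s l) * triangleEntry τ j l
  kernel : ∀ x, H x (u 0) * s 0 + H x (u 1) * s 1 + H x (u 2) * s 2 = 0
  twin : ∀ w ∈ S, ∃ l c, IsFourthRoot c ∧ ∀ x, H w x = c * H (u l) x

namespace IsGainMatrix

variable {H : Matrix V V ℂ}

theorem apply (hH : IsGainMatrix H) (u w : V) : star (H w u) = H u w :=
  hH.isHermitian.apply u w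

theorem eq_zero_comm (hH : IsGainMatrix H) {u w : V} : H u w = 0 ↔ H w u = 0 := by
  rw [← hH.apply u w, star_eq_zero]

theorem isFourthRoot (hH : IsGainMatrix H) {u w : V} (h : H u w ≠ 0) : IsFourthRoot (H u w) :=
  (hH.entry u w).resolve_left h

theorem mul_symm (hH : IsGainMatrix H) {u w : V} (h : H u w ≠ 0) : H u w * H w u = 1 := by
  rw [← hH.apply w u, (hH.isFourthRoot h).mul_star]

/-- The combination `z` of e_u and e_w that cancels at t is isotropic, because u and w are
nonadjacent, and it is orthogonal to the positive vector of the edge ut. So it lies in the kernel,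
and this is a proportionality of full rows, including entries outside S. -/
theorem exists_twin_of_common_neighbor [Fintype V] (hH : IsGainMatrix H) {S : Set V}
    (hS : IsHyperbolicOn H S) {u w t : V} (hu : u ∈ S) (hw : w ∈ S) (ht : t ∈ S)
    (huw : H u w = 0) (hut : H u t ≠ 0) (hwt : H w t ≠ 0) :
    ∃ c, IsFourthRoot c ∧ ∀ x, H u x = c * H w x := by
  classical
  have hut' := hH.isFourthRoot hut
  have hwt' := hH.isFourthRoot hwt
  let f : V → ℂ := Pi.single t 1 + Pi.single u (H u t)
  let z : V → ℂ := Pi.single u (H u t) + Pi.single w (-H w t)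
  have hf : ∀ x ∉ S, f x = 0 := by
    intro x hx
    have h1 : x ≠ t := fun h => hx (h ▸ ht)
    have h2 : x ≠ u := fun h => hx (h ▸ hu)
    simp [f, h1, h2]
  have hz : ∀ x ∉ S, z x = 0 := by
    intro x hx
    have h1 : x ≠ w := fun h => hx (h ▸ hw)
    have h2 : x ≠ u := fun h => hx (h ▸ hu)
    simp [z, h1, h2]
  have huw' := hH.eq_zero_comm.1 huw
  have e1 := hH.mul_symm hut
  have e2 := hH.mul_symm hwt
  have e3 := hut'.star_mul
  have key := hS f z hf hz (by
      simp only [f, hform_add_left, hform_add_right, hform_single_single, hH.diag]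
      have : star (1 : ℂ) * 0 * 1 + star (H u t) * H u t * 1
          + (star 1 * H t u * H u t + star (H u t) * 0 * H u t) = 2 := by
        rw [star_one]; linear_combination e1 + e3
      rw [this]; norm_num) (by
      simp only [f, z, hform_add_left, hform_add_right, hform_single_single, hH.diag, huw]
      rw [star_one]
      linear_combination e1 - e2) (by
      simp only [z, hform_add_left, hform_add_right, hform_single_single, hH.diag, huw, huw']
      simp)
  refine ⟨H u t * star (H w t), hut'.mul hwt'.star, fun x => ?_⟩
  have h1 : hform H (Pi.single x 1) z = 0 := by rw [hform_single_left, key]; simp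
  simp only [z, hform_add_right, hform_single_single, star_one, one_mul] at h1
  have h2 := congrArg star h1
  simp only [star_add, star_mul', star_neg, star_zero, hH.apply] at h2
  rw [hH.apply t w]
  linear_combination (H u t) * h2 - H u x * e1

theorem hasTwins [Fintype V] (hH : IsGainMatrix H) {S : Set V} (hS : IsHyperbolicOn H S)
    (hc : IsConnectedOn H S) : HasTwins H S := by
  intro u hu w hw huw
  by_cases hne : u = w
  · subst hne; exact ⟨1, IsFourthRoot.one, fun x => by simp⟩
  -- The vertices of S at distance at most two from u are closed under adjacency: one at distance
  -- two has, up to a unit, the row of u, so its neighbours are neighbours of u. Connectedness then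
  -- gives every nonadjacent w a common neighbour with u.
  have hA := hc {w | w = u ∨ H u w ≠ 0 ∨ ∃ t ∈ S, H u t ≠ 0 ∧ H w t ≠ 0} ⟨u, hu, Or.inl rfl⟩ (by
    rintro x hx hxA y hy hxy
    rcases hxA with rfl | h | ⟨t, ht, hut, hxt⟩
    · exact Or.inr (Or.inl hxy)
    · exact Or.inr (Or.inr ⟨x, hx, h, fun h' => hxy (hH.eq_zero_comm.1 h')⟩)
    · by_cases hux : H u x = 0
      · obtain ⟨c, hc, h⟩ := hH.exists_twin_of_common_neighbor hS hu hx ht hux hut hxt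
        exact Or.inr (Or.inl (by rw [h]; exact mul_ne_zero hc.ne_zero hxy))
      · exact Or.inr (Or.inr ⟨x, hx, hux, fun h' => hxy (hH.eq_zero_comm.1 h')⟩)) hw
  rcases hA with h | h | ⟨t, ht, hut, hwt⟩
  · exact absurd h.symm hne
  · exact absurd huw h
  · exact hH.exists_twin_of_common_neighbor hS hu hw ht huw hut hwt

/-- Switch by the column of a base vertex u₀: a neighbour gets its own entry, a nonneighbour its
proportionality factor to u₀. Triangles through u₀ check the entries between two neighbours; two
nonneighbours are nonadjacent. -/
theorem isBalancedOn (hH : IsGainMatrix H) {S : Set V} (hS : HasTwins H S)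
    (htri : ∀ u ∈ S, ∀ w ∈ S, ∀ t ∈ S, H u w ≠ 0 → H w t ≠ 0 → H t u ≠ 0 →
      H u w * H w t * H t u = 1) : IsBalancedOn H S := by
  rcases S.eq_empty_or_nonempty with rfl | ⟨u₀, hu₀⟩
  · exact ⟨fun _ => 1, fun _ => IsFourthRoot.one, by simp⟩
  have hex : ∀ w, ∃ s, IsFourthRoot s ∧ (w ∈ S → (H w u₀ ≠ 0 ∧ s = H w u₀) ∨
      (H w u₀ = 0 ∧ ∀ x, H w x = s * H u₀ x)) := by
    intro w
    by_cases hw : w ∈ S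
    · by_cases h0 : H w u₀ = 0
      · obtain ⟨c, hc, h⟩ := hS w hw u₀ hu₀ h0
        exact ⟨c, hc, fun _ => Or.inr ⟨h0, h⟩⟩
      · exact ⟨_, hH.isFourthRoot h0, fun _ => Or.inl ⟨h0, rfl⟩⟩
    · exact ⟨1, IsFourthRoot.one, fun h => absurd h hw⟩
  choose s hs hs' using hex
  refine ⟨s, hs, fun w hw x hx => or_iff_not_imp_left.2 fun hwx => ?_⟩
  rcases hs' w hw with ⟨h1, h2⟩ | ⟨h1, h2⟩
  · rcases hs' x hx with ⟨h3, h4⟩ | ⟨h3, h4⟩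
    · have := htri w hw x hx u₀ hu₀ hwx h3 (fun h => h1 (hH.eq_zero_comm.1 h))
      have e1 := hH.mul_symm h1
      have e2 := hH.mul_symm h3
      rw [h2, h4, hH.apply]
      linear_combination (H u₀ x * H w u₀) * this - H w x * H w u₀ * H u₀ w * e2 - H w x * e1
    · rw [h2, ← hH.apply w x, h4, star_mul', hH.apply, mul_comm]
  · rcases hs' x hx with ⟨h3, h4⟩ | ⟨h3, h4⟩
    · rw [h2, h4, hH.apply]
    · exact absurd (by rw [h2, hH.eq_zero_comm.1 h3, mul_zero]) hwx

/-- A triangle of gain −1 has eigenvalues 1, 1, −2, one positive direction too many. One of gain ±i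
is singular, and its isotropic kernel vector is then in the kernel of all of H, which ties every
other vertex of S to a corner. -/
theorem exists_isTriangularOn [Fintype V] (hH : IsGainMatrix H) {S : Set V}
    (hS : IsHyperbolicOn H S) (hT : HasTwins H S) {p q r : V} (hp : p ∈ S) (hq : q ∈ S)
    (hr : r ∈ S) (hpq : H p q ≠ 0) (hqr : H q r ≠ 0) (hrp : H r p ≠ 0)
    (hg : H p q * H q r * H r p ≠ 1) : ∃ u s τ, IsTriangularOn H S u s τ := by
  classical
  have e1 := hH.mul_symm hpq
  have e2 := hH.mul_symm hqr
  have e3 := hH.mul_symm hrp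
  have up := hH.isFourthRoot hpq
  have uq := hH.isFourthRoot hqr
  have ur := hH.isFourthRoot hrp
  obtain ⟨g, hgdef⟩ : ∃ g, g = H p q * H q r * H r p := ⟨_, rfl⟩
  have hgu : IsFourthRoot g := hgdef ▸ (up.mul uq).mul ur
  have hqr' : H q r = g * H q p * H p r := by
    rw [hgdef]; linear_combination (-H q r) * e1 - H p q * H q p * H q r * e3
  have hrq' : H r q = star g * H p q * H r p := by
    rw [← hH.apply r q, hqr', star_mul', star_mul', hH.apply, hH.apply]
  have hsupp : ∀ a b c : ℂ, ∀ x ∉ S,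
      (Pi.single p a + Pi.single q b + Pi.single r c : V → ℂ) x = 0 := by
    intro a b c x hx
    have h1 : x ≠ p := fun h => hx (h ▸ hp)
    have h2 : x ≠ q := fun h => hx (h ▸ hq)
    have h3 : x ≠ r := fun h => hx (h ▸ hr)
    simp [h1, h2, h3]
  have hgne : g ≠ 1 := hgdef ▸ hg
  have hform3 : ∀ a b c a' b' c' : ℂ,
      hform H (Pi.single p a + Pi.single q b + Pi.single r c)
        (Pi.single p a' + Pi.single q b' + Pi.single r c')
      = star a * H p q * b' + star a * H p r * c' + star b * H q p * a'
        + star b * (g * H q p * H p r) * c' + star c * H r p * a'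
        + star c * (star g * H p q * H r p) * b' := by
    intro a b c a' b' c'
    rw [← hqr', ← hrq']
    simp only [hform_add_left, hform_add_right, hform_single_single, hH.diag]
    ring
  have hker : ∀ x (a b c : ℂ), H.mulVec (Pi.single p a + Pi.single q b + Pi.single r c) = 0 →
      H x p * a + H x q * b + H x r * c = 0 := by
    intro x a b c h
    have h1 : hform H (Pi.single x 1) (Pi.single p a + Pi.single q b + Pi.single r c) = 0 := by
      rw [hform_single_left, h]; simp
    simpa only [hform_add_right, hform_single_single, star_one, one_mul] using h1
  have hspr : star (H p r) = H r p := hH.apply r p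
  have hsqp : star (H q p) = H p q := hH.apply p q
  have hsrp : star (H r p) = H p r := hH.apply p r
  have hspq : star (H p q) = H q p := hH.apply q p
  have hcase : g = -1 ∨ g = Complex.I ∨ g = -Complex.I := hgu.resolve_left hgne
  rcases hcase with hg1 | hgI
  -- With the gains at p switched to 1, the vectors are (1, 1, 0) and (1, −1, 2). The second is an
  -- eigenvector of the triangle for the eigenvalue 1, so it cannot be in the kernel.
  · exfalso
    have := hS (Pi.single p 1 + Pi.single q (H q p) + Pi.single r 0)
      (Pi.single p 1 + Pi.single q (-H q p) + Pi.single r (2 * H r p)) (hsupp _ _ _)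
      (hsupp _ _ _) (by
        rw [hform3, hg1, hsqp]
        simp only [star_one, star_zero, star_neg]
        have : 1 * H p q * H q p + 1 * H p r * 0 + H p q * H q p * 1
            + H p q * (-1 * H q p * H p r) * 0 + 0 * H r p * 1
            + 0 * (-1 * H p q * H r p) * H q p = 2 := by
          linear_combination 2 * e1
        rw [this]; norm_num) (by
        rw [hform3, hg1, hsqp]
        simp only [star_one, star_zero, star_neg]
        linear_combination (-2 * H p r * H r p) * e1) (by
        rw [hform3, hg1]
        simp only [star_one, star_neg, star_mul', hsqp, hsrp, star_ofNat]
        have : 1 * H p q * -H q p + 1 * H p r * (2 * H r p) + -H p q * H q p * 1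
            + -H p q * (-1 * H q p * H p r) * (2 * H r p) + 2 * H p r * H r p * 1
            + 2 * H p r * (-1 * H p q * H r p) * -H q p = 6 := by
          linear_combination (-2 + 4 * H p r * H r p) * e1 + 8 * e3
        rw [this]; norm_num)
    have h1 := hker p _ _ _ this
    rw [hH.diag] at h1
    have : (1 : ℂ) = 0 := by linear_combination h1 + e1 - 2 * e3
    exact one_ne_zero this
  have hgg : star g = -g := by rcases hgI with rfl | rfl <;> simp
  have hgsq : g * g = -1 := by rcases hgI with rfl | rfl <;> simp
  -- In the same normalization this is (1, −g, g), the kernel vector of the triangle when g² = −1.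
  have key : H.mulVec (Pi.single p 1 + Pi.single q (-g * H q p) + Pi.single r (g * H r p)) = 0 := by
    refine hS (Pi.single p 1 + Pi.single q (H q p) + Pi.single r 0) _ (hsupp _ _ _)
      (hsupp _ _ _) ?_ ?_ ?_
    · rw [hform3, hsqp]
      simp only [star_one, star_zero]
      have : 1 * H p q * H q p + 1 * H p r * 0 + H p q * H q p * 1
          + H p q * (g * H q p * H p r) * 0 + 0 * H r p * 1
          + 0 * (star g * H p q * H r p) * H q p = 2 := by
        linear_combination 2 * e1
      rw [this]; norm_num
    · rw [hform3, hsqp]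
      simp only [star_one, star_zero]
      linear_combination (1 - g + g * g * H p r * H r p) * e1 + (g + g * g) * e3 + hgsq
    · rw [hform3]
      simp only [star_one, star_neg, star_mul', hsqp, hsrp, hgg]
      refine le_of_eq ?_
      rw [← Complex.zero_re]
      congr 1
      linear_combination (g ^ 3 * H p r * H r p - g ^ 3 * H p r * H r p) * e1
  have hker' : ∀ x, H x p * 1 + H x q * (-g * H q p) + H x r * (g * H r p) = 0 := fun x =>
    hker x _ _ _ key
  have uqp : IsFourthRoot (H q p) := by rw [← hspq]; exact up.star
  -- Switching by the coordinates of the kernel vector makes the three gains equal, each to −g; this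
  -- agrees with the cycle gain since (−g)³ = g.
  refine ⟨![p, q, r], ![1, -g * H q p, g * H r p], -g, ?_, ?_, ?_, ?_, ?_, ?_⟩
  · intro j; fin_cases j <;> simp [hp, hq, hr]
  · intro j
    fin_cases j
    · exact IsFourthRoot.one
    · exact hgu.neg.mul uqp
    · exact hgu.mul ur
  · rcases hgI with rfl | rfl <;> simp
  · intro j l
    fin_cases j <;> fin_cases l <;>
      simp only [triangleEntry, Fin.zero_eta, Fin.mk_one, Fin.reduceFinMk, Fin.isValue, hH.diag,
        Matrix.cons_val_zero, Matrix.cons_val_one, Matrix.cons_val, Fin.reduceAdd, Fin.reduceEq,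
        if_true, if_false, star_mul', star_neg, star_one, hgg, hsqp, hsrp, mul_zero]
    · linear_combination H p q * hgsq
    · linear_combination H p r * hgsq
    · linear_combination H q p * hgsq
    · linear_combination hqr' + g * H q p * H p r * hgsq
    · linear_combination H r p * hgsq
    · rw [hrq', hgg]; linear_combination -g * H r p * H p q * hgsq
  · intro x
    simpa using hker' x
  · intro w hw
    -- Otherwise the kernel relation in row w would be a vanishing sum of three fourth roots. So w
    -- is nonadjacent to some corner and a twin of it.
    have hzero : H w p = 0 ∨ H w q = 0 ∨ H w r = 0 := by
      by_contra! h
      exact IsFourthRoot.add_add_ne_zero ((hH.isFourthRoot h.1).mul IsFourthRoot.one)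
        ((hH.isFourthRoot h.2.1).mul (hgu.neg.mul uqp))
        ((hH.isFourthRoot h.2.2).mul (hgu.mul ur)) (hker' w)
    rcases hzero with h | h | h
    · exact ⟨0, hT w hw p hp h⟩
    · exact ⟨1, hT w hw q hq h⟩
    · exact ⟨2, hT w hw r hr h⟩

theorem isBalancedOn_or_isTriangularOn [Fintype V] (hH : IsGainMatrix H) {S : Set V}
    (hS : IsHyperbolicOn H S) (hc : IsConnectedOn H S) :
    IsBalancedOn H S ∨ ∃ u s τ, IsTriangularOn H S u s τ := by
  have hT := hH.hasTwins hS hc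
  by_cases h : ∀ u ∈ S, ∀ w ∈ S, ∀ t ∈ S, H u w ≠ 0 → H w t ≠ 0 → H t u ≠ 0 →
      H u w * H w t * H t u = 1
  · exact Or.inl (hH.isBalancedOn hT h)
  · push Not at h
    obtain ⟨u, hu, w, hw, t, ht, h1, h2, h3, h4⟩ := h
    exact Or.inr (hH.exists_isTriangularOn hS hT hu hw ht h1 h2 h3 h4)

end IsGainMatrix

end GainMatrix

namespace MixedGraph

variable {V : Type*} (G : MixedGraph V)

theorem herm_ne_zero_iff {u w : V} : G.herm u w ≠ 0 ↔ G.graph.Adj u w := by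
  simp only [herm, graph]
  split_ifs <;> simp_all

theorem isGainMatrix_herm : IsGainMatrix G.herm where
  isHermitian := G.isHermitian_herm
  entry u w := by
    simp only [herm, IsFourthRoot]
    split_ifs <;> simp
  diag u := by
    by_contra h
    exact G.graph.loopless.irrefl u (G.herm_ne_zero_iff.1 h)

end MixedGraph

/-! ### The two sides of the cut vertex. -/

section Split

variable {V : Type*} [Fintype V] [DecidableEq V]

/-- A positive vector supported on an edge. -/
noncomputable def edgeVector (H : Matrix V V ℂ) (u w : V) : V → ℂ :=
  Pi.single u 1 + Pi.single w (H w u)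

theorem IsGainMatrix.hform_edgeVector {H : Matrix V V ℂ} (hH : IsGainMatrix H) {u w : V}
    (h : H u w ≠ 0) : hform H (edgeVector H u w) (edgeVector H u w) = 2 := by
  simp only [edgeVector, hform_add_left, hform_add_right, hform_single_single, hH.diag, hH.apply,
    star_one]
  linear_combination 2 * hH.mul_symm h

omit [Fintype V] in
theorem edgeVector_eq_zero (H : Matrix V V ℂ) {S : Set V} {u w x : V} (hu : u ∈ S) (hw : w ∈ S)
    (hx : x ∉ S) : edgeVector H u w x = 0 := by
  have h1 : x ≠ u := fun h => hx (h ▸ hu)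
  have h2 : x ≠ w := fun h => hx (h ▸ hw)
  simp [edgeVector, h1, h2]

omit [DecidableEq V] in
theorem hform_eq_zero_of_support {H : Matrix V V ℂ} {S S' : Set V} {f g : V → ℂ}
    (hf : ∀ x ∉ S, f x = 0) (hg : ∀ x ∉ S', g x = 0) (h : ∀ u ∈ S, ∀ w ∈ S', H u w = 0) :
    hform H f g = 0 := by
  rw [hform_eq_sum]
  refine Finset.sum_eq_zero fun u _ => Finset.sum_eq_zero fun w _ => ?_
  by_cases hu : u ∈ S
  · by_cases hw : w ∈ S'
    · rw [h u hu w hw]; simp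
    · rw [hg w hw]; simp
  · rw [hf u hu]; simp

theorem IsGainMatrix.posGe_of_edges {H : Matrix V V ℂ} (hH : IsGainMatrix H) {d : ℕ}
    (S : Fin d → Set V) (hS : ∀ i j, i ≠ j → ∀ u ∈ S i, ∀ w ∈ S j, H u w = 0)
    (he : ∀ i, ∃ u ∈ S i, ∃ w ∈ S i, H u w ≠ 0) : PosGe H d := by
  choose u hu w hw h using he
  refine ⟨fun i => edgeVector H (u i) (w i), fun i j hij => ?_, fun i => ?_⟩
  · exact hform_eq_zero_of_support (fun x hx => edgeVector_eq_zero H (hu i) (hw i) hx)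
      (fun x hx => edgeVector_eq_zero H (hu j) (hw j) hx) (hS i j hij)
  · rw [hH.hform_edgeVector (h i)]; norm_num

/-- The vertices other than `v` are split into two connected sets `S`, `S'` without edges between
them; each of them contains an edge and a neighbor of `v`. -/
structure IsSplit (H : Matrix V V ℂ) (v : V) (S S' : Set V) : Prop where
  notMem_left : v ∉ S
  notMem_right : v ∉ S'
  cover : ∀ x, x = v ∨ x ∈ S ∨ x ∈ S'
  disjoint : ∀ x ∈ S, x ∉ S'
  zero : ∀ u ∈ S, ∀ w ∈ S', H u w = 0
  connected_left : IsConnectedOn H S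
  connected_right : IsConnectedOn H S'
  edge_left : ∃ u ∈ S, ∃ w ∈ S, H u w ≠ 0
  edge_right : ∃ u ∈ S', ∃ w ∈ S', H u w ≠ 0
  adj_left : ∃ u ∈ S, H v u ≠ 0
  adj_right : ∃ u ∈ S', H v u ≠ 0

omit [Fintype V] [DecidableEq V] in
theorem IsSplit.symm {H : Matrix V V ℂ} (hH : IsGainMatrix H) {v : V} {S S' : Set V}
    (h : IsSplit H v S S') : IsSplit H v S' S where
  notMem_left := h.notMem_right
  notMem_right := h.notMem_left
  cover x := by have := h.cover x; tauto
  disjoint x hx hx' := h.disjoint x hx' hx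
  zero u hu w hw := hH.eq_zero_comm.1 (h.zero w hw u hu)
  connected_left := h.connected_right
  connected_right := h.connected_left
  edge_left := h.edge_right
  edge_right := h.edge_left
  adj_left := h.adj_right
  adj_right := h.adj_left

/-- An edge vector of S' is orthogonal to everything on S, so together with f it is a family of two
positive vectors, and this is maximal. -/
theorem IsSplit.isHyperbolicOn {H : Matrix V V ℂ} (hH : IsGainMatrix H) {v : V} {S S' : Set V}
    (h : IsSplit H v S S') (h3 : ¬ PosGe H 3) : IsHyperbolicOn H S := by
  intro f z hf hz hpos ho hq
  obtain ⟨u, hu, w, hw, huw⟩ := h.edge_right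
  have hsupp : ∀ x ∉ S', edgeVector H u w x = 0 := fun x hx => edgeVector_eq_zero H hu hw hx
  have h1 := hform_eq_zero_of_support hf hsupp h.zero
  have h2 := hform_eq_zero_of_support hz hsupp h.zero
  refine mulVec_eq_zero_of_maximal hH.isHermitian h3 (f := ![f, edgeVector H u w]) ?_ ?_ ?_ hq
  · intro i j hij
    fin_cases i <;> fin_cases j
    · exact absurd rfl hij
    · exact h1
    · change hform H (edgeVector H u w) f = 0
      rw [← star_hform hH.isHermitian, h1, star_zero]
    · exact absurd rfl hij
  · intro i
    fin_cases i
    · exact hpos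
    · change 0 < (hform H (edgeVector H u w) (edgeVector H u w)).re
      rw [hH.hform_edgeVector huw]; norm_num
  · intro i
    fin_cases i
    · exact ho
    · change hform H (edgeVector H u w) z = 0
      rw [← star_hform hH.isHermitian, h2, star_zero]

theorem IsGainMatrix.isHyperbolicOn_univ {H : Matrix V V ℂ} (hH : IsGainMatrix H)
    (h2 : ¬ PosGe H 2) : IsHyperbolicOn H Set.univ := by
  intro f z _ _ hpos ho hq
  refine mulVec_eq_zero_of_maximal hH.isHermitian h2 (f := fun _ : Fin 1 => f) ?_ ?_ ?_ hq
  · intro i j hij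
    exact absurd (Subsingleton.elim i j) hij
  · exact fun _ => hpos
  · exact fun _ => ho

end Split

/-! ### Components of the graph without the cut vertex. -/

section CutVertex

variable {V : Type*} {S : SimpleGraph V} {v : V}

/-- The vertices of a component of the graph without `v`. -/
def componentSupport (c : (S.induce {v}ᶜ).ConnectedComponent) : Set V :=
  {u | ∃ h : u ∈ ({v}ᶜ : Set V), (S.induce {v}ᶜ).connectedComponentMk ⟨u, h⟩ = c}

theorem notMem_componentSupport (c : (S.induce {v}ᶜ).ConnectedComponent) :
    v ∉ componentSupport c := fun ⟨h, _⟩ => h rfl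

theorem componentSupport_eq {c c' : (S.induce {v}ᶜ).ConnectedComponent} {u w : V}
    (hu : u ∈ componentSupport c) (hw : w ∈ componentSupport c') (h : S.Adj u w) : c = c' := by
  obtain ⟨h1, rfl⟩ := hu
  obtain ⟨h2, rfl⟩ := hw
  exact SimpleGraph.ConnectedComponent.sound (SimpleGraph.Adj.reachable (by simpa using h))

theorem mem_componentSupport_of_adj {c : (S.induce {v}ᶜ).ConnectedComponent} {u w : V}
    (hu : u ∈ componentSupport c) (hw : w ≠ v) (h : S.Adj u w) : w ∈ componentSupport c :=
  ⟨hw, (componentSupport_eq hu ⟨hw, rfl⟩ h).symm⟩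

theorem exists_adj_ne_of_not_isPendant (hconn : S.Connected) (hpend : ∀ u, ¬ IsPendant S u)
    {u : V} (hu : u ≠ v) : ∃ w, w ≠ v ∧ S.Adj u w := by
  by_contra! h
  have : Nontrivial V := ⟨u, v, hu⟩
  obtain ⟨x, hx⟩ := hconn.preconnected.exists_adj_of_nontrivial u
  refine hpend u ?_
  rw [IsPendant, Set.ncard_eq_one]
  refine ⟨v, Set.eq_singleton_iff_unique_mem.2 ⟨?_, fun y hy => ?_⟩⟩
  · by_contra hv
    exact h x (fun hxv => hv (hxv ▸ hx)) hx
  · by_contra hy'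
    exact h y hy' hy

theorem exists_edge_componentSupport (hconn : S.Connected) (hpend : ∀ u, ¬ IsPendant S u)
    (c : (S.induce {v}ᶜ).ConnectedComponent) :
    ∃ u ∈ componentSupport c, ∃ w ∈ componentSupport c, S.Adj u w := by
  obtain ⟨⟨u, hu⟩, rfl⟩ := c.exists_rep
  obtain ⟨w, hw, h⟩ := exists_adj_ne_of_not_isPendant hconn hpend hu
  exact ⟨u, ⟨hu, rfl⟩, w, mem_componentSupport_of_adj ⟨hu, rfl⟩ hw h, h⟩

theorem exists_adj_componentSupport (hconn : S.Connected)
    (c : (S.induce {v}ᶜ).ConnectedComponent) : ∃ u ∈ componentSupport c, S.Adj v u := by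
  by_contra! h
  obtain ⟨⟨u, hu⟩, rfl⟩ := c.exists_rep
  obtain ⟨p⟩ := hconn.preconnected u v
  have key : ∀ (x y : V) (p : S.Walk x y),
      x ∈ componentSupport ((S.induce {v}ᶜ).connectedComponentMk ⟨u, hu⟩) →
      y ∈ componentSupport ((S.induce {v}ᶜ).connectedComponentMk ⟨u, hu⟩) := by
    intro x y p
    induction p with
    | nil => exact id
    | cons hadj _ ih =>
      exact fun hx => ih (mem_componentSupport_of_adj hx
        (fun hv => h _ hx (hv ▸ hadj.symm)) hadj)
  exact notMem_componentSupport _ (key u v p ⟨hu, rfl⟩)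

theorem IsCutVertex.two_le_card [Finite V] (hconn : S.Connected) (hcut : IsCutVertex S v) :
    1 < Nat.card (S.induce {v}ᶜ).ConnectedComponent := by
  have h1 : Nat.card S.ConnectedComponent = 1 := by
    have := hconn.preconnected.subsingleton_connectedComponent
    have := hconn.nonempty
    exact Nat.card_unique
  rw [IsCutVertex, h1] at hcut
  exact hcut

end CutVertex

namespace MixedGraph

variable {V : Type*} [Fintype V] [DecidableEq V] {G : MixedGraph V} {v : V}

theorem posGe_of_components (hconn : G.graph.Connected) (hpend : ∀ u, ¬ IsPendant G.graph u)
    {d : ℕ} (c : Fin d → (G.graph.induce {v}ᶜ).ConnectedComponent) (hc : Function.Injective c) :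
    PosGe G.herm d := by
  refine G.isGainMatrix_herm.posGe_of_edges (fun i => componentSupport (c i)) ?_ ?_
  · intro i j hij u hu w hw
    by_contra h
    exact hij (hc (componentSupport_eq hu hw (G.herm_ne_zero_iff.1 h)))
  · intro i
    simp only [herm_ne_zero_iff]
    exact exists_edge_componentSupport hconn hpend (c i)

omit [Fintype V] [DecidableEq V] in
theorem isConnectedOn_componentSupport (c : (G.graph.induce {v}ᶜ).ConnectedComponent) :
    IsConnectedOn G.herm (componentSupport c) := by
  rintro A ⟨u, ⟨hu, huc⟩, huA⟩ hA w ⟨hw, hwc⟩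
  obtain ⟨p⟩ := SimpleGraph.ConnectedComponent.exact (huc.trans hwc.symm)
  have key : ∀ (x y : ({v}ᶜ : Set V)) (p : (G.graph.induce {v}ᶜ).Walk x y),
      x.1 ∈ componentSupport c → x.1 ∈ A → y.1 ∈ A := by
    intro x y p
    induction p with
    | nil => exact fun _ h => h
    | @cons a b e hadj _ ih =>
      intro hx hxA
      have hadj' : G.graph.Adj a.1 b.1 := by simpa using hadj
      have hb := mem_componentSupport_of_adj hx b.2 hadj'
      exact ih hb (hA _ hx hxA _ hb (G.herm_ne_zero_iff.2 hadj'))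
  exact key _ _ p ⟨hu, huc⟩ huA

theorem posGe_two (hconn : G.graph.Connected) (hcut : IsCutVertex G.graph v)
    (hpend : ∀ u, ¬ IsPendant G.graph u) : PosGe G.herm 2 := by
  obtain ⟨c, c', h⟩ := (Finite.one_lt_card_iff_nontrivial.1 (hcut.two_le_card hconn)).exists_pair_ne
  refine posGe_of_components (v := v) hconn hpend ![c, c'] ?_
  intro i j hij
  fin_cases i <;> fin_cases j <;> simp_all

/-- A third component would contain an edge and so provide a third orthogonal positive vector. -/
theorem exists_isSplit (hconn : G.graph.Connected) (hcut : IsCutVertex G.graph v)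
    (hpend : ∀ u, ¬ IsPendant G.graph u) (h3 : ¬ PosGe G.herm 3) :
    ∃ S S', IsSplit G.herm v S S' := by
  obtain ⟨c, c', h⟩ := (Finite.one_lt_card_iff_nontrivial.1 (hcut.two_le_card hconn)).exists_pair_ne
  have hall : ∀ d, d = c ∨ d = c' := by
    intro d
    by_contra! hd
    refine h3 (posGe_of_components (v := v) hconn hpend ![c, c', d] ?_)
    have h1 := hd.1.symm
    have h2 := hd.2.symm
    have h3 := h.symm
    intro i j hij
    fin_cases i <;> fin_cases j <;> simp_all
  refine ⟨componentSupport c, componentSupport c', ?_⟩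
  constructor
  · exact notMem_componentSupport c
  · exact notMem_componentSupport c'
  · intro x
    by_cases hx : x = v
    · exact Or.inl hx
    · rcases hall ((G.graph.induce {v}ᶜ).connectedComponentMk ⟨x, hx⟩) with h | h
      · exact Or.inr (Or.inl ⟨hx, h⟩)
      · exact Or.inr (Or.inr ⟨hx, h⟩)
  · rintro x ⟨h1, rfl⟩ ⟨_, h2⟩
    exact h h2
  · intro u hu w hw
    by_contra h'
    exact h (componentSupport_eq hu hw (G.herm_ne_zero_iff.1 h'))
  · exact isConnectedOn_componentSupport c
  · exact isConnectedOn_componentSupport c'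
  · simp only [herm_ne_zero_iff]; exact exists_edge_componentSupport hconn hpend c
  · simp only [herm_ne_zero_iff]; exact exists_edge_componentSupport hconn hpend c'
  · simp only [herm_ne_zero_iff]; exact exists_adj_componentSupport hconn c
  · simp only [herm_ne_zero_iff]; exact exists_adj_componentSupport hconn c'

end MixedGraph

/-! ### Multipartite coordinates, pullbacks and recognition of the pieces. -/

theorem exists_equiv_sigma {W : Type*} [Fintype W] {k : ℕ} {c : W → Fin k}
    (hc : Function.Surjective c) : ∃ n : Fin k → ℕ, (∀ j, 0 < n j) ∧
      ∃ e : W ≃ Σ j : Fin k, Fin (n j), ∀ w, (e w).1 = c w := by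
  classical
  refine ⟨fun j => Fintype.card {w // c w = j}, fun j => ?_,
    (Equiv.sigmaFiberEquiv c).symm.trans (Equiv.sigmaCongrRight fun j => Fintype.equivFin _),
    fun w => rfl⟩
  obtain ⟨w, hw⟩ := hc j
  exact Fintype.card_pos_iff.2 ⟨⟨w, hw⟩⟩

/-- Non-adjacency is an equivalence relation on `S`; its classes can be numbered. -/
theorem IsGainMatrix.exists_classes {V : Type*} [Fintype V] {H : Matrix V V ℂ}
    (hH : IsGainMatrix H) {S : Set V} (hS : HasTwins H S) :
    ∃ (k : ℕ) (c : S → Fin k), Function.Surjective c ∧ ∀ a b : S, c a = c b ↔ H a b = 0 := by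
  classical
  let r : Setoid S :=
    { r := fun a b => H a b = 0
      iseqv := ⟨fun a => hH.diag a, fun h => hH.eq_zero_comm.1 h, fun {a b d} h h' => by
        obtain ⟨c, _, h1⟩ := hS a a.2 b b.2 h
        rw [h1, h', mul_zero]⟩ }
  refine ⟨Fintype.card (Quotient r), fun a => Fintype.equivFin _ (Quotient.mk r a), ?_, ?_⟩
  · exact (Fintype.equivFin _).surjective.comp Quotient.mk_surjective
  · intro a b
    rw [EmbeddingLike.apply_eq_iff_eq]
    exact Quotient.eq

namespace MixedGraph

section Comap

variable {V W : Type*}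

/-- The pullback of a mixed graph along a map of vertices. -/
def comap (f : W → V) (G : MixedGraph V) : MixedGraph W where
  undirected := G.undirected.comap f
  arc a b := G.arc (f a) (f b)
  arc_asymm a b := G.arc_asymm (f a) (f b)
  not_undirected_of_arc a b := G.not_undirected_of_arc (f a) (f b)

theorem comap_herm (f : W → V) (G : MixedGraph V) :
    (G.comap f).herm = G.herm.submatrix f f := by
  rfl

theorem converse_herm (G : MixedGraph V) (u w : V) : G.converse.herm u w = star (G.herm u w) := by
  have h1 := G.arc_asymm u w
  have h2 := G.not_undirected_of_arc u w
  simp only [converse, herm]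
  by_cases h3 : G.undirected.Adj u w
  · simp [h3]
  by_cases h4 : G.arc u w
  · simp [h3, h4, h1 h4]
  by_cases h5 : G.arc w u <;> simp [h3, h4, h5]

/-- With entries s_u · star s_w the product along any walk telescopes, so closed walks have value 1.
-/
theorem IsPositive.of_isBalancedOn {G : MixedGraph V} (h : IsBalancedOn G.herm Set.univ) :
    G.IsPositive := by
  obtain ⟨s, hs, h⟩ := h
  have key : ∀ (u w : V) (p : G.graph.Walk u w),
      (p.darts.map fun d => G.herm d.fst d.snd).prod = s u * star (s w) := by
    intro u w p
    induction p with
    | nil => rw [(hs _).mul_star]; rfl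
    | @cons a b c hadj p ih =>
      simp only [SimpleGraph.Walk.darts_cons, List.map_cons, List.prod_cons, ih]
      rw [(h a trivial b trivial).resolve_left (G.herm_ne_zero_iff.2 hadj)]
      linear_combination s a * star (s c) * (hs b).star_mul
  intro u w _
  rw [key, (hs u).mul_star]

theorem c3_herm (t : Fin 3 → ℕ) (x y : Σ j : Fin 3, Fin (t j)) :
    (c3 t).herm x y = triangleEntry Complex.I x.1 y.1 := by
  have h1 : ∀ i j : Fin 3, i + 1 = j → i ≠ j := by decide
  have h2 : ∀ i j : Fin 3, ¬ i + 1 = j → i ≠ j → j + 1 = i := by decide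
  have h3 : ∀ i : Fin 3, ¬ i + 1 = i := by decide
  simp only [herm, c3, triangleEntry, SimpleGraph.bot_adj, if_false]
  by_cases h4 : x.1 + 1 = y.1
  · simp [h4, h1 _ _ h4]
  by_cases h5 : x.1 = y.1
  · simp [h5, h3]
  · simp [h4, h5, h2 _ _ h4 h5]

theorem IsC3Type.of_isTriangularOn [Fintype V] {G : MixedGraph V} {u : Fin 3 → V}
    {s : Fin 3 → ℂ} {τ : ℂ} (h : IsTriangularOn G.herm Set.univ u s τ) : G.IsC3Type := by
  have hH := G.isGainMatrix_herm
  choose c d hd hcd using fun w => h.twin w trivial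
  have hτ : τ ≠ 0 := by rcases h.gain with rfl | rfl <;> simp
  have hT : ∀ j l, triangleEntry τ j l = 0 → j = l := by
    intro j l hjl
    by_contra hne
    simp only [triangleEntry, if_neg hne] at hjl
    split_ifs at hjl
    · exact hτ hjl
    · exact hτ (neg_eq_zero.1 hjl)
  have hcu : ∀ j, c (u j) = j := by
    intro j
    have h1 := hcd (u j) (u j)
    rw [hH.diag, h.entry] at h1
    have h2 := (mul_eq_zero.1 h1.symm).resolve_left (hd _).ne_zero
    exact hT _ _ ((mul_eq_zero.1 h2).resolve_left
      (mul_ne_zero (h.unit _).ne_zero (h.unit _).star.ne_zero))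
  obtain ⟨t, ht, e, he⟩ := exists_equiv_sigma (c := c) fun j => ⟨u j, hcu j⟩
  -- Each vertex is `d w` times a corner and each corner is switched by `s`, so the product switches
  -- the entire graph to the blow-up.
  let σ : V → ℂ := fun w => d w * s (c w)
  have hσ : ∀ w, IsFourthRoot (σ w) := fun w => (hd w).mul (h.unit _)
  have hentry : ∀ w w', G.herm w w' = σ w * star (σ w') * triangleEntry τ (c w) (c w') := by
    intro w w'
    rw [hcd, ← hH.apply, hcd w', star_mul', hH.apply, h.entry]
    simp only [σ, star_mul']
    ring
  refine ⟨t, ht, e, ?_⟩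
  rcases h.gain with rfl | rfl
  · refine ⟨σ, hσ, Or.inl fun w w' => ?_⟩
    rw [c3_herm, he, he, hentry, (hσ w).inv_eq]
    linear_combination (-triangleEntry Complex.I (c w) (c w')) * (hσ w).star_mul
      - (triangleEntry Complex.I (c w) (c w') * star (σ w) * σ w) * (hσ w').star_mul
  -- For τ = −i the cyclic orientation is reversed; the converse corrects it.
  · refine ⟨fun w => star (σ w), fun w => (hσ w).star, Or.inr fun w w' => ?_⟩
    rw [c3_herm, he, he, converse_herm, hentry, (hσ w).star.inv_eq, star_star, star_mul',
      star_mul', star_star]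
    have : star (triangleEntry (-Complex.I) (c w) (c w')) = triangleEntry Complex.I (c w) (c w') := by
      simp only [triangleEntry]; split_ifs <;> simp
    rw [this]
    linear_combination (-triangleEntry Complex.I (c w) (c w')) * (hσ w).star_mul
      - (triangleEntry Complex.I (c w) (c w') * star (σ w) * σ w) * (hσ w').star_mul

theorem IsC3Type.comap_symm {G : MixedGraph V} (h : G.IsC3Type) (e : V ≃ W) :
    (G.comap e.symm).IsC3Type := by
  obtain ⟨t, ht, e', Q, hQ, h⟩ := h
  refine ⟨t, ht, e.symm.trans e', Q ∘ e.symm, fun u => hQ _, ?_⟩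
  rcases h with h | h
  · exact Or.inl fun u w => by rw [comap_herm]; exact h _ _
  · refine Or.inr fun u w => ?_
    rw [converse_herm, comap_herm]
    have := h (e.symm u) (e.symm w)
    rw [converse_herm] at this
    exact this

end Comap

variable {V : Type*} [Fintype V] [DecidableEq V] {G : MixedGraph V} {v : V} {S S' : Set V}

-- With inertia at most one, S ∪ {v} is itself hyperbolic, and it is connected; so the block
-- classification applies to it as a graph of its own.
omit [Fintype V] in
theorem exists_multipartite_piece [Fintype {x // x ∈ S ∨ x = v}]
    (hpend : ∀ u, ¬ IsPendant G.graph u)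
    (hS : IsSplit G.herm v S S')
    (h2 : ¬ PosGe (G.comap (Subtype.val : {x // x ∈ S ∨ x = v} → V)).herm 2) :
    ∃ (x : ℕ) (m : Fin x → ℕ) (e : {x // x ∈ S ∨ x = v} ≃ Σ j : Fin x, Fin (m j)),
      2 ≤ x ∧ (∀ j, 0 < m j) ∧
      (G.comap fun y => (e.symm y).1).graph
        = SimpleGraph.completeMultipartiteGraph (fun j => Fin (m j)) ∧
      ¬ (G.comap fun y => (e.symm y).1).IsMixedStar ∧
      ((G.comap fun y => (e.symm y).1).IsPositive ∨ (G.comap fun y => (e.symm y).1).IsC3Type) := by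
  classical
  set N := G.comap (Subtype.val : {x // x ∈ S ∨ x = v} → V) with hN
  have hNh : ∀ a b, N.herm a b = G.herm a.1 b.1 := fun a b => by rw [hN, comap_herm]; rfl
  have hH := G.isGainMatrix_herm
  have hNH := N.isGainMatrix_herm
  have hhyp := hNH.isHyperbolicOn_univ h2
  have hv : v ∈ S ∨ v = v := Or.inr rfl
  obtain ⟨u₀, hu₀, hvu₀⟩ := hS.adj_left
  have hconn : IsConnectedOn N.herm Set.univ := by
    rintro A ⟨a, _, haA⟩ hA b _
    have hA' : ∀ a ∈ A, ∀ b, N.herm a b ≠ 0 → b ∈ A := fun a ha b h =>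
      hA a trivial ha b trivial h
    have hmemS : ∀ w (hw : w ∈ S), (⟨w, Or.inl hw⟩ : {x // x ∈ S ∨ x = v}) ∈ A → ∀ b, b ∈ A := by
      intro w hw hwA b
      have h1 : ∀ y (hy : y ∈ S), (⟨y, Or.inl hy⟩ : {x // x ∈ S ∨ x = v}) ∈ A := by
        intro y hy
        have := hS.connected_left {y | ∀ hy : y ∈ S, (⟨y, Or.inl hy⟩ : {x // x ∈ S ∨ x = v}) ∈ A}
          ⟨w, hw, fun _ => hwA⟩ (fun p hp hpA q hq hpq _ => hA' _ (hpA hp) _ (by rwa [hNh])) hy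
        exact this hy
      obtain ⟨b, hb | rfl⟩ := b
      · exact h1 b hb
      · refine hA' _ (h1 u₀ hu₀) _ ?_
        rw [hNh]
        exact fun h => hvu₀ (hH.eq_zero_comm.1 h)
    obtain ⟨a, ha | rfl⟩ := a
    · exact hmemS a ha haA b
    · refine hmemS u₀ hu₀ (hA' _ haA _ ?_) b
      rwa [hNh]
  have htw := hNH.hasTwins hhyp hconn
  obtain ⟨x, c₀, hc₀, hc₀'⟩ := hNH.exists_classes htw
  let c : {x // x ∈ S ∨ x = v} → Fin x := fun a => c₀ ⟨a, trivial⟩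
  have hc : Function.Surjective c := fun j => by
    obtain ⟨a, ha⟩ := hc₀ j
    exact ⟨a.1, ha⟩
  have hc' : ∀ a b, c a = c b ↔ N.herm a b = 0 := fun a b => hc₀' ⟨a, trivial⟩ ⟨b, trivial⟩
  obtain ⟨m, hm, e, he⟩ := exists_equiv_sigma hc
  obtain ⟨p, hp, q, hq, hpq⟩ := hS.edge_left
  have hsymm : (G.comap fun y => (e.symm y).1) = N.comap e.symm := rfl
  refine ⟨x, m, e, ?_, hm, ?_, ?_, ?_⟩
  · have hne : c ⟨p, Or.inl hp⟩ ≠ c ⟨q, Or.inl hq⟩ := fun h => hpq (by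
      rw [hc', hNh] at h; exact h)
    by_contra! hx
    have : Subsingleton (Fin x) := Fin.subsingleton_iff_le_one.2 (by omega)
    exact hne (Subsingleton.elim _ _)
  · ext a b
    rw [← herm_ne_zero_iff, hsymm, comap_herm, Matrix.submatrix_apply, Ne, ← hc', ← he, ← he]
    simp
  · rintro ⟨z, hz⟩
    have hadj : ∀ a b : {x // x ∈ S ∨ x = v}, G.graph.Adj a.1 b.1 ↔
        (SimpleGraph.starGraph z).Adj (e a) (e b) := by
      intro a b
      rw [← hz, ← herm_ne_zero_iff, ← herm_ne_zero_iff, comap_herm]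
      simp
    -- Vertices of S have no neighbours outside S ∪ {v}, so a leaf of the star lying in S would be
    -- pendant in G. Then both ends of an edge inside S would have to be the centre.
    have leaf : ∀ y (hy : y ∈ S), e ⟨y, Or.inl hy⟩ ≠ z → False := by
      intro y hy hyz
      refine hpend y ?_
      rw [IsPendant, Set.ncard_eq_one]
      refine ⟨(e.symm z).1, Set.eq_singleton_iff_unique_mem.2 ⟨?_, fun t ht => ?_⟩⟩
      · have := (hadj ⟨y, Or.inl hy⟩ (e.symm z)).2 (by simp [SimpleGraph.starGraph_adj, hyz])
        exact this
      · have ht' : t ∈ S ∨ t = v := by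
          rcases hS.cover t with h | h | h
          · exact Or.inr h
          · exact Or.inl h
          · exact absurd (hS.zero y hy t h) (G.herm_ne_zero_iff.2 ht)
        have := (hadj ⟨y, Or.inl hy⟩ ⟨t, ht'⟩).1 ht
        rw [SimpleGraph.starGraph_adj] at this
        have h3 : e ⟨t, ht'⟩ = z := by tauto
        rw [← h3]; simp
    have hpz : e ⟨p, Or.inl hp⟩ = z := not_not.1 fun h => leaf p hp h
    have hqz : e ⟨q, Or.inl hq⟩ = z := not_not.1 fun h => leaf q hq h
    have := e.injective (hpz.trans hqz.symm)
    simp only [Subtype.mk.injEq] at this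
    rw [this] at hpq
    exact hpq (hH.diag q)
  · rcases hNH.isBalancedOn_or_isTriangularOn hhyp hconn with ⟨s, hs, h⟩ | ⟨u, s, τ, h⟩
    · left
      refine IsPositive.of_isBalancedOn ⟨s ∘ e.symm, fun u => hs _, fun a _ b _ => ?_⟩
      rw [hsymm, comap_herm]
      exact h _ trivial _ trivial
    · right
      exact (IsC3Type.of_isTriangularOn h).comap_symm e

omit [Fintype V] [DecidableEq V] in
theorem exists_glue (hS : IsSplit G.herm v S S') {A B : Type*}
    (e : {x // x ∈ S ∨ x = v} ≃ A) (e' : {x // x ∈ S' ∨ x = v} ≃ B) :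
    ∃ f : V ≃ GlueVertex A (e' ⟨v, Or.inr rfl⟩), f v = Sum.inl (e ⟨v, Or.inr rfl⟩) ∧
      SwitchingEquivVia f G (glue (G.comap fun y => (e.symm y).1) (e ⟨v, Or.inr rfl⟩)
        (G.comap fun y => (e'.symm y).1) (e' ⟨v, Or.inr rfl⟩)) := by
  classical
  set a := e ⟨v, Or.inr rfl⟩ with ha
  set b := e' ⟨v, Or.inr rfl⟩ with hb
  let φ : GlueVertex A b → V := Sum.elim (fun y => (e.symm y).1) (fun y => (e'.symm y.1).1)
  have hr : ∀ y : {y : B // y ≠ b}, (e'.symm y.1).1 ∈ S' := by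
    intro y
    refine (e'.symm y.1).2.resolve_right fun h => y.2 ?_
    exact (Equiv.symm_apply_eq e').1 (Subtype.ext h)
  have hl : ∀ y : A, y ≠ a → (e.symm y).1 ∈ S := by
    intro y hy
    refine (e.symm y).2.resolve_right fun h => hy ?_
    rw [ha, ← Equiv.symm_apply_eq]
    exact Subtype.ext h
  have hsa : (e.symm a).1 = v := by simp [ha]
  have hsb : (e'.symm b).1 = v := by simp [hb]
  have hlr : ∀ (x : A) (y : {y : B // y ≠ b}), (e.symm x).1 ≠ (e'.symm y.1).1 := by
    intro x y h
    by_cases hx : x = a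
    · rw [hx, hsa] at h
      exact hS.notMem_right (h ▸ hr y)
    · exact hS.disjoint _ (hl x hx) (h ▸ hr y)
  have hφ : Function.Bijective φ := by
    constructor
    · rintro (x | x) (y | y) h
      · simpa [φ, Subtype.val_inj] using h
      · exact absurd h (hlr x y)
      · exact absurd h.symm (hlr y x)
      · simpa [φ, Subtype.val_inj] using h
    · intro x
      rcases hS.cover x with h | h | h
      · exact ⟨Sum.inl a, hsa.trans h.symm⟩
      · exact ⟨Sum.inl (e ⟨x, Or.inl h⟩), by simp [φ]⟩
      · refine ⟨Sum.inr ⟨e' ⟨x, Or.inl h⟩, fun h' => ?_⟩, by simp [φ]⟩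
        have := congrArg Subtype.val (e'.injective h')
        exact hS.notMem_right ((show x = v from this) ▸ h)
  have hno : ∀ (x : A) (y : {y : B // y ≠ b}), x ≠ a →
      ¬ G.graph.Adj (e.symm x).1 (e'.symm y.1).1 := fun x y hx h =>
    G.herm_ne_zero_iff.2 h (hS.zero _ (hl x hx) _ (hr y))
  have hglue : glue (G.comap fun y => (e.symm y).1) a (G.comap fun y => (e'.symm y).1) b
      = G.comap φ := by
    apply MixedGraph.ext
    · ext x y
      rcases x with x | x <;> rcases y with y | y
      · exact Iff.rfl
      · change (x = a ∧ G.undirected.Adj (e'.symm b).1 (e'.symm y.1).1) ↔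
          G.undirected.Adj (e.symm x).1 (e'.symm y.1).1
        by_cases hx : x = a
        · rw [hx, hsa, hsb]; simp
        · have := hno x y hx
          simp only [hx, false_and, false_iff]
          exact fun h => this (Or.inl h)
      · change (y = a ∧ G.undirected.Adj (e'.symm x.1).1 (e'.symm b).1) ↔
          G.undirected.Adj (e'.symm x.1).1 (e.symm y).1
        by_cases hy : y = a
        · rw [hy, hsa, hsb]; simp
        · have := hno y x hy
          simp only [hy, false_and, false_iff]
          exact fun h => this (Or.inl h.symm)
      · exact Iff.rfl
    · ext x y
      rcases x with x | x <;> rcases y with y | y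
      · exact Iff.rfl
      · change (x = a ∧ G.arc (e'.symm b).1 (e'.symm y.1).1) ↔
          G.arc (e.symm x).1 (e'.symm y.1).1
        by_cases hx : x = a
        · rw [hx, hsa, hsb]; simp
        · have := hno x y hx
          simp only [hx, false_and, false_iff]
          exact fun h => this (Or.inr (Or.inl h))
      · change (y = a ∧ G.arc (e'.symm x.1).1 (e'.symm b).1) ↔
          G.arc (e'.symm x.1).1 (e.symm y).1
        by_cases hy : y = a
        · rw [hy, hsa, hsb]; simp
        · have := hno y x hy
          simp only [hy, false_and, false_iff]
          exact fun h => this (Or.inr (Or.inr h))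
      · exact Iff.rfl
  refine ⟨(Equiv.ofBijective φ hφ).symm, ?_, fun _ => 1, fun _ => Or.inl rfl, Or.inl ?_⟩
  · rw [Equiv.symm_apply_eq]
    exact hsa.symm
  · intro u w
    rw [hglue, comap_herm, Matrix.submatrix_apply]
    have h1 : ∀ u, φ ((Equiv.ofBijective φ hφ).symm u) = u := fun u =>
      (Equiv.ofBijective φ hφ).apply_symm_apply u
    rw [h1, h1]; simp

end MixedGraph

/-! ### Schur complement at the cut vertex. -/

section Reduction

variable {V : Type*} [Fintype V]

theorem hform_eq_zero_of_mulVec {H : Matrix V V ℂ} {S : Set V} {f g : V → ℂ}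
    (hf : ∀ x ∉ S, f x = 0) (hg : ∀ x ∈ S, H.mulVec g x = 0) : hform H f g = 0 := by
  refine Finset.sum_eq_zero fun u _ => ?_
  by_cases hu : u ∈ S
  · rw [hg u hu, mul_zero]
  · rw [Pi.star_apply, hf u hu]; simp

theorem mulVec_eq_zero_of_support {H : Matrix V V ℂ} {S S' : Set V} {z : V → ℂ}
    (hz : ∀ x ∉ S', z x = 0) (h : ∀ u ∈ S, ∀ w ∈ S', H u w = 0) {x : V} (hx : x ∈ S) :
    H.mulVec z x = 0 := by
  refine Finset.sum_eq_zero fun w _ => ?_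
  change H x w * z w = 0
  by_cases hw : w ∈ S'
  · rw [h x hx w hw, zero_mul]
  · rw [hz w hw, mul_zero]

/-- A vector supported on `S` whose sum with the indicator of `v` is orthogonal to all vectors
supported on `S`. -/
structure IsReduction (H : Matrix V V ℂ) (v : V) (S : Set V) (z : V → ℂ) : Prop where
  support : ∀ x ∉ S, z x = 0
  mulVec : ∀ w ∈ S, H.mulVec z w = -H w v

variable [DecidableEq V] {H : Matrix V V ℂ} {v : V} {S S' : Set V}

theorem mulVec_single_one_apply (w : V) :
    H.mulVec (Pi.single v 1) w = H w v := by
  simp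

/-- The vector e_v + z + z' is orthogonal to everything on S and on S', and its form is the sum of
the two contributions. If that were positive, it and an edge vector from each side would be three
orthogonal positive vectors. -/
theorem IsSplit.reduction_nonpos (hH : IsGainMatrix H) (hS : IsSplit H v S S')
    (h3 : ¬ PosGe H 3) {z z' : V → ℂ} (hz : IsReduction H v S z) (hz' : IsReduction H v S' z') :
    (H.mulVec z v + H.mulVec z' v).re ≤ 0 := by
  by_contra! hpos
  obtain ⟨p, hp, q, hq, hpq⟩ := hS.edge_left
  obtain ⟨p', hp', q', hq', hpq'⟩ := hS.edge_right
  let f : V → ℂ := Pi.single v 1 + z + z'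
  have hf1 : ∀ w ∈ S, H.mulVec f w = 0 := by
    intro w hw
    simp only [f, Matrix.mulVec_add, Pi.add_apply]
    rw [mulVec_single_one_apply, hz.mulVec w hw,
      mulVec_eq_zero_of_support hz'.support hS.zero hw]
    ring
  have hf2 : ∀ w ∈ S', H.mulVec f w = 0 := by
    intro w hw
    simp only [f, Matrix.mulVec_add, Pi.add_apply]
    rw [mulVec_single_one_apply, hz'.mulVec w hw,
      mulVec_eq_zero_of_support hz.support (hS.symm hH).zero hw]
    ring
  have hf3 : H.mulVec f v = H.mulVec z v + H.mulVec z' v := by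
    simp only [f, Matrix.mulVec_add, Pi.add_apply]
    rw [mulVec_single_one_apply, hH.diag]
    ring
  have hff : hform H f f = H.mulVec z v + H.mulVec z' v := by
    rw [hform, dotProduct, Finset.sum_eq_single v]
    · rw [hf3]
      simp [f, hz.support v hS.notMem_left, hz'.support v hS.notMem_right]
    · intro w _ hw
      rcases hS.cover w with h | h | h
      · exact absurd h hw
      · rw [hf1 w h, mul_zero]
      · rw [hf2 w h, mul_zero]
    · simp
  have s1 : ∀ x ∉ S, edgeVector H p q x = 0 := fun x hx => edgeVector_eq_zero H hp hq hx
  have s2 : ∀ x ∉ S', edgeVector H p' q' x = 0 := fun x hx => edgeVector_eq_zero H hp' hq' hx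
  have o1 := hform_eq_zero_of_mulVec s1 hf1
  have o2 := hform_eq_zero_of_mulVec s2 hf2
  have o3 := hform_eq_zero_of_support s1 s2 hS.zero
  refine h3 ⟨![f, edgeVector H p q, edgeVector H p' q'], ?_, ?_⟩
  · intro i j hij
    fin_cases i <;> fin_cases j
    · exact absurd rfl hij
    · change hform H f (edgeVector H p q) = 0
      rw [← star_hform hH.isHermitian, o1, star_zero]
    · change hform H f (edgeVector H p' q') = 0
      rw [← star_hform hH.isHermitian, o2, star_zero]
    · exact o1
    · exact absurd rfl hij
    · exact o3
    · exact o2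
    · change hform H (edgeVector H p' q') (edgeVector H p q) = 0
      rw [← star_hform hH.isHermitian, o3, star_zero]
    · exact absurd rfl hij
  · intro i
    fin_cases i
    · change 0 < (hform H f f).re
      rw [hff]; exact hpos
    · change 0 < (hform H (edgeVector H p q) (edgeVector H p q)).re
      rw [hH.hform_edgeVector hpq]; norm_num
    · change 0 < (hform H (edgeVector H p' q') (edgeVector H p' q')).re
      rw [hH.hform_edgeVector hpq']; norm_num

omit [DecidableEq V] in
theorem PosGe.succ_of_map {W : Type*} [Fintype W] {N : Matrix W W ℂ} (hH : H.IsHermitian)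
    (h : PosGe N 2) (T : (W → ℂ) → V → ℂ) (hT : ∀ f g, hform H (T f) (T g) = hform N f g)
    {y : V → ℂ} (hy : 0 < (hform H y y).re) (hyT : ∀ f, hform H y (T f) = 0) : PosGe H 3 := by
  obtain ⟨f, ho, hp⟩ := h
  refine ⟨Fin.cons y fun i => T (f i), fun i j => ?_, fun i => ?_⟩
  · refine Fin.cases ?_ (fun i => ?_) i <;> refine Fin.cases ?_ (fun j => ?_) j
    · simp
    · intro _
      simpa using hyT (f j)
    · intro _
      simp only [Fin.cons_zero, Fin.cons_succ]
      rw [← star_hform hH, hyT, star_zero]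
    · intro hij
      simp only [Fin.cons_succ]
      rw [hT]
      exact ho i j fun h => hij (by rw [h])
  · refine Fin.cases ?_ (fun i => ?_) i
    · simpa using hy
    · simp only [Fin.cons_succ]
      rw [hT]
      exact hp i

omit [DecidableEq V] in
theorem hform_extend {P : V → Prop} [DecidablePred P] [Fintype {x // P x}] (f g : {x // P x} → ℂ) :
    hform H (fun x => if h : P x then f ⟨x, h⟩ else 0) (fun x => if h : P x then g ⟨x, h⟩ else 0)
      = hform (H.submatrix Subtype.val Subtype.val) f g := by
  have key : ∀ F : V → ℂ, (∀ x, ¬ P x → F x = 0) → ∑ x, F x = ∑ x : {x // P x}, F x.1 := by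
    intro F hF
    exact (Finset.sum_filter_of_ne fun x _ hx => not_not.1 fun h => hx (hF x h)).symm.trans
      (Finset.sum_subtype (Finset.univ.filter P) (by simp) F)
  rw [hform_eq_sum, hform_eq_sum, key]
  · refine Finset.sum_congr rfl fun u _ => ?_
    rw [key]
    · refine Finset.sum_congr rfl fun w _ => ?_
      simp [u.2, w.2]
    · intro x hx; simp [hx]
  · intro x hx; simp [hx]

/-- When the contribution of S is zero, y = e_v + z is in the radical of the form on S ∪ {v}.
Subtracting f(v)·y moves any f into S without changing the form, which leaves an edge of S' free as
a further positive vector. -/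
theorem IsSplit.not_posGe_two_left (hH : IsGainMatrix H) (hS : IsSplit H v S S')
    (h3 : ¬ PosGe H 3) {z : V → ℂ} (hz : IsReduction H v S z) (hz0 : H.mulVec z v = 0)
    [Fintype {x // x ∈ S ∨ x = v}] :
    ¬ PosGe (H.submatrix (Subtype.val : {x // x ∈ S ∨ x = v} → V) Subtype.val) 2 := by
  classical
  intro h2
  obtain ⟨p, hp, q, hq, hpq⟩ := hS.edge_right
  let E : ({x // x ∈ S ∨ x = v} → ℂ) → V → ℂ := fun f x =>
    if h : x ∈ S ∨ x = v then f ⟨x, h⟩ else 0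
  let y : V → ℂ := Pi.single v 1 + z
  let T : ({x // x ∈ S ∨ x = v} → ℂ) → V → ℂ := fun f => E f + (-f ⟨v, Or.inr rfl⟩) • y
  have hE : ∀ f, ∀ x ∉ {x | x ∈ S ∨ x = v}, E f x = 0 := fun f x hx => by
    simp only [Set.mem_ofPred_eq] at hx
    simp [E, hx]
  have hyv : ∀ x ∉ {x | x ∈ S ∨ x = v}, y x = 0 := fun x hx => by
    simp only [Set.mem_ofPred_eq, not_or] at hx
    simp [y, hx.2, hz.support x hx.1]
  have hHy : ∀ x ∈ {x | x ∈ S ∨ x = v}, H.mulVec y x = 0 := by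
    rintro x (hx | rfl)
    · simp only [y, Matrix.mulVec_add, Pi.add_apply]
      rw [mulVec_single_one_apply, hz.mulVec x hx]; ring
    · simp only [y, Matrix.mulVec_add, Pi.add_apply]
      rw [mulVec_single_one_apply, hz0, hH.diag]; ring
  have hTS : ∀ f, ∀ x ∉ S, T f x = 0 := by
    intro f x hx
    by_cases hxv : x = v
    · subst hxv
      simp [T, E, y, hz.support x hx]
    · have : x ∉ {x | x ∈ S ∨ x = v} := by simp [hx, hxv]
      simp [T, hE f x this, hyv x this]
  refine h3 (PosGe.succ_of_map hH.isHermitian h2 T ?_ (y := edgeVector H p q) ?_ ?_)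
  · intro f g
    have h1 : ∀ f, hform H (E f) y = 0 := fun f => hform_eq_zero_of_mulVec (hE f) hHy
    have h1' : ∀ f, hform H y (E f) = 0 := fun f => by
      rw [← star_hform hH.isHermitian, h1, star_zero]
    have h2 : hform H y y = 0 := hform_eq_zero_of_mulVec hyv hHy
    simp only [T, hform_add_left, hform_add_right, hform_smul_left, hform_smul_right, h1, h1', h2]
    rw [← hform_extend]
    simp [E]
  · rw [hH.hform_edgeVector hpq]; norm_num
  · intro f
    exact hform_eq_zero_of_support (fun x hx => edgeVector_eq_zero H hp hq hx) (hTS f)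
      (hS.symm hH).zero

/-- Here z is isotropic and orthogonal to S' ∪ {v}, so adding f(v)·z to f preserves the form. It
also makes the result orthogonal to all vectors on S, and an edge of S is a further positive vector.
-/
theorem IsSplit.not_posGe_two_right (hH : IsGainMatrix H) (hS : IsSplit H v S S')
    (h3 : ¬ PosGe H 3) {z : V → ℂ} (hz : IsReduction H v S z) (hz0 : H.mulVec z v = 0)
    [Fintype {x // x ∈ S' ∨ x = v}] :
    ¬ PosGe (H.submatrix (Subtype.val : {x // x ∈ S' ∨ x = v} → V) Subtype.val) 2 := by
  classical
  intro h2
  obtain ⟨p, hp, q, hq, hpq⟩ := hS.edge_left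
  let E : ({x // x ∈ S' ∨ x = v} → ℂ) → V → ℂ := fun f x =>
    if h : x ∈ S' ∨ x = v then f ⟨x, h⟩ else 0
  let T : ({x // x ∈ S' ∨ x = v} → ℂ) → V → ℂ := fun f => E f + f ⟨v, Or.inr rfl⟩ • z
  have hE : ∀ f, ∀ x ∉ {x | x ∈ S' ∨ x = v}, E f x = 0 := fun f x hx => by
    simp only [Set.mem_ofPred_eq] at hx
    simp [E, hx]
  have hHz : ∀ x ∈ {x | x ∈ S' ∨ x = v}, H.mulVec z x = 0 := by
    rintro x (hx | rfl)
    · exact mulVec_eq_zero_of_support hz.support (hS.symm hH).zero hx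
    · exact hz0
  have hEz : ∀ f, hform H (E f) z = 0 := fun f => hform_eq_zero_of_mulVec (hE f) hHz
  have hzE : ∀ f, hform H z (E f) = 0 := fun f => by
    rw [← star_hform hH.isHermitian, hEz, star_zero]
  have hzz : hform H z z = 0 := by
    have h4 : hform H z (Pi.single v 1) = 0 := by
      rw [← star_hform hH.isHermitian, hform_single_left, hz0]; simp
    have h5 : hform H z (Pi.single v 1 + z) = 0 := by
      refine hform_eq_zero_of_mulVec hz.support fun x hx => ?_
      rw [Matrix.mulVec_add, Pi.add_apply, mulVec_single_one_apply, hz.mulVec x hx]; ring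
    rwa [hform_add_right, h4, zero_add] at h5
  have hES : ∀ f, ∀ x ∈ S, T f x = z x * f ⟨v, Or.inr rfl⟩ := by
    intro f x hx
    have : x ∉ {x | x ∈ S' ∨ x = v} := by
      rintro (h | rfl)
      · exact hS.disjoint x hx h
      · exact hS.notMem_left hx
    simp [T, hE f x this, mul_comm]
  refine h3 (PosGe.succ_of_map hH.isHermitian h2 T ?_ (y := edgeVector H p q) ?_ ?_)
  · intro f g
    simp only [T, hform_add_left, hform_add_right, hform_smul_left, hform_smul_right, hEz, hzE, hzz]
    rw [← hform_extend]
    simp [E]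
  · rw [hH.hform_edgeVector hpq]; norm_num
  · intro f
    refine hform_eq_zero_of_mulVec (S := S) (fun x hx => edgeVector_eq_zero H hp hq hx) fun x hx => ?_
    have hEf : E f = Pi.single v (f ⟨v, Or.inr rfl⟩) + fun x => if x = v then 0 else E f x := by
      ext x
      by_cases h : x = v
      · subst h; simp [E]
      · simp [h]
    have h6 : H.mulVec (fun x => if x = v then 0 else E f x) x = 0 := by
      refine mulVec_eq_zero_of_support (S' := S') (fun w hw => ?_) hS.zero hx
      by_cases h : w = v
      · simp [h]
      · simp [h, E, hw]
    have h7 : (Pi.single v (f ⟨v, Or.inr rfl⟩) : V → ℂ) = f ⟨v, Or.inr rfl⟩ • Pi.single v 1 := by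
      rw [← Pi.single_smul]; simp
    simp only [T]
    rw [Matrix.mulVec_add, Matrix.mulVec_smul, hEf, Matrix.mulVec_add, h7, Matrix.mulVec_smul]
    simp only [Pi.add_apply, Pi.smul_apply]
    rw [h6, mulVec_single_one_apply, hz.mulVec x hx, smul_eq_mul, smul_eq_mul]
    ring

/-- The kernel relation in row v forces v to miss a corner u_j and to have opposite switched entries
at the other two. So on S the row of v is a multiple of the row of u_j, and a multiple of e_{u_j} is
the reduction; it contributes 0 since v misses u_j. -/
theorem IsTriangularOn.exists_reduction (hH : IsGainMatrix H) {u : Fin 3 → V} {s : Fin 3 → ℂ}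
    {τ : ℂ} (h : IsTriangularOn H S u s τ) :
    ∃ z, IsReduction H v S z ∧ H.mulVec z v = 0 := by
  have hker := h.kernel v
  have hτ : τ * star τ = 1 := by
    rcases h.gain with rfl | rfl <;> simp
  have main : ∀ j, H v (u j) = 0 → ∃ z, IsReduction H v S z ∧ H.mulVec z v = 0 := by
    intro j hj
    let d : ℂ := H v (u (j + 1)) * s (j + 1) * star (s j) * star τ
    have hd : ∀ l, H v (u l) = d * H (u j) (u l) := by
      have hs := fun l => (h.unit l).star_mul
      have hs' := fun l => (h.unit l).mul_star
      intro l
      rw [h.entry]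
      have hl : l = j ∨ l = j + 1 ∨ l = j + 2 :=
        (by decide : ∀ l j : Fin 3, l = j ∨ l = j + 1 ∨ l = j + 2) l j
      have e1 : j ≠ j + 1 := (by decide : ∀ j : Fin 3, j ≠ j + 1) j
      have e2 : j ≠ j + 2 := (by decide : ∀ j : Fin 3, j ≠ j + 2) j
      have e3 : ¬ j + 1 = j + 2 := (by decide : ∀ j : Fin 3, ¬ j + 1 = j + 2) j
      rcases hl with rfl | rfl | rfl
      · simp [triangleEntry, hj]
      · simp only [triangleEntry, if_neg e1, if_true, d]
        linear_combination (-H v (u (j + 1))) * hs' (j + 1)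
          - H v (u (j + 1)) * s (j + 1) * star (s (j + 1)) * hs j
          - H v (u (j + 1)) * s (j + 1) * star (s (j + 1)) * star (s j) * s j * hτ
      · simp only [triangleEntry, if_neg e2, if_neg e3, d]
        have h8 : H v (u (j + 1)) * s (j + 1) + H v (u (j + 2)) * s (j + 2) = 0 := by
          revert hj hker
          fin_cases j
          · intro hker hj
            have : H v (u 0) = 0 := hj
            rw [this, zero_mul, zero_add] at hker
            exact hker
          · intro hker hj
            have : H v (u 1) = 0 := hj
            rw [this, zero_mul, add_zero] at hker
            change H v (u 2) * s 2 + H v (u 0) * s 0 = 0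
            rw [← hker]; ring
          · intro hker hj
            have : H v (u 2) = 0 := hj
            rw [this, zero_mul, add_zero] at hker
            exact hker
        linear_combination (-H v (u (j + 2))) * hs' (j + 2)
          + H v (u (j + 1)) * s (j + 1) * star (s (j + 2)) * hs j
          + H v (u (j + 1)) * s (j + 1) * star (s (j + 2)) * star (s j) * s j * hτ
          + star (s (j + 2)) * h8
    refine ⟨Pi.single (u j) (-star d), ⟨fun x hx => ?_, fun w hw => ?_⟩, ?_⟩
    · have : x ≠ u j := fun h' => hx (h' ▸ h.mem j)
      simp [this]
    · obtain ⟨l, c, _, hc⟩ := h.twin w hw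
      have h9 : H.mulVec (Pi.single (u j) (-star d)) w = H w (u j) * (-star d) := by simp
      rw [h9, hc, hc v, ← hH.apply (u l) v, hd, star_mul' d, hH.apply]
      ring
    · have h9 : H.mulVec (Pi.single (u j) (-star d)) v = H v (u j) * (-star d) := by simp
      rw [h9, hj, zero_mul]
  have hzero : H v (u 0) = 0 ∨ H v (u 1) = 0 ∨ H v (u 2) = 0 := by
    by_contra! h'
    exact IsFourthRoot.add_add_ne_zero ((hH.isFourthRoot h'.1).mul (h.unit 0))
      ((hH.isFourthRoot h'.2.1).mul (h.unit 1)) ((hH.isFourthRoot h'.2.2).mul (h.unit 2)) hker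
  rcases hzero with h' | h' | h'
  · exact main 0 h'
  · exact main 1 h'
  · exact main 2 h'

/-- On `S`, the matrix is switching equivalent to that of a complete multipartite graph with the
`k` classes given by `c`; the edges from `v` to the class `j` have gain `x j`. -/
structure IsMultipartiteBlock {k : ℕ} (H : Matrix V V ℂ) (v : V) (S : Set V) (c : S → Fin k)
    (s : V → ℂ) (x : Fin k → ℂ) : Prop where
  two_le : 2 ≤ k
  surjective : Function.Surjective c
  unit : ∀ u, IsFourthRoot (s u)
  entry : ∀ a b : S, H a b = if c a = c b then 0 else s a * star (s b)
  gain : ∀ a : S, H v a = x (c a) * star (s a)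
  gain_mem : ∀ j, x j = 0 ∨ IsFourthRoot (x j)

-- The twin relation holds for full rows, in particular at v. So the gain from v, corrected by the
-- switching, is constant on each class.
omit [DecidableEq V] in
theorem IsGainMatrix.exists_isMultipartiteBlock (hH : IsGainMatrix H) (hT : HasTwins H S)
    (hb : IsBalancedOn H S) (he : ∃ u ∈ S, ∃ w ∈ S, H u w ≠ 0) :
    ∃ (k : ℕ) (c : S → Fin k) (s : V → ℂ) (x : Fin k → ℂ), IsMultipartiteBlock H v S c s x := by
  obtain ⟨s, hs, hb⟩ := hb
  obtain ⟨k, c, hc, hc'⟩ := hH.exists_classes hT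
  choose ρ hρ using hc
  obtain ⟨p, hp, q, hq, hpq⟩ := he
  have hk : 2 ≤ k := by
    by_contra! hx
    have : Subsingleton (Fin k) := Fin.subsingleton_iff_le_one.2 (by omega)
    exact hpq ((hc' ⟨p, hp⟩ ⟨q, hq⟩).1 (Subsingleton.elim _ _))
  refine ⟨k, c, s, fun j => H v (ρ j) * s (ρ j), hk, fun j => ⟨ρ j, hρ j⟩, hs, ?_, ?_, ?_⟩
  · intro a b
    split_ifs with h
    · exact (hc' a b).1 h
    · exact (hb a a.2 b b.2).resolve_left fun h' => h ((hc' a b).2 h')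
  · intro a
    obtain ⟨d, hd, hda⟩ := hT a a.2 (ρ (c a)) (ρ (c a)).2 ((hc' _ _).1 (hρ _).symm)
    -- A vertex of a second class is needed to identify the twin factor as a quotient of switching
    -- values.
    have : Nontrivial (Fin k) := Fin.nontrivial_iff_two_le.2 hk
    obtain ⟨l, hl⟩ := exists_ne (c a)
    have h1 : H (ρ (c a)) (ρ l) ≠ 0 := fun h => hl (by
      rw [← hc', hρ, hρ] at h; exact h.symm)
    have h2 : H a (ρ l) ≠ 0 := by rw [hda]; exact mul_ne_zero hd.ne_zero h1
    have h3 := (hb _ (ρ (c a)).2 _ (ρ l).2).resolve_left h1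
    have h4 := (hb _ a.2 _ (ρ l).2).resolve_left h2
    have h5 : d * s (ρ (c a)) = s a := by
      have := hda (ρ l)
      rw [h3, h4] at this
      exact mul_right_cancel₀ (hs (ρ l)).star.ne_zero (by rw [this]; ring)
    have h6 : star d = s (ρ (c a)) * star (s a) := by
      rw [← h5, star_mul']
      linear_combination (-star d) * (hs (ρ (c a))).mul_star
    rw [← hH.apply, hda, star_mul', hH.apply, h6]
    ring
  · intro j
    rcases hH.entry v (ρ j) with h | h
    · left; rw [h, zero_mul]
    · exact Or.inr (h.mul (hs _))

/-- On one representative per class the switched matrix is J − I, with inverse J/(k − 1) − I. The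
weights y = −(J − I)⁻¹ x̄ solve the system, and the contribution is Σ x_j y_j. -/
theorem IsMultipartiteBlock.exists_reduction {k : ℕ} {c : S → Fin k} {s : V → ℂ} {x : Fin k → ℂ}
    (hH : IsGainMatrix H) (h : IsMultipartiteBlock H v S c s x) : ∃ z, IsReduction H v S z ∧
      (H.mulVec z v).im = 0 ∧ (H.mulVec z v).re =
        ∑ j, Complex.normSq (x j) - Complex.normSq (∑ j, x j) / (k - 1) := by
  obtain ⟨ρ, hρ⟩ := h.surjective.hasRightInverse
  have hk : ((k : ℂ) - 1) ≠ 0 := by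
    have h2 := h.two_le
    rw [sub_ne_zero]
    exact_mod_cast (by omega : k ≠ 1)
  let y : Fin k → ℂ := fun j => star (x j) - star (∑ j, x j) / (k - 1)
  let z : V → ℂ := ∑ j, Pi.single (ρ j : V) (y j * s (ρ j))
  have hmul : ∀ w, H.mulVec z w = ∑ j, H w (ρ j) * (y j * s (ρ j)) := by
    intro w
    simp only [z, Matrix.mulVec_sum, Finset.sum_apply]
    refine Finset.sum_congr rfl fun j _ => ?_
    simp
  have hys : ∑ j, y j = - star (∑ j, x j) / (k - 1) := by
    simp only [y, Finset.sum_sub_distrib, Finset.sum_const, Finset.card_univ, Fintype.card_fin,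
      star_sum, nsmul_eq_mul]
    field_simp
    ring
  have hv : H.mulVec z v = ((∑ j, Complex.normSq (x j)
      - Complex.normSq (∑ j, x j) / (k - 1) : ℝ) : ℂ) := by
    rw [hmul]
    have h1 : ∀ j, H v (ρ j) * (y j * s (ρ j)) = x j * y j := by
      intro j
      rw [h.gain, hρ]
      linear_combination x j * y j * (h.unit (ρ j)).star_mul
    simp only [h1, y, mul_sub, Finset.sum_sub_distrib]
    rw [← Finset.sum_mul]
    push_cast
    simp only [Complex.normSq_eq_conj_mul_self, Complex.star_def]
    congr 1
    · exact Finset.sum_congr rfl fun j _ => mul_comm _ _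
    · ring
  refine ⟨z, ⟨fun w hw => ?_, fun w hw => ?_⟩, ?_, ?_⟩
  · simp only [z, Finset.sum_apply]
    refine Finset.sum_eq_zero fun j _ => ?_
    have : w ≠ ρ j := fun h' => hw (h' ▸ (ρ j).2)
    simp [this]
  · rw [hmul, ← hH.apply w v, h.gain ⟨w, hw⟩]
    have h1 : ∀ j, H w (ρ j) * (y j * s (ρ j))
        = s w * y j - if c ⟨w, hw⟩ = j then s w * y j else 0 := by
      intro j
      rw [h.entry ⟨w, hw⟩ (ρ j), hρ]
      split_ifs
      · ring
      · linear_combination s w * y j * (h.unit (ρ j)).star_mul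
    simp only [h1, Finset.sum_sub_distrib, Finset.sum_ite_eq, Finset.mem_univ, if_true]
    rw [← Finset.mul_sum, hys, star_mul', star_star]
    simp only [y]
    field_simp
    ring
  · rw [hv, Complex.ofReal_im]
  · rw [hv, Complex.ofReal_re]

end Reduction

/-! ### Counting the gains from the cut vertex. -/

section ValueCount

open Complex

variable {k : ℕ}

/-- The number of entries of `x` equal to `z`. -/
noncomputable def valueCount (x : Fin k → ℂ) (z : ℂ) : ℕ := (Finset.univ.filter fun j => x j = z).card

theorem valueCount_of_notMem {x : Fin k → ℂ} (hx : ∀ j, x j = 0 ∨ IsFourthRoot (x j)) {z : ℂ}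
    (h0 : z ≠ 0) (hz : ¬ IsFourthRoot z) : valueCount x z = 0 := by
  rw [valueCount, Finset.card_eq_zero, Finset.filter_eq_empty_iff]
  rintro j - rfl
  exact (hx j).elim h0 hz

theorem sum_eq_valueCount {M : Type*} [Semiring M] {x : Fin k → ℂ}
    (hx : ∀ j, x j = 0 ∨ IsFourthRoot (x j)) (f : ℂ → M) :
    ∑ j, f (x j) = valueCount x I * f I + valueCount x (-I) * f (-I) + valueCount x 1 * f 1
      + valueCount x (-1) * f (-1) + valueCount x 0 * f 0 := by
  have key : ∀ z, (valueCount x z : M) * f z = ∑ j, if x j = z then f z else 0 := by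
    intro z
    rw [← Finset.sum_filter, Finset.sum_const, nsmul_eq_mul, valueCount]
  simp only [key, ← Finset.sum_add_distrib]
  refine Finset.sum_congr rfl fun j _ => ?_
  have h1 : (I : ℂ) ≠ -I := fun h => by have := congrArg Complex.im h; norm_num at this
  have h2 : (I : ℂ) ≠ 1 := fun h => by have := congrArg Complex.re h; norm_num at this
  have h3 : (I : ℂ) ≠ -1 := fun h => by have := congrArg Complex.re h; norm_num at this
  have h4 : (-I : ℂ) ≠ 1 := fun h => by have := congrArg Complex.re h; norm_num at this
  have h5 : (-I : ℂ) ≠ -1 := fun h => by have := congrArg Complex.re h; norm_num at this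
  have h6 : (1 : ℂ) ≠ -1 := by norm_num
  rcases hx j with h | h | h | h | h <;> rw [h] <;>
    simp [I_ne_zero.symm, h1, h2, h3, h4, h6, h1.symm, h2.symm, h3.symm, h4.symm, h6.symm]

theorem valueCount_total {x : Fin k → ℂ} (hx : ∀ j, x j = 0 ∨ IsFourthRoot (x j)) :
    valueCount x I + valueCount x (-I) + valueCount x 1 + valueCount x (-1) + valueCount x 0
      = k := by
  have := sum_eq_valueCount hx (fun _ => (1 : ℕ))
  simpa using this.symm

theorem sum_normSq_eq {x : Fin k → ℂ} (hx : ∀ j, x j = 0 ∨ IsFourthRoot (x j)) :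
    ∑ j, normSq (x j) = valueCount x I + valueCount x (-I) + valueCount x 1
      + valueCount x (-1) := by
  rw [sum_eq_valueCount hx]
  simp

theorem normSq_sum_eq {x : Fin k → ℂ} (hx : ∀ j, x j = 0 ∨ IsFourthRoot (x j)) :
    normSq (∑ j, x j) = ((valueCount x 1 : ℝ) - valueCount x (-1)) ^ 2
      + ((valueCount x I : ℝ) - valueCount x (-I)) ^ 2 := by
  have := sum_eq_valueCount hx (fun z => z)
  rw [this]
  simp [normSq_apply]
  ring

theorem valueCount_smul {ω : ℂ} (hω : IsFourthRoot ω) (x : Fin k → ℂ) (z : ℂ) :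
    valueCount (fun j => ω * x j) z = valueCount x (star ω * z) := by
  rw [valueCount, valueCount]
  congr 1
  ext j
  simp only [Finset.mem_filter, Finset.mem_univ, true_and]
  constructor
  · rintro rfl
    rw [← mul_assoc, hω.star_mul, one_mul]
  · intro h
    rw [h, ← mul_assoc, hω.mul_star, one_mul]

theorem valueCount_star (x : Fin k → ℂ) (z : ℂ) :
    valueCount (fun j => star (x j)) z = valueCount x (star z) := by
  rw [valueCount, valueCount]
  congr 1
  ext j
  simp only [Finset.mem_filter, Finset.mem_univ, true_and]
  exact star_eq_iff_star_eq.trans eq_comm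

theorem eq_of_valueCount {x : Fin k → ℂ} {z : ℂ} (h : valueCount x z = k) (j : Fin k) :
    x j = z := by
  have h1 : Finset.univ.filter (fun j => x j = z) = Finset.univ := by
    rw [← Finset.card_eq_iff_eq_univ, Fintype.card_fin]; exact h
  have := Finset.mem_univ j
  rw [← h1] at this
  exact (Finset.mem_filter.1 this).2

theorem exists_perm_of_valueCount {x y : Fin k → ℂ} (h : ∀ z, valueCount x z = valueCount y z) :
    ∃ σ : Equiv.Perm (Fin k), ∀ j, y (σ j) = x j := by
  have hz : ∀ z, Nonempty ({j // x j = z} ≃ {j // y j = z}) := by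
    intro z
    refine ⟨Fintype.equivOfCardEq ?_⟩
    rw [Fintype.card_subtype, Fintype.card_subtype]
    exact h z
  let e : ∀ z, {j // x j = z} ≃ {j // y j = z} := fun z => (hz z).some
  refine ⟨(Equiv.sigmaFiberEquiv x).symm.trans
    ((Equiv.sigmaCongrRight e).trans (Equiv.sigmaFiberEquiv y)), fun j => ?_⟩
  exact (e (x j) ⟨j, rfl⟩).2

/-- The gains of the edges from the special vertex to the classes of `K_{n_1, …, n_k}`. -/
noncomputable def classGain (a b c : ℕ) (j : ℕ) : ℂ :=
  if j < a then I else if j < a + b then -I else if j < a + b + c then 1 else 0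

theorem classGain_mem (a b c j : ℕ) : classGain a b c j = 0 ∨ IsFourthRoot (classGain a b c j) := by
  simp only [classGain, IsFourthRoot]
  split_ifs <;> simp

theorem card_filter_interval {p q : ℕ} (h : q ≤ k) :
    (Finset.univ.filter fun j : Fin k => p ≤ (j : ℕ) ∧ (j : ℕ) < q).card = q - p := by
  rw [← Nat.card_Ico, ← Finset.card_map Fin.valEmbedding]
  congr 1
  ext l
  simp only [Finset.mem_map, Finset.mem_filter, Finset.mem_univ, true_and, Fin.valEmbedding_apply,
    Finset.mem_Ico]
  constructor
  · rintro ⟨j, hj, rfl⟩; exact hj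
  · intro hl
    exact ⟨⟨l, by omega⟩, hl, rfl⟩

theorem valueCount_classGain {a b c : ℕ} (h : a + b + c ≤ k) :
    valueCount (fun j : Fin k => classGain a b c j) I = a ∧
    valueCount (fun j : Fin k => classGain a b c j) (-I) = b ∧
    valueCount (fun j : Fin k => classGain a b c j) 1 = c ∧
    valueCount (fun j : Fin k => classGain a b c j) (-1) = 0 := by
  have h1 : (I : ℂ) ≠ -I := fun h => by have := congrArg Complex.im h; norm_num at this
  have h2 : (I : ℂ) ≠ 1 := fun h => by have := congrArg Complex.re h; norm_num at this
  have h3 : (I : ℂ) ≠ -1 := fun h => by have := congrArg Complex.re h; norm_num at this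
  have h4 : (-I : ℂ) ≠ 1 := fun h => by have := congrArg Complex.re h; norm_num at this
  have h6 : (1 : ℂ) ≠ -1 := by norm_num
  refine ⟨?_, ?_, ?_, ?_⟩
  · refine (congrArg Finset.card (Finset.ext fun j => ?_)).trans
      ((card_filter_interval (k := k) (p := 0) (q := a) (by omega)).trans (by omega))
    simp only [Finset.mem_filter, Finset.mem_univ, true_and, Nat.zero_le]
    simp only [classGain]
    split_ifs with g1 g2 g3 <;> simp [g1, h1.symm, h2.symm, I_ne_zero.symm]
  · refine (congrArg Finset.card (Finset.ext fun j => ?_)).trans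
      ((card_filter_interval (k := k) (p := a) (q := a + b) (by omega)).trans (by omega))
    simp only [Finset.mem_filter, Finset.mem_univ, true_and]
    simp only [classGain]
    split_ifs with g1 g2 g3 <;> simp [h1, h4.symm] <;> omega
  · refine (congrArg Finset.card (Finset.ext fun j => ?_)).trans
      ((card_filter_interval (k := k) (p := a + b) (q := a + b + c) (by omega)).trans (by omega))
    simp only [Finset.mem_filter, Finset.mem_univ, true_and]
    simp only [classGain]
    split_ifs with g1 g2 g3 <;> first | simp [h2]; omega | simp [h4]; omega
  · rw [valueCount, Finset.card_eq_zero, Finset.filter_eq_empty_iff]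
    intro j _
    simp only [classGain]
    split_ifs <;> simp [h3, h2, h6]

theorem exists_perm_classGain {x : Fin k → ℂ} (hx : ∀ j, x j = 0 ∨ IsFourthRoot (x j))
    (h : valueCount x (-1) = 0) : ∃ σ : Equiv.Perm (Fin k), ∀ j,
      classGain (valueCount x I) (valueCount x (-I)) (valueCount x 1) (σ j) = x j := by
  have htot := valueCount_total hx
  obtain ⟨h1, h2, h3, h4⟩ := valueCount_classGain (k := k) (a := valueCount x I)
    (b := valueCount x (-I)) (c := valueCount x 1) (by omega)
  have hg := fun j : Fin k => classGain_mem (valueCount x I) (valueCount x (-I)) (valueCount x 1) j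
  have htot' := valueCount_total hg
  refine exists_perm_of_valueCount (y := fun j : Fin k => classGain _ _ _ j) fun z => ?_
  by_cases hz0 : z = 0
  · subst hz0; omega
  by_cases hz : IsFourthRoot z
  · rcases hz with rfl | rfl | rfl | rfl <;> omega
  · rw [valueCount_of_notMem hx hz0 hz, valueCount_of_notMem hg hz0 hz]

/-- The value of the Schur complement is a combinatorial quantity. -/
theorem schur_eq_valueCount {x : Fin k → ℂ} (hx : ∀ j, x j = 0 ∨ IsFourthRoot (x j)) (hk : 2 ≤ k) :
    (∑ j, normSq (x j) - normSq (∑ j, x j) / (k - 1)) * (k - 1) =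
      4 * valueCount x I * valueCount x (-I) + 4 * valueCount x 1 * valueCount x (-1)
        + 2 * (valueCount x I + valueCount x (-I)) * (valueCount x 1 + valueCount x (-1))
        + (valueCount x I + valueCount x (-I) + valueCount x 1 + valueCount x (-1))
          * (valueCount x 0 - 1) := by
  have hk' : (k : ℝ) - 1 ≠ 0 := by
    rw [sub_ne_zero]; exact_mod_cast (by omega : k ≠ 1)
  have htot : (k : ℝ) = valueCount x I + valueCount x (-I) + valueCount x 1 + valueCount x (-1)
      + valueCount x 0 := by
    exact_mod_cast (valueCount_total hx).symm
  rw [sum_normSq_eq hx, normSq_sum_eq hx, sub_mul, div_mul_cancel₀ _ hk', htot]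
  ring

/-- In the count formula only the linear term a + b + c + d is subtracted. A zero gain offsets it,
and so do two different nonzero gains, since m + n ≤ 2mn for positive m and n. -/
theorem eq_const_of_schur_neg {x : Fin k → ℂ} (hx : ∀ j, x j = 0 ∨ IsFourthRoot (x j)) (hk : 2 ≤ k)
    (h : ∑ j, normSq (x j) - normSq (∑ j, x j) / (k - 1) < 0) :
    ∃ z, IsFourthRoot z ∧ ∀ j, x j = z := by
  have hk' : (0 : ℝ) < (k : ℝ) - 1 := by
    have : (2 : ℝ) ≤ k := by exact_mod_cast hk
    linarith
  have h1 := schur_eq_valueCount hx hk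
  have htot := valueCount_total hx
  have h2 := mul_neg_of_neg_of_pos h hk'
  rw [h1] at h2
  generalize ha : valueCount x I = a at *
  generalize hb : valueCount x (-I) = b at *
  generalize hc : valueCount x 1 = c at *
  generalize hd : valueCount x (-1) = d at *
  generalize hs : valueCount x 0 = s at *
  have h3 : 4 * (a * b) + 4 * (c * d) + 2 * ((a + b) * (c + d)) + (a + b + c + d) * s
      < a + b + c + d := by
    have : (4 * (a * b) + 4 * (c * d) + 2 * ((a + b) * (c + d)) + (a + b + c + d) * s : ℝ)
      < a + b + c + d := by linarith
    exact_mod_cast this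
  have hs0 : s = 0 := by
    by_contra hs0
    have : 1 ≤ s := by omega
    nlinarith [Nat.zero_le (a * b), Nat.zero_le (c * d), Nat.zero_le ((a + b) * (c + d))]
  have hpair : ∀ m n : ℕ, m ≠ 0 → n ≠ 0 → m + n ≤ 2 * (m * n) := by
    intro m n hm hn
    have hm' : 1 ≤ m := by omega
    have hn' : 1 ≤ n := by omega
    nlinarith
  have hab : a + b = 0 ∨ c + d = 0 := by
    by_contra! hh
    have := hpair _ _ hh.1 hh.2
    omega
  have hcd0 : (a + b) * (c + d) = 0 := by rcases hab with h | h <;> simp [h]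
  rw [hcd0, hs0] at h3
  have hab' : a = 0 ∨ b = 0 := by
    by_contra! hh
    have := hpair _ _ hh.1 hh.2
    rcases hab with h | h
    · omega
    · have h5 : c = 0 := by omega
      rw [h5] at h3
      omega
  have hcd' : c = 0 ∨ d = 0 := by
    by_contra! hh
    have := hpair _ _ hh.1 hh.2
    rcases hab with h | h
    · have h5 : a = 0 := by omega
      rw [h5] at h3
      omega
    · omega
  have : a = k ∨ b = k ∨ c = k ∨ d = k := by omega
  rcases this with h | h | h | h
  · exact ⟨I, by simp [IsFourthRoot], eq_of_valueCount (by omega)⟩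
  · exact ⟨-I, by simp [IsFourthRoot], eq_of_valueCount (by omega)⟩
  · exact ⟨1, by simp [IsFourthRoot], eq_of_valueCount (by omega)⟩
  · exact ⟨-1, by simp [IsFourthRoot], eq_of_valueCount (by omega)⟩

end ValueCount

/-! ### Integer solutions of the inertia inequality. -/

section Arithmetic

/-- As r/(r − 1) ≤ 2, the case r = 2 is the weakest; it is used to bound the counts before r is
considered. -/
theorem le_two_mul_of_sub_one_mul_le {r E K : ℤ} (hr : 2 ≤ r) (hK : 0 ≤ K)
    (h : (r - 1) * E ≤ r * K) : E ≤ 2 * K := by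
  by_contra! hlt
  have h1 : 0 < (r - 1) * (E - 2 * K) := mul_pos (by linarith) (by linarith)
  have h2 : 0 ≤ (r - 2) * K := mul_nonneg (by linarith) hK
  linarith

/-- The solutions of the inertia inequality with all gains equal. -/
theorem arith_constant {r p s : ℕ} (hr : 2 ≤ r) (hp : 2 ≤ p)
    (h : ((r : ℤ) - 1) * (p * (s - 1)) ≤ r * (p + s - 1)) :
    p + s ≤ p + 1 ∨ (p + 2 ≤ p + s ∧
      (1 : ℚ) ≤ 1 / (r : ℚ) + 1 / (p : ℚ) + 1 / (((p + s : ℕ) : ℚ) - (p : ℚ) - 1)) := by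
  by_cases hs : s ≤ 1
  · left; omega
  · right
    refine ⟨by omega, ?_⟩
    have h' : ((r : ℚ) - 1) * (p * (s - 1)) ≤ r * (p + s - 1) := by exact_mod_cast h
    have hs' : (0 : ℚ) < s - 1 := by
      have : (2 : ℚ) ≤ s := by exact_mod_cast (by omega : 2 ≤ s)
      linarith
    have hr' : (0 : ℚ) < r := by exact_mod_cast (by omega : 0 < r)
    have hp' : (0 : ℚ) < p := by exact_mod_cast (by omega : 0 < p)
    push_cast
    have e : (p : ℚ) + s - p - 1 = s - 1 := by ring
    rw [e, div_add_div _ _ hr'.ne' hp'.ne', div_add_div _ _ (by positivity) hs'.ne',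
      le_div_iff₀ (by positivity)]
    linarith

/-- The solutions of the inertia inequality with opposite gains. -/
theorem arith_opposite {r a b s : ℕ} (hr : 2 ≤ r) (hab : b ≤ a) (hb : 1 ≤ b)
    (h : ((r : ℤ) - 1) * (4 * a * b + (a + b) * (s - 1)) ≤ r * (a + b + s - 1)) :
    a = 1 ∧ b = 1 ∧ r = 2 := by
  have h1 : (4 * a * b + (a + b) * (s - 1) : ℤ) ≤ 2 * (a + b + s - 1) :=
    le_two_mul_of_sub_one_mul_le (by exact_mod_cast hr) (by omega) h
  have ha1 : a = 1 := by
    by_contra ha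
    have h2 : (2 : ℤ) ≤ a := by exact_mod_cast (by omega : 2 ≤ a)
    have h3 : (1 : ℤ) ≤ b := by exact_mod_cast hb
    have h4 : (0 : ℤ) ≤ s * (a + b - 2) := mul_nonneg (by positivity) (by linarith)
    have h5 : (0 : ℤ) ≤ (a - 1) * (b - 1) := mul_nonneg (by linarith) (by linarith)
    linarith
  have hb1 : b = 1 := by omega
  refine ⟨ha1, hb1, ?_⟩
  subst ha1; subst hb1
  -- With a = b = 1 the inequality reads (r − 2)(s + 1) ≤ 0.
  push_cast at h
  by_contra hr2
  have : (3 : ℤ) ≤ r := by exact_mod_cast (by omega : 3 ≤ r)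
  have h4 : (0 : ℤ) ≤ (r - 3) * s := mul_nonneg (by linarith) (by positivity)
  linarith

/-- The solutions of the inertia inequality with adjacent gains. -/
theorem arith_adjacent {r a c s : ℕ} (hr : 2 ≤ r) (hca : c ≤ a) (hc : 1 ≤ c)
    (h : ((r : ℤ) - 1) * (2 * a * c + (a + c) * (s - 1)) ≤ r * (a + c + s - 1)) :
    (a = 1 ∧ c = 1 ∧ (s = 0 ∨ s = 1)) ∨
    (a = 1 ∧ c = 1 ∧ s = 2 ∧ (r = 3 ∨ r = 4)) ∨
    (a = 1 ∧ c = 1 ∧ s = 3 ∧ r = 3) ∨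
    (a = 1 ∧ c = 1 ∧ 2 ≤ s ∧ r = 2) ∨
    (a = 2 ∧ c = 2 ∧ s = 0 ∧ 2 ≤ r ∧ r ≤ 4) ∨
    (a = 2 ∧ c = 2 ∧ s = 1 ∧ r = 2) ∨
    (a = 3 ∧ s = 0 ∧ r = 2 ∧ c = 2) ∨
    (a = 4 ∧ c = 2 ∧ r = 2 ∧ s = 0) ∨
    (2 ≤ a ∧ c = 1 ∧ ((a : ℚ) * (s : ℚ) - 1) / ((a : ℚ) + (s : ℚ)) ≤ 1 / ((r : ℚ) - 1)) := by
  have hr' : (2 : ℤ) ≤ r := by exact_mod_cast hr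
  have hs' : (0 : ℤ) ≤ s := by positivity
  have hc' : (1 : ℤ) ≤ c := by exact_mod_cast hc
  have hca' : (c : ℤ) ≤ a := by exact_mod_cast hca
  have h1 : (2 * a * c + (a + c) * (s - 1) : ℤ) ≤ 2 * (a + c + s - 1) :=
    le_two_mul_of_sub_one_mul_le hr' (by omega) h
  by_cases hc1 : c = 1
  · subst hc1
    by_cases ha1 : a = 1
    · subst ha1
      push_cast at h
      -- Equivalently (r − 2)(s − 1) ≤ 2.
      have h2 : (r : ℤ) * s ≤ 2 * s + r := by linarith
      have h3 : r * s ≤ 2 * s + r := by exact_mod_cast h2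
      by_cases hr2 : r = 2
      · have : s = 0 ∨ s = 1 ∨ 2 ≤ s := by omega
        rcases this with hs | hs | hs <;> simp [hs, hr2]
      · have hs3 : s ≤ 3 := by
          by_contra! hs
          obtain ⟨r', rfl⟩ : ∃ r', r = r' + 3 := ⟨r - 3, by omega⟩
          have h4 : r' * 4 ≤ r' * s := Nat.mul_le_mul_left r' hs
          have h5 : (r' + 3) * s = r' * s + 3 * s := by ring
          omega
        have : s = 0 ∨ s = 1 ∨ s = 2 ∨ s = 3 := by omega
        rcases this with rfl | rfl | rfl | rfl
        · simp
        · simp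
        · have : r = 3 ∨ r = 4 := by omega
          simp [this]
        · have : r = 3 := by omega
          simp [this]
    · right; right; right; right; right; right; right; right
      refine ⟨by omega, rfl, ?_⟩
      have hr1 : (0 : ℚ) < (r : ℚ) - 1 := by
        have : (2 : ℚ) ≤ r := by exact_mod_cast hr
        linarith
      have has : (0 : ℚ) < (a : ℚ) + s := by
        have : (1 : ℚ) ≤ a := by exact_mod_cast (by omega : 1 ≤ a)
        have : (0 : ℚ) ≤ s := by positivity
        linarith
      -- For c = 1 the inertia inequality simplifies to (r − 1)(as − 1) ≤ a + s.
      rw [div_le_div_iff₀ has hr1]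
      have h' : ((r : ℚ) - 1) * (2 * a * (1 : ℕ) + (a + (1 : ℕ)) * (s - 1))
        ≤ r * (a + (1 : ℕ) + s - 1) := by exact_mod_cast h
      push_cast at h'
      linarith
  · have hc2 : (2 : ℤ) ≤ c := by exact_mod_cast (by omega : 2 ≤ c)
    have hc3 : c = 2 := by
      by_contra hc3
      have h3 : (3 : ℤ) ≤ c := by exact_mod_cast (by omega : 3 ≤ c)
      have h4 : (0 : ℤ) ≤ (a - 3) * (c - 3) := mul_nonneg (by linarith) (by linarith)
      have h5 : (0 : ℤ) ≤ s * (a + c - 2) := mul_nonneg hs' (by linarith)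
      linarith
    subst hc3
    push_cast at h h1
    -- For c = 2 the r = 2 inequality collapses to a(s + 1) ≤ 4.
    have ha4 : a ≤ 4 := by
      have : (a : ℤ) ≤ 4 := by
        have : (0 : ℤ) ≤ a * s := by positivity
        linarith
      exact_mod_cast this
    have hs1 : (a * s + a : ℤ) ≤ 4 := by linarith
    have hs2 : a * s + a ≤ 4 := by exact_mod_cast hs1
    have hcases : (a = 2 ∧ s = 0) ∨ (a = 2 ∧ s = 1) ∨ (a = 3 ∧ s = 0) ∨ (a = 4 ∧ s = 0) := by
      have : a = 2 ∨ a = 3 ∨ a = 4 := by omega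
      rcases this with rfl | rfl | rfl <;> omega
    rcases hcases with ⟨rfl, rfl⟩ | ⟨rfl, rfl⟩ | ⟨rfl, rfl⟩ | ⟨rfl, rfl⟩ <;> push_cast at h
    · have : r ≤ 4 := by omega
      simp [this, hr]
    · have : r = 2 := by omega
      simp [this]
    · have : r = 2 := by omega
      simp [this]
    · have : r = 2 := by omega
      simp [this]

end Arithmetic

/-! ### Matrix entries of the standard graphs. -/

section KMixed

variable {r k : ℕ} {q : Fin r → ℕ} {n : Fin k → ℕ} {a b c : ℕ}

theorem ofSimpleGraph_kGraph (p : ℕ) :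
    MixedGraph.ofSimpleGraph (kGraph q n p) = kMixed q n 0 0 p := by
  apply MixedGraph.ext
  · ext x y
    rcases x with _ | x | x <;> rcases y with _ | y | y <;>
      simp [MixedGraph.ofSimpleGraph, kGraph, kMixed]
  · ext x y
    rcases x with _ | x | x <;> rcases y with _ | y | y <;>
      simp [MixedGraph.ofSimpleGraph, kMixed]

theorem kMixed_herm_none_none : (kMixed q n a b c).herm none none = 0 :=
  (kMixed q n a b c).isGainMatrix_herm.diag none

theorem kMixed_herm_none_inl (x : Σ j : Fin r, Fin (q j)) :
    (kMixed q n a b c).herm none (some (.inl x)) = 1 := by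
  simp [MixedGraph.herm, kMixed]

theorem kMixed_herm_inl_none (x : Σ j : Fin r, Fin (q j)) :
    (kMixed q n a b c).herm (some (.inl x)) none = 1 := by
  simp [MixedGraph.herm, kMixed]

theorem kMixed_herm_none_inr (x : Σ j : Fin k, Fin (n j)) :
    (kMixed q n a b c).herm none (some (.inr x)) = classGain a b c x.1 := by
  simp only [MixedGraph.herm, kMixed, classGain]
  by_cases h1 : (x.1 : ℕ) < a
  · have : ¬ (a + b ≤ (x.1 : ℕ)) := by omega
    simp [h1, this]
  by_cases h2 : (x.1 : ℕ) < a + b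
  · have : ¬ (a + b ≤ (x.1 : ℕ)) := by omega
    simp [h1, h2, this, Nat.le_of_not_lt h1]
  by_cases h3 : (x.1 : ℕ) < a + b + c
  · simp [h1, h2, h3, Nat.le_of_not_lt h2]
  · simp [h1, h2, h3]

theorem kMixed_herm_inr_none (x : Σ j : Fin k, Fin (n j)) :
    (kMixed q n a b c).herm (some (.inr x)) none = star (classGain a b c x.1) := by
  rw [← (kMixed q n a b c).isGainMatrix_herm.apply, kMixed_herm_none_inr]

theorem kMixed_herm_inl_inl (x y : Σ j : Fin r, Fin (q j)) :
    (kMixed q n a b c).herm (some (.inl x)) (some (.inl y)) = if x.1 = y.1 then 0 else 1 := by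
  by_cases h : x.1 = y.1 <;> simp [MixedGraph.herm, kMixed, h]

theorem kMixed_herm_inr_inr (x y : Σ j : Fin k, Fin (n j)) :
    (kMixed q n a b c).herm (some (.inr x)) (some (.inr y)) = if x.1 = y.1 then 0 else 1 := by
  by_cases h : x.1 = y.1 <;> simp [MixedGraph.herm, kMixed, h]

theorem kMixed_herm_inl_inr (x : Σ j : Fin r, Fin (q j)) (y : Σ j : Fin k, Fin (n j)) :
    (kMixed q n a b c).herm (some (.inl x)) (some (.inr y)) = 0 := by
  simp [MixedGraph.herm, kMixed]

theorem kMixed_herm_inr_inl (x : Σ j : Fin r, Fin (q j)) (y : Σ j : Fin k, Fin (n j)) :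
    (kMixed q n a b c).herm (some (.inr y)) (some (.inl x)) = 0 := by
  simp [MixedGraph.herm, kMixed]

end KMixed

/-! ### Renormalizing blocks and switching to standard form. -/

section Blocks

variable {V : Type*} {H : Matrix V V ℂ} {v : V} {S S' : Set V} {k : ℕ} {c : S → Fin k} {s : V → ℂ}
  {x : Fin k → ℂ}

/-- A common factor on the switching function leaves the inside of the block alone and rotates all
gains from v. The two sides can be rotated independently. -/
theorem IsMultipartiteBlock.smul (h : IsMultipartiteBlock H v S c s x) {ω : ℂ}
    (hω : IsFourthRoot ω) :
    IsMultipartiteBlock H v S c (fun u => ω * s u) (fun j => ω * x j) where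
  two_le := h.two_le
  surjective := h.surjective
  unit u := hω.mul (h.unit u)
  entry a b := by
    rw [h.entry]
    split_ifs
    · rfl
    · rw [star_mul']; linear_combination (-s a * star (s b)) * hω.mul_star
  gain a := by
    rw [h.gain, star_mul']; linear_combination (-x (c a) * star (s a)) * hω.mul_star
  gain_mem j := (h.gain_mem j).imp (fun h => by rw [h, mul_zero]) fun h => hω.mul h

theorem IsMultipartiteBlock.perm (h : IsMultipartiteBlock H v S c s x) (σ : Equiv.Perm (Fin k))
    {y : Fin k → ℂ} (hy : ∀ j, y (σ j) = x j) :
    IsMultipartiteBlock H v S (fun a => σ (c a)) s y where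
  two_le := h.two_le
  surjective := σ.surjective.comp h.surjective
  unit := h.unit
  entry a b := by rw [h.entry]; simp
  gain a := by rw [h.gain, hy]
  gain_mem j := by
    rw [← σ.apply_symm_apply j, hy]
    exact h.gain_mem _

theorem IsMultipartiteBlock.star (h : IsMultipartiteBlock H v S c s x) {H' : Matrix V V ℂ}
    (hH' : ∀ u w, H' u w = Star.star (H u w)) :
    IsMultipartiteBlock H' v S c (fun u => Star.star (s u)) (fun j => Star.star (x j)) where
  two_le := h.two_le
  surjective := h.surjective
  unit u := (h.unit u).star
  entry a b := by
    rw [hH', h.entry]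
    split_ifs
    · simp
    · rw [star_mul']
  gain a := by rw [hH', h.gain, star_mul']
  gain_mem j := (h.gain_mem j).imp (fun h => by rw [h, star_zero]) fun h => h.star

theorem IsSplit.star (h : IsSplit H v S S') {H' : Matrix V V ℂ}
    (hH' : ∀ u w, H' u w = Star.star (H u w)) : IsSplit H' v S S' := by
  have hne : ∀ u w, H' u w ≠ 0 ↔ H u w ≠ 0 := fun u w => by rw [hH', Ne, star_eq_zero]
  constructor
  · exact h.notMem_left
  · exact h.notMem_right
  · exact h.cover
  · exact h.disjoint
  · intro u hu w hw
    rw [hH', h.zero u hu w hw, star_zero]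
  · intro A hA hA'
    exact h.connected_left A hA fun u hu huA w hw huw => hA' u hu huA w hw ((hne _ _).2 huw)
  · intro A hA hA'
    exact h.connected_right A hA fun u hu huA w hw huw => hA' u hu huA w hw ((hne _ _).2 huw)
  · simp only [hne]; exact h.edge_left
  · simp only [hne]; exact h.edge_right
  · simp only [hne]; exact h.adj_left
  · simp only [hne]; exact h.adj_right

end Blocks

namespace MixedGraph

variable {V W : Type*} {G : MixedGraph V} {G' : MixedGraph W} {e : V ≃ W}

theorem SwitchingEquivVia.of_converse (h : SwitchingEquivVia e G.converse G') :
    SwitchingEquivVia e G G' := by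
  obtain ⟨Q, hQ, h⟩ := h
  exact ⟨Q, hQ, h.symm⟩

theorem SwitchingEquivVia.adj_iff (h : SwitchingEquivVia e G G') (u w : V) :
    G'.graph.Adj (e u) (e w) ↔ G.graph.Adj u w := by
  obtain ⟨Q, hQ, h⟩ := h
  have hne : ∀ u, Q u ≠ 0 := fun u => IsFourthRoot.ne_zero (hQ u)
  rw [← herm_ne_zero_iff, ← herm_ne_zero_iff]
  rcases h with h | h
  · rw [h]
    simp [hne]
  · rw [h, converse_herm]
    simp [hne]

variable [Fintype V] {v : V} {S S' : Set V}

/-- If all gains from `v` to the block `S` are `1` and those to `S'` are sorted, then the mixed graph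
is switching equivalent to one of the standard ones. -/
theorem exists_kMixed (hS : IsSplit G.herm v S S') {r k a b d : ℕ} {c : S → Fin r}
    {c' : S' → Fin k} {s s' : V → ℂ} (h : IsMultipartiteBlock G.herm v S c s fun _ => 1)
    (h' : IsMultipartiteBlock G.herm v S' c' s' fun j => classGain a b d j) :
    ∃ (q : Fin r → ℕ) (n : Fin k → ℕ), (∀ j, 0 < q j) ∧ (∀ j, 0 < n j) ∧
      ∃ e : V ≃ KVertex q n, e v = none ∧ SwitchingEquivVia e G (kMixed q n a b d) := by
  classical
  have hH := G.isGainMatrix_herm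
  obtain ⟨q, hq, e₁, he₁⟩ := exists_equiv_sigma h.surjective
  obtain ⟨n, hn, e₂, he₂⟩ := exists_equiv_sigma h'.surjective
  let φ : KVertex q n → V := fun y => match y with
    | none => v
    | some (.inl y) => (e₁.symm y).1
    | some (.inr y) => (e₂.symm y).1
  have m₁ : ∀ y, (e₁.symm y).1 ∈ S := fun y => (e₁.symm y).2
  have m₂ : ∀ y, (e₂.symm y).1 ∈ S' := fun y => (e₂.symm y).2
  have hφ : Function.Bijective φ := by
    constructor
    · have n₁ : ∀ y, φ (some (.inl y)) ∈ S := m₁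
      have n₂ : ∀ y, φ (some (.inr y)) ∈ S' := m₂
      rintro (_ | x | x) (_ | y | y) hxy
      · rfl
      · exact absurd (hxy ▸ n₁ y : φ none ∈ S) hS.notMem_left
      · exact absurd (hxy ▸ n₂ y : φ none ∈ S') hS.notMem_right
      · exact absurd (hxy ▸ n₁ x : φ none ∈ S) hS.notMem_left
      · rw [e₁.symm.injective (Subtype.ext hxy)]
      · exact absurd (hxy ▸ n₂ y) (hS.disjoint _ (n₁ x))
      · exact absurd (hxy ▸ n₂ x : φ none ∈ S') hS.notMem_right
      · exact absurd (hxy ▸ n₂ x) (hS.disjoint _ (n₁ y))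
      · rw [e₂.symm.injective (Subtype.ext hxy)]
    · intro x
      rcases hS.cover x with hx | hx | hx
      · exact ⟨none, hx.symm⟩
      · exact ⟨some (.inl (e₁ ⟨x, hx⟩)), by simp [φ]⟩
      · exact ⟨some (.inr (e₂ ⟨x, hx⟩)), by simp [φ]⟩
  -- No edge joins S and S', so the two switchings combine without conflict, with value 1 at v.
  let Q : V → ℂ := fun u => if u ∈ S then s u else if u ∈ S' then s' u else 1
  have hQ : ∀ u, IsFourthRoot (Q u) := by
    intro u
    simp only [Q]
    split_ifs
    · exact h.unit u
    · exact h'.unit u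
    · exact IsFourthRoot.one
  have Qv : Q v = 1 := by simp [Q, hS.notMem_left, hS.notMem_right]
  have Q1 : ∀ u ∈ S, Q u = s u := fun u hu => by simp [Q, hu]
  have Q2 : ∀ u ∈ S', Q u = s' u := fun u hu => by
    have : u ∉ S := fun h => hS.disjoint u h hu
    simp [Q, hu, this]
  have c₁ : ∀ y, c (e₁.symm y) = y.1 := fun y => by rw [← he₁]; simp
  have c₂ : ∀ y, c' (e₂.symm y) = y.1 := fun y => by rw [← he₂]; simp
  refine ⟨q, n, hq, hn, (Equiv.ofBijective φ hφ).symm, ?_, Q, hQ, Or.inl ?_⟩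
  · rw [Equiv.symm_apply_eq]; rfl
  have key : ∀ y z, (kMixed q n a b d).herm y z = (Q (φ y))⁻¹ * G.herm (φ y) (φ z) * Q (φ z) := by
    intro y z
    rw [(hQ _).inv_eq]
    rcases y with _ | y | y <;> rcases z with _ | z | z <;>
      simp only [φ, Qv, Q1 _ (m₁ _), Q2 _ (m₂ _)]
    · rw [kMixed_herm_none_none, hH.diag]; simp
    · rw [kMixed_herm_none_inl, h.gain, star_one, one_mul, one_mul, (h.unit _).star_mul]
    · rw [kMixed_herm_none_inr, h'.gain, star_one, one_mul, c₂]
      linear_combination (-classGain a b d z.1) * (h'.unit (e₂.symm z).1).star_mul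
    · rw [kMixed_herm_inl_none, ← hH.apply, h.gain, one_mul, star_star, mul_one,
        (h.unit _).star_mul]
    · rw [kMixed_herm_inl_inl, h.entry, c₁, c₁]
      split_ifs
      · simp
      · linear_combination (-1 : ℂ) * (h.unit (e₁.symm y).1).star_mul
          - (star (s (e₁.symm y).1) * s (e₁.symm y).1) * (h.unit (e₁.symm z).1).star_mul
    · rw [kMixed_herm_inl_inr, hS.zero _ (m₁ y) _ (m₂ z)]; simp
    · rw [kMixed_herm_inr_none, ← hH.apply, h'.gain, c₂, star_mul', star_star]
      linear_combination (-star (classGain a b d y.1)) * (h'.unit (e₂.symm y).1).star_mul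
    · rw [kMixed_herm_inr_inl, hH.eq_zero_comm.1 (hS.zero _ (m₁ z) _ (m₂ y))]; simp
    · rw [kMixed_herm_inr_inr, h'.entry, c₂, c₂]
      split_ifs
      · simp
      · linear_combination (-1 : ℂ) * (h'.unit (e₂.symm y).1).star_mul
          - (star (s' (e₂.symm y).1) * s' (e₂.symm y).1) * (h'.unit (e₂.symm z).1).star_mul
  intro u w
  have h1 : ∀ u, φ ((Equiv.ofBijective φ hφ).symm u) = u := fun u =>
    (Equiv.ofBijective φ hφ).apply_symm_apply u
  rw [key, h1, h1]

/-- Sorting the classes of the second block. -/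
theorem exists_kMixed_of_valueCount (hS : IsSplit G.herm v S S') {r k : ℕ} {c : S → Fin r}
    {c' : S' → Fin k} {s s' : V → ℂ} {y : Fin k → ℂ}
    (h : IsMultipartiteBlock G.herm v S c s fun _ => 1)
    (h' : IsMultipartiteBlock G.herm v S' c' s' y) (hy : valueCount y (-1) = 0) :
    ∃ (q : Fin r → ℕ) (n : Fin k → ℕ), (∀ j, 0 < q j) ∧ (∀ j, 0 < n j) ∧
      ∃ e : V ≃ KVertex q n, e v = none ∧ SwitchingEquivVia e G
        (kMixed q n (valueCount y Complex.I) (valueCount y (-Complex.I)) (valueCount y 1)) := by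
  obtain ⟨σ, hσ⟩ := exists_perm_classGain h'.gain_mem hy
  exact exists_kMixed hS h (h'.perm σ hσ)

end MixedGraph

theorem pos_of_two_le {k : ℕ} (hk : 2 ≤ k) : 0 < k := lt_of_lt_of_le two_pos hk

namespace MixedGraph

/-- `G` is obtained by identifying vertices of two multipartite graphs of positive inertia index one. -/
def IsGlueType {V : Type*} (G : MixedGraph V) (v : V) : Prop :=
      (∃ (x y : ℕ) (m : Fin x → ℕ) (m' : Fin y → ℕ)
        (M : MixedGraph (Σ j : Fin x, Fin (m j))) (M' : MixedGraph (Σ j : Fin y, Fin (m' j)))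
        (v₁ : Σ j : Fin x, Fin (m j)) (v₂ : Σ j : Fin y, Fin (m' j)),
        2 ≤ x ∧ 2 ≤ y ∧ (∀ j, 0 < m j) ∧ (∀ j, 0 < m' j) ∧
        M.graph = SimpleGraph.completeMultipartiteGraph (fun j => Fin (m j)) ∧
        M'.graph = SimpleGraph.completeMultipartiteGraph (fun j => Fin (m' j)) ∧
        ¬ M.IsMixedStar ∧ ¬ M'.IsMixedStar ∧
        (M.IsPositive ∨ M.IsC3Type) ∧ (M'.IsPositive ∨ M'.IsC3Type) ∧
        ∃ e : V ≃ MixedGraph.GlueVertex (Σ j : Fin x, Fin (m j)) v₂, e v = Sum.inl v₁ ∧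
          MixedGraph.SwitchingEquivVia e G (MixedGraph.glue M v₁ M' v₂))

/-- All gains of the edges from `v` to the second block are equal. -/
def IsConstantGainType {V : Type*} (G : MixedGraph V) (v : V) : Prop :=
      (∃ (r k p : ℕ) (q : Fin r → ℕ) (n : Fin k → ℕ) (_ : 2 ≤ r) (hk : 2 ≤ k),
        1 ≤ p ∧ p ≤ k ∧ (∀ j, 0 < q j) ∧ (∀ j, 0 < n j) ∧
        ((p = 1 ∧ ((n ⟨0, pos_of_two_le hk⟩ = 1 ∧ p + 2 ≤ k) ∨ 2 ≤ n ⟨0, pos_of_two_le hk⟩)) ∨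
          (2 ≤ p ∧ k ≤ p + 1) ∨
          (2 ≤ p ∧ p + 2 ≤ k ∧
            (1 : ℚ) ≤ 1 / (r : ℚ) + 1 / (p : ℚ) + 1 / ((k : ℚ) - (p : ℚ) - 1))) ∧
        ∃ e : V ≃ KVertex q n, e v = none ∧
          MixedGraph.SwitchingEquivVia e G (MixedGraph.ofSimpleGraph (kGraph q n p)))

/-- The gains of the edges from `v` to the second block are `i` and `-i`. -/
def IsOppositeGainType {V : Type*} (G : MixedGraph V) (v : V) : Prop :=
      (∃ (r k a b s : ℕ) (q : Fin r → ℕ) (n : Fin k → ℕ),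
        2 ≤ r ∧ 2 ≤ k ∧ b ≤ a ∧ 1 ≤ b ∧ a + b + s = k ∧ (∀ j, 0 < q j) ∧ (∀ j, 0 < n j) ∧
        (a = 1 ∧ b = 1 ∧ r = 2) ∧
        ∃ e : V ≃ KVertex q n, e v = none ∧
          MixedGraph.SwitchingEquivVia e G (kMixed q n a b 0))

/-- The gains of the edges from `v` to the second block are `i` and `1`. -/
def IsAdjacentGainType {V : Type*} (G : MixedGraph V) (v : V) : Prop :=
      (∃ (r k a c s : ℕ) (q : Fin r → ℕ) (n : Fin k → ℕ),
        2 ≤ r ∧ 2 ≤ k ∧ c ≤ a ∧ 1 ≤ c ∧ a + c + s = k ∧ (∀ j, 0 < q j) ∧ (∀ j, 0 < n j) ∧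
        ((a = 1 ∧ c = 1 ∧ (s = 0 ∨ s = 1)) ∨
          (a = 1 ∧ c = 1 ∧ s = 2 ∧ (r = 3 ∨ r = 4)) ∨
          (a = 1 ∧ c = 1 ∧ s = 3 ∧ r = 3) ∨
          (a = 1 ∧ c = 1 ∧ 2 ≤ s ∧ r = 2) ∨
          (a = 2 ∧ c = 2 ∧ s = 0 ∧ 2 ≤ r ∧ r ≤ 4) ∨
          (a = 2 ∧ c = 2 ∧ s = 1 ∧ r = 2) ∨
          (a = 3 ∧ s = 0 ∧ r = 2 ∧ c = 2) ∨
          (a = 4 ∧ c = 2 ∧ r = 2 ∧ s = 0) ∨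
          (2 ≤ a ∧ c = 1 ∧
            ((a : ℚ) * (s : ℚ) - 1) / ((a : ℚ) + (s : ℚ)) ≤ 1 / ((r : ℚ) - 1))) ∧
        ∃ e : V ≃ KVertex q n, e v = none ∧
          MixedGraph.SwitchingEquivVia e G (kMixed q n a 0 c))

end MixedGraph

/-! ### From the Schur bound to the list of graphs. -/

section SchurBound

variable {r k : ℕ} {y : Fin k → ℂ}

/-- The Schur complement of the gains `y` is at most `r / (r - 1)`. -/
def SchurBound (r : ℕ) (y : Fin k → ℂ) : Prop :=
  ∑ j, Complex.normSq (y j) - Complex.normSq (∑ j, y j) / (k - 1) ≤ (r : ℝ) / (r - 1)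

theorem IsFourthRoot.normSq_eq {ω : ℂ} (hω : IsFourthRoot ω) : Complex.normSq ω = 1 := by
  rcases hω with rfl | rfl | rfl | rfl <;> simp

theorem SchurBound.smul (h : SchurBound r y) {ω : ℂ} (hω : IsFourthRoot ω) :
    SchurBound r fun j => ω * y j := by
  simp only [SchurBound] at h ⊢
  rw [← Finset.mul_sum]
  simpa [hω.normSq_eq] using h

theorem SchurBound.star (h : SchurBound r y) : SchurBound r fun j => star (y j) := by
  simp only [SchurBound] at h ⊢
  rw [← star_sum]
  simpa only [Complex.star_def, Complex.normSq_conj] using h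

/-- Clearing the denominators k − 1 and r − 1 leaves an inequality between integers in the five
counts. -/
theorem SchurBound.valueCount (hr : 2 ≤ r) (hk : 2 ≤ k) (hy : ∀ j, y j = 0 ∨ IsFourthRoot (y j))
    (h : SchurBound r y) {a b c d s : ℕ} (ha : valueCount y Complex.I = a)
    (hb : valueCount y (-Complex.I) = b) (hc : valueCount y 1 = c)
    (hd : valueCount y (-1) = d) (hs : valueCount y 0 = s) :
    ((r : ℤ) - 1) * (4 * a * b + 4 * c * d + 2 * (a + b) * (c + d) + (a + b + c + d) * (s - 1))
      ≤ r * (a + b + c + d + s - 1) := by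
  have hk' : (0 : ℝ) < (k : ℝ) - 1 := by
    have : (2 : ℝ) ≤ k := by exact_mod_cast hk
    linarith
  have hr' : (0 : ℝ) < (r : ℝ) - 1 := by
    have : (2 : ℝ) ≤ r := by exact_mod_cast hr
    linarith
  have h1 := schur_eq_valueCount hy hk
  have h2 := mul_le_mul_of_nonneg_right h hk'.le
  have htot := valueCount_total hy
  rw [h1, div_mul_eq_mul_div, le_div_iff₀ hr'] at h2
  rw [ha, hb, hc, hd, hs] at h2 htot
  have htot' : (k : ℝ) = a + b + c + d + s := by exact_mod_cast htot.symm
  rw [htot'] at h2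
  have h3 : ((r : ℝ) - 1) * (4 * a * b + 4 * c * d + 2 * (a + b) * (c + d)
      + (a + b + c + d) * (s - 1)) ≤ r * (a + b + c + d + s - 1) := by linarith
  exact_mod_cast h3

end SchurBound

namespace MixedGraph

variable {V : Type*} [Fintype V] {G : MixedGraph V} {v : V}

-- Vertices of the second class see only the first class, which is a single vertex. This is where
-- the condition on n₁ for p = 1 comes from; inertia imposes nothing there.
omit [Fintype V] in
theorem isPendant_of_kMixed {r k : ℕ} {q : Fin r → ℕ} {n : Fin k → ℕ} (hk : k = 2)
    {e : V ≃ KVertex q n} (h : SwitchingEquivVia e G (kMixed q n 0 0 1)) (hn : ∀ j, 0 < n j)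
    (h0 : n ⟨0, by omega⟩ = 1) : ∃ u, IsPendant G.graph u := by
  subst hk
  let u : KVertex q n := some (.inr ⟨⟨1, by omega⟩, ⟨0, hn _⟩⟩)
  let w : KVertex q n := some (.inr ⟨⟨0, by omega⟩, ⟨0, hn _⟩⟩)
  refine ⟨e.symm u, ?_⟩
  rw [IsPendant, Set.ncard_eq_one]
  refine ⟨e.symm w, Set.eq_singleton_iff_unique_mem.2 ⟨?_, fun t ht => ?_⟩⟩
  · change G.graph.Adj (e.symm u) (e.symm w)
    rw [← h.adj_iff, e.apply_symm_apply, e.apply_symm_apply, ← herm_ne_zero_iff,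
      kMixed_herm_inr_inr]
    simp
  · change G.graph.Adj (e.symm u) t at ht
    rw [← h.adj_iff, e.apply_symm_apply, ← herm_ne_zero_iff] at ht
    rw [Equiv.eq_symm_apply]
    generalize e t = t' at ht ⊢
    rcases t' with _ | x | x
    · rw [kMixed_herm_inr_none] at ht
      simp [classGain] at ht
    · rw [kMixed_herm_inr_inl] at ht
      exact absurd rfl ht
    · rw [kMixed_herm_inr_inr] at ht
      obtain ⟨⟨j, hj⟩, i⟩ := x
      have hj0 : j = 0 := by
        by_contra hj0
        have : j = 1 := by omega
        subst this
        simp at ht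
      subst hj0
      have : i = ⟨0, hn _⟩ := by
        apply Fin.ext
        have := i.2
        change i.1 = 0
        have h0' : n ⟨0, hj⟩ = 1 := h0
        omega
      rw [this]

variable {S S' : Set V} {r k : ℕ} {c : S → Fin r} {c' : S' → Fin k} {s s' : V → ℂ} {y : Fin k → ℂ}

theorem isConstantGainType_of_block (hpend : ∀ u, ¬ IsPendant G.graph u)
    (hS : IsSplit G.herm v S S') (h : IsMultipartiteBlock G.herm v S c s fun _ => 1)
    (h' : IsMultipartiteBlock G.herm v S' c' s' y) (hB : SchurBound r y)
    (ha : valueCount y Complex.I = 0) (hb : valueCount y (-Complex.I) = 0)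
    (hd : valueCount y (-1) = 0) (hc : 1 ≤ valueCount y 1) : IsConstantGainType G v := by
  obtain ⟨q, n, hq, hn, e, hev, he⟩ := exists_kMixed_of_valueCount hS h h' hd
  have htot := valueCount_total h'.gain_mem
  have hr := h.two_le
  have hk := h'.two_le
  have hineq := hB.valueCount hr hk h'.gain_mem ha hb rfl hd rfl
  rw [ha, hb] at he
  generalize valueCount y 1 = p at *
  generalize valueCount y 0 = t at *
  refine ⟨r, k, p, q, n, hr, hk, hc, by omega, hq, hn, ?_, e, hev, ?_⟩
  · by_cases hp : p = 1
    · left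
      refine ⟨hp, ?_⟩
      by_cases h0 : n ⟨0, by omega⟩ = 1
      · left
        refine ⟨h0, ?_⟩
        by_contra hk3
        subst hp
        obtain ⟨u, hu⟩ := isPendant_of_kMixed (by omega) he hn h0
        exact hpend u hu
      · right
        have := hn ⟨0, by omega⟩
        omega
    · right
      have hkp : k = p + t := by omega
      have := arith_constant (r := r) (p := p) (s := t) hr (by omega) (by
        push_cast at hineq
        linarith)
      rw [← hkp] at this
      rcases this with h1 | ⟨h1, h2⟩
      · exact Or.inl ⟨by omega, h1⟩
      · exact Or.inr ⟨by omega, h1, h2⟩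
  · rw [ofSimpleGraph_kGraph]; exact he

theorem isOppositeGainType_of_block (hS : IsSplit G.herm v S S')
    (h : IsMultipartiteBlock G.herm v S c s fun _ => 1)
    (h' : IsMultipartiteBlock G.herm v S' c' s' y) (hB : SchurBound r y)
    (hc : valueCount y 1 = 0) (hd : valueCount y (-1) = 0)
    (hb : 1 ≤ valueCount y (-Complex.I))
    (hab : valueCount y (-Complex.I) ≤ valueCount y Complex.I) : IsOppositeGainType G v := by
  obtain ⟨q, n, hq, hn, e, hev, he⟩ := exists_kMixed_of_valueCount hS h h' hd
  have htot := valueCount_total h'.gain_mem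
  have hr := h.two_le
  have hk := h'.two_le
  have hineq := hB.valueCount hr hk h'.gain_mem rfl rfl hc hd rfl
  rw [hc] at he
  refine ⟨r, k, _, _, valueCount y 0, q, n, hr, hk, hab, hb, by omega, hq, hn, ?_, e, hev, he⟩
  refine arith_opposite (s := valueCount y 0) hr hab hb ?_
  push_cast at hineq
  linarith

theorem isAdjacentGainType_of_block (hS : IsSplit G.herm v S S')
    (h : IsMultipartiteBlock G.herm v S c s fun _ => 1)
    (h' : IsMultipartiteBlock G.herm v S' c' s' y) (hB : SchurBound r y)
    (hb : valueCount y (-Complex.I) = 0) (hd : valueCount y (-1) = 0)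
    (hc : 1 ≤ valueCount y 1)
    (hac : valueCount y 1 ≤ valueCount y Complex.I) : IsAdjacentGainType G v := by
  obtain ⟨q, n, hq, hn, e, hev, he⟩ := exists_kMixed_of_valueCount hS h h' hd
  have htot := valueCount_total h'.gain_mem
  have hr := h.two_le
  have hk := h'.two_le
  have hineq := hB.valueCount hr hk h'.gain_mem rfl hb rfl hd rfl
  rw [hb] at he
  refine ⟨r, k, _, _, valueCount y 0, q, n, hr, hk, hac, hc, by omega, hq, hn, ?_, e, hev, he⟩
  refine arith_adjacent hr hac hc ?_
  push_cast at hineq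
  linarith

omit [Fintype V] in
theorem IsAdjacentGainType.of_converse (h : IsAdjacentGainType G.converse v) :
    IsAdjacentGainType G v := by
  obtain ⟨r, k, a, c, s, q, n, h1, h2, h3, h4, h5, h6, h7, h8, e, hev, he⟩ := h
  exact ⟨r, k, a, c, s, q, n, h1, h2, h3, h4, h5, h6, h7, h8, e, hev, he.of_converse⟩

theorem type_of_block_of_max (hpend : ∀ u, ¬ IsPendant G.graph u)
    (hS : IsSplit G.herm v S S') (h : IsMultipartiteBlock G.herm v S c s fun _ => 1)
    (h' : IsMultipartiteBlock G.herm v S' c' s' y) (hB : SchurBound r y)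
    (ha : 1 ≤ valueCount y Complex.I)
    (hab : valueCount y (-Complex.I) ≤ valueCount y Complex.I)
    (hac : valueCount y 1 ≤ valueCount y Complex.I)
    (had : valueCount y (-1) ≤ valueCount y Complex.I) :
    IsConstantGainType G v ∨ IsOppositeGainType G v ∨ IsAdjacentGainType G v := by
  have hr := h.two_le
  have hk := h'.two_le
  have hineq := hB.valueCount hr hk h'.gain_mem rfl rfl rfl rfl rfl
  have htot := valueCount_total h'.gain_mem
  have hu : IsFourthRoot (-Complex.I) := IsFourthRoot.I.neg
  have hone : IsFourthRoot (-1 : ℂ) := IsFourthRoot.one.neg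
  -- This r = 2 inequality already excludes three different nonzero gains. What remains is i alone
  -- or i together with one of −i, 1, −1.
  have hle := le_two_mul_of_sub_one_mul_le (by exact_mod_cast hr) (by omega) hineq
  by_cases hd0 : valueCount y (-1) = 0
  · by_cases hc0 : valueCount y 1 = 0
    · by_cases hb0 : valueCount y (-Complex.I) = 0
      · left
        -- Rotation by −i turns the constant gain i into 1.
        refine isConstantGainType_of_block hpend hS h (h'.smul hu) (hB.smul hu) ?_ ?_ ?_ ?_ <;>
          rw [valueCount_smul hu] <;> simpa
      · exact Or.inr (Or.inl (isOppositeGainType_of_block hS h h' hB hc0 hd0 (by omega) hab))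
    · by_cases hb0 : valueCount y (-Complex.I) = 0
      · exact Or.inr (Or.inr (isAdjacentGainType_of_block hS h h' hB hb0 hd0 (by omega) hac))
      · exfalso
        rw [hd0] at hle
        generalize valueCount y Complex.I = a at *
        generalize valueCount y (-Complex.I) = b at *
        generalize valueCount y 1 = c at *
        generalize valueCount y 0 = t at *
        obtain ⟨a, rfl⟩ : ∃ a', a = a' + 1 := ⟨a - 1, by omega⟩
        obtain ⟨b, rfl⟩ : ∃ b', b = b' + 1 := ⟨b - 1, by omega⟩
        obtain ⟨c, rfl⟩ : ∃ c', c = c' + 1 := ⟨c - 1, by omega⟩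
        push_cast at hle
        nlinarith [(by positivity : (0 : ℤ) ≤ a * b), (by positivity : (0 : ℤ) ≤ a * c),
          (by positivity : (0 : ℤ) ≤ b * c), (by positivity : (0 : ℤ) ≤ a * t),
          (by positivity : (0 : ℤ) ≤ b * t), (by positivity : (0 : ℤ) ≤ c * t)]
  · by_cases hc0 : valueCount y 1 = 0
    · by_cases hb0 : valueCount y (-Complex.I) = 0
      · right; right
        -- Gains i and −1: conjugation followed by the factor −1 fixes i and sends −1 to 1, while
        -- the gains 1 towards the other block survive conjugation.
        apply IsAdjacentGainType.of_converse
        have hst := G.converse_herm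
        have h1 : IsMultipartiteBlock G.converse.herm v S c (fun u => star (s u)) fun _ => 1 := by
          have := h.star hst
          simpa using this
        refine isAdjacentGainType_of_block (hS.star hst) h1 ((h'.star hst).smul hone)
          (hB.star.smul hone) ?_ ?_ ?_ ?_ <;> simp only [valueCount_smul hone, valueCount_star] <;>
          simp <;> omega
      · exfalso
        rw [hc0] at hle
        generalize valueCount y Complex.I = a at *
        generalize valueCount y (-Complex.I) = b at *
        generalize valueCount y (-1) = c at *
        generalize valueCount y 0 = t at *
        obtain ⟨a, rfl⟩ : ∃ a', a = a' + 1 := ⟨a - 1, by omega⟩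
        obtain ⟨b, rfl⟩ : ∃ b', b = b' + 1 := ⟨b - 1, by omega⟩
        obtain ⟨c, rfl⟩ : ∃ c', c = c' + 1 := ⟨c - 1, by omega⟩
        push_cast at hle
        nlinarith [(by positivity : (0 : ℤ) ≤ a * b), (by positivity : (0 : ℤ) ≤ a * c),
          (by positivity : (0 : ℤ) ≤ b * c), (by positivity : (0 : ℤ) ≤ a * t),
          (by positivity : (0 : ℤ) ≤ b * t), (by positivity : (0 : ℤ) ≤ c * t)]
    · exfalso
      generalize valueCount y Complex.I = a at *
      generalize valueCount y (-Complex.I) = b at *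
      generalize valueCount y (-1) = d at *
      generalize valueCount y 1 = c at *
      generalize valueCount y 0 = t at *
      obtain ⟨a, rfl⟩ : ∃ a', a = a' + 1 := ⟨a - 1, by omega⟩
      obtain ⟨d, rfl⟩ : ∃ b', d = b' + 1 := ⟨d - 1, by omega⟩
      obtain ⟨c, rfl⟩ : ∃ c', c = c' + 1 := ⟨c - 1, by omega⟩
      push_cast at hle
      nlinarith [(by positivity : (0 : ℤ) ≤ a * b), (by positivity : (0 : ℤ) ≤ a * c),
        (by positivity : (0 : ℤ) ≤ b * c), (by positivity : (0 : ℤ) ≤ a * t),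
        (by positivity : (0 : ℤ) ≤ b * t), (by positivity : (0 : ℤ) ≤ c * t),
        (by positivity : (0 : ℤ) ≤ a * d), (by positivity : (0 : ℤ) ≤ b * d),
        (by positivity : (0 : ℤ) ≤ c * d), (by positivity : (0 : ℤ) ≤ d * t)]

/-- Rotate so that the most frequent nonzero gain becomes i; a nonzero gain exists because v has a
neighbour in S'. -/
theorem type_of_block (hpend : ∀ u, ¬ IsPendant G.graph u)
    (hS : IsSplit G.herm v S S') (h : IsMultipartiteBlock G.herm v S c s fun _ => 1)
    (h' : IsMultipartiteBlock G.herm v S' c' s' y) (hB : SchurBound r y) :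
    IsConstantGainType G v ∨ IsOppositeGainType G v ∨ IsAdjacentGainType G v := by
  have htot := valueCount_total h'.gain_mem
  have hne : valueCount y 0 ≠ k := by
    intro h0
    obtain ⟨u, hu, hvu⟩ := hS.adj_right
    refine hvu ?_
    rw [h'.gain ⟨u, hu⟩, eq_of_valueCount h0, zero_mul]
  have main : ∀ ω, IsFourthRoot ω →
      valueCount y (star ω * -Complex.I) ≤ valueCount y (star ω * Complex.I) →
      valueCount y (star ω * 1) ≤ valueCount y (star ω * Complex.I) →
      valueCount y (star ω * -1) ≤ valueCount y (star ω * Complex.I) →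
      1 ≤ valueCount y (star ω * Complex.I) →
      IsConstantGainType G v ∨ IsOppositeGainType G v ∨ IsAdjacentGainType G v := by
    intro ω hω h1 h2 h3 h4
    refine type_of_block_of_max hpend hS h (h'.smul hω) (hB.smul hω) ?_ ?_ ?_ ?_ <;>
      simp only [valueCount_smul hω] <;> assumption
  by_cases m1 : valueCount y (-Complex.I) ≤ valueCount y Complex.I ∧
      valueCount y 1 ≤ valueCount y Complex.I ∧ valueCount y (-1) ≤ valueCount y Complex.I
  · apply main 1 IsFourthRoot.one <;> simp only [star_one, one_mul] <;> omega
  by_cases m2 : valueCount y Complex.I ≤ valueCount y (-Complex.I) ∧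
      valueCount y 1 ≤ valueCount y (-Complex.I) ∧ valueCount y (-1) ≤ valueCount y (-Complex.I)
  · apply main (-1) IsFourthRoot.one.neg <;>
      simp only [star_one, star_neg, mul_neg, neg_mul, one_mul, mul_one, neg_neg] <;> omega
  by_cases m3 : valueCount y Complex.I ≤ valueCount y 1 ∧
      valueCount y (-Complex.I) ≤ valueCount y 1 ∧ valueCount y (-1) ≤ valueCount y 1
  · apply main Complex.I IsFourthRoot.I <;>
      simp only [Complex.star_def, Complex.conj_I, mul_neg, neg_mul, mul_one, neg_neg,
        Complex.I_mul_I] <;> omega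
  · apply main (-Complex.I) IsFourthRoot.I.neg <;>
      simp only [Complex.star_def, Complex.conj_I, map_neg, mul_neg, mul_one, neg_neg,
        Complex.I_mul_I] <;> omega

variable [DecidableEq V]

-- A negative contribution means r equal gains, which can be switched to 1. The contribution is then
-- −r/(r − 1), so the inequality for the sum is exactly `SchurBound` for the other block.
omit [DecidableEq V] in
theorem type_of_schur_neg (hpend : ∀ u, ¬ IsPendant G.graph u) (hS : IsSplit G.herm v S S')
    {x : Fin r → ℂ} (h : IsMultipartiteBlock G.herm v S c s x)
    (h' : IsMultipartiteBlock G.herm v S' c' s' y)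
    (hx : ∑ j, Complex.normSq (x j) - Complex.normSq (∑ j, x j) / (r - 1) < 0)
    (hxy : ∑ j, Complex.normSq (x j) - Complex.normSq (∑ j, x j) / (r - 1)
      + (∑ j, Complex.normSq (y j) - Complex.normSq (∑ j, y j) / (k - 1)) ≤ 0) :
    IsConstantGainType G v ∨ IsOppositeGainType G v ∨ IsAdjacentGainType G v := by
  obtain ⟨z, hz, hxz⟩ := eq_const_of_schur_neg h.gain_mem h.two_le hx
  have h1 : IsMultipartiteBlock G.herm v S c (fun u => star z * s u) fun _ => 1 := by
    have := h.smul hz.star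
    simpa only [hxz, hz.star_mul] using this
  refine type_of_block hpend hS h1 h' ?_
  have hr' : (0 : ℝ) < (r : ℝ) - 1 := by
    have : (2 : ℝ) ≤ r := by exact_mod_cast h.two_le
    linarith
  have h2 : ∑ j, Complex.normSq (x j) - Complex.normSq (∑ j, x j) / (r - 1)
      = - ((r : ℝ) / (r - 1)) := by
    simp only [hxz, hz.normSq_eq, Finset.sum_const, Finset.card_univ, Fintype.card_fin,
      nsmul_eq_mul, Complex.normSq_mul, Complex.normSq_natCast]
    field_simp
    ring
  rw [h2] at hxy
  rw [SchurBound]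
  linarith

theorem isGlueType (hpend : ∀ u, ¬ IsPendant G.graph u) (hS : IsSplit G.herm v S S')
    (h3 : ¬ PosGe G.herm 3) {z : V → ℂ} (hz : IsReduction G.herm v S z)
    (hz0 : G.herm.mulVec z v = 0) : IsGlueType G v := by
  classical
  have hH := G.isGainMatrix_herm
  have h1 := hS.not_posGe_two_left hH h3 hz hz0
  have h2 := hS.not_posGe_two_right hH h3 hz hz0
  rw [← comap_herm] at h1 h2
  obtain ⟨x, m, e, a1, a2, a3, a4, a5⟩ := exists_multipartite_piece hpend hS h1
  obtain ⟨y, m', e', b1, b2, b3, b4, b5⟩ := exists_multipartite_piece hpend (hS.symm hH) h2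
  obtain ⟨f, hf1, hf2⟩ := exists_glue hS e e'
  exact ⟨x, y, m, m', _, _, _, _, a1, b1, a2, b2, a3, b3, a4, b4, a5, b5, f, hf1, hf2⟩

end MixedGraph

/-! ### Classification from the failure of three positive directions, and switching invariance. -/

namespace MixedGraph

variable {V : Type*} [Fintype V] [DecidableEq V] {G : MixedGraph V} {v : V}

theorem type_of_not_posGe_three (hconn : G.graph.Connected) (hcut : IsCutVertex G.graph v)
    (hpend : ∀ u, ¬ IsPendant G.graph u) (h3 : ¬ PosGe G.herm 3) :
    IsGlueType G v ∨ IsConstantGainType G v ∨ IsOppositeGainType G v ∨ IsAdjacentGainType G v := by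
  have hH := G.isGainMatrix_herm
  obtain ⟨S, S', hS⟩ := exists_isSplit hconn hcut hpend h3
  have hyp := hS.isHyperbolicOn hH h3
  have hyp' := (hS.symm hH).isHyperbolicOn hH h3
  rcases hH.isBalancedOn_or_isTriangularOn hyp hS.connected_left with hb | ⟨u, s, τ, ht⟩
  swap
  · obtain ⟨z, hz, hz0⟩ := ht.exists_reduction (v := v) hH
    exact Or.inl (isGlueType hpend hS h3 hz hz0)
  rcases hH.isBalancedOn_or_isTriangularOn hyp' hS.connected_right with hb' | ⟨u, s, τ, ht⟩
  swap
  · obtain ⟨z, hz, hz0⟩ := ht.exists_reduction (v := v) hH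
    exact Or.inl (isGlueType hpend (hS.symm hH) h3 hz hz0)
  obtain ⟨r, c, s, x, hx⟩ := hH.exists_isMultipartiteBlock (v := v)
    (hH.hasTwins hyp hS.connected_left) hb hS.edge_left
  obtain ⟨k, c', s', y, hy⟩ := hH.exists_isMultipartiteBlock (v := v)
    (hH.hasTwins hyp' hS.connected_right) hb' hS.edge_right
  obtain ⟨z, hz, hzi, hzr⟩ := hx.exists_reduction hH
  obtain ⟨z', hz', hzi', hzr'⟩ := hy.exists_reduction hH
  have hsum := hS.reduction_nonpos hH h3 hz hz'
  rw [Complex.add_re, hzr, hzr'] at hsum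
  -- A zero contribution gives a glued graph whatever the other block is. If this contribution is
  -- positive, the other is negative and the blocks exchange roles.
  rcases lt_trichotomy (∑ j, Complex.normSq (x j) - Complex.normSq (∑ j, x j) / (r - 1)) 0
    with hlt | heq | hgt
  · exact Or.inr (type_of_schur_neg hpend hS hx hy hlt hsum)
  · refine Or.inl (isGlueType hpend hS h3 hz (Complex.ext ?_ ?_))
    · rw [hzr, heq, Complex.zero_re]
    · rw [hzi, Complex.zero_im]
  · refine Or.inr (type_of_schur_neg hpend (hS.symm hH) hy hx (by linarith) (by linarith))

-- Switching rescales coordinates by units. For the converse the vectors are conjugated too, and the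
-- form turns into its complex conjugate.
omit [DecidableEq V] in
theorem SwitchingEquivVia.posGe {W : Type*} [Fintype W] {G' : MixedGraph W} {e : V ≃ W}
    (h : SwitchingEquivVia e G G') {d : ℕ} (hd : PosGe G.herm d) : PosGe G'.herm d := by
  obtain ⟨Q, hQ, h⟩ := h
  have hQ' : ∀ u, IsFourthRoot (Q u) := hQ
  have hsum : ∀ f g : W → ℂ, hform G'.herm f g
      = ∑ u, ∑ w, star (f (e u)) * G'.herm (e u) (e w) * g (e w) := by
    intro f g
    rw [hform_eq_sum, ← e.sum_comp]
    exact Finset.sum_congr rfl fun u _ => (e.sum_comp _).symm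
  rcases h with h | h
  · refine hd.map (fun f x => star (Q (e.symm x)) * f (e.symm x)) fun f g => ?_
    rw [hsum, hform_eq_sum]
    refine Finset.sum_congr rfl fun u _ => Finset.sum_congr rfl fun w _ => ?_
    rw [h, (hQ' u).inv_eq, e.symm_apply_apply, e.symm_apply_apply, star_mul', star_star]
    linear_combination (star (f u) * G.herm u w * g w) * (hQ' u).mul_star
      + (star (f u) * G.herm u w * g w * Q u * star (Q u)) * (hQ' w).mul_star
  · refine hd.map_star (fun f x => star (Q (e.symm x)) * star (f (e.symm x))) fun f g => ?_
    rw [hsum, hform_eq_sum, star_sum]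
    refine Finset.sum_congr rfl fun u _ => ?_
    rw [star_sum]
    refine Finset.sum_congr rfl fun w _ => ?_
    rw [h, (hQ' u).inv_eq, e.symm_apply_apply, e.symm_apply_apply, converse_herm]
    simp only [star_mul', star_star]
    linear_combination (f u * star (G.herm u w) * star (g w)) * (hQ' u).mul_star
      + (f u * star (G.herm u w) * star (g w) * Q u * star (Q u)) * (hQ' w).mul_star

theorem posLe_of_not_posGe {d : ℕ} (h : ¬ PosGe G.herm (d + 1)) : PosLe G.herm d := by
  rw [posGe_iff] at h
  exact PosLe.of_eigenvalues G.isHermitian_herm (by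
    have : G.posInertia ≤ d := by omega
    exact this)

end MixedGraph

/-! ### Upper bounds for the inertia of the standard graphs. -/

section Multipartite

variable {k : ℕ} {n : Fin k → ℕ}

/-- The form of J − I on classes depends on the class sums only: squared modulus of the total minus
the squared moduli of the class sums. -/
theorem sum_multipartite (g : (Σ j : Fin k, Fin (n j)) → ℂ) :
    ∑ u, ∑ w, star (g u) * (if u.1 = w.1 then 0 else 1) * g w
      = star (∑ j, ∑ i, g ⟨j, i⟩) * (∑ j, ∑ i, g ⟨j, i⟩)
        - ∑ j, star (∑ i, g ⟨j, i⟩) * ∑ i, g ⟨j, i⟩ := by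
  have h1 : ∑ u, ∑ w, star (g u) * (if u.1 = w.1 then 0 else 1) * g w
      = ∑ j, ∑ l, star (∑ i, g ⟨j, i⟩) * (if j = l then 0 else 1) * ∑ i, g ⟨l, i⟩ := by
    rw [Fintype.sum_sigma]
    refine Finset.sum_congr rfl fun j _ => ?_
    simp only [Fintype.sum_sigma]
    rw [Finset.sum_comm]
    refine Finset.sum_congr rfl fun l _ => ?_
    rw [star_sum, Finset.sum_mul, Finset.sum_mul]
    refine Finset.sum_congr rfl fun i _ => ?_
    rw [Finset.mul_sum]
  rw [h1, star_sum, Finset.sum_mul, ← Finset.sum_sub_distrib]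
  refine Finset.sum_congr rfl fun j _ => ?_
  rw [Finset.mul_sum, eq_sub_iff_add_eq]
  have h2 : ∀ l, star (∑ i, g ⟨j, i⟩) * (if j = l then 0 else 1) * ∑ i, g ⟨l, i⟩
      = star (∑ i, g ⟨j, i⟩) * ∑ i, g ⟨l, i⟩
        - if j = l then star (∑ i, g ⟨j, i⟩) * ∑ i, g ⟨l, i⟩ else 0 := by
    intro l
    split_ifs <;> ring
  simp only [h2, Finset.sum_sub_distrib, Finset.sum_ite_eq, Finset.mem_univ, if_true]
  ring

theorem sum_star_mul_self_re_nonneg {ι : Type*} [Fintype ι] (F : ι → ℂ) :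
    0 ≤ (∑ j, star (F j) * F j).re := by
  rw [Complex.re_sum]
  refine Finset.sum_nonneg fun j _ => ?_
  rw [Complex.star_def, ← Complex.normSq_eq_conj_mul_self, Complex.ofReal_re]
  exact Complex.normSq_nonneg _

/-- Completing the square in the form of a vertex joined to a complete multipartite graph. -/
theorem multipartite_join_le (hk : 2 ≤ k) (x F : Fin k → ℂ) (t : ℂ)
    (hL : ∑ j, F j + t * (star (∑ j, x j) / (k - 1)) = 0) :
    (star t * ∑ j, x j * F j + (∑ j, star (x j) * star (F j)) * t + star (∑ j, F j) * (∑ j, F j)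
      - ∑ j, star (F j) * F j).re
      ≤ (∑ j, Complex.normSq (x j) - Complex.normSq (∑ j, x j) / (k - 1)) * Complex.normSq t := by
  have hk' : ((k : ℂ) - 1) ≠ 0 := by
    rw [sub_ne_zero]
    exact_mod_cast (by omega : k ≠ 1)
  obtain ⟨m, hm⟩ : ∃ m : ℂ, m = (k - 1 : ℂ)⁻¹ := ⟨_, rfl⟩
  have hmk : (k : ℂ) * m = 1 + m := by rw [hm]; field_simp; ring
  have hms : star m = m := by rw [hm]; simp
  obtain ⟨σ, hσ⟩ : ∃ σ, σ = ∑ j, x j := ⟨_, rfl⟩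
  have hF : ∑ j, F j = -(t * star σ * m) := by
    rw [hσ, hm, eq_neg_iff_add_eq_zero, ← hL]; ring
  -- The deviation of the class sums from t times the reduction weights conj x_j − conj σ/(k − 1).
  -- Under `hL` the expression equals the contribution times |t|² minus Σ|D_j|².
  let D : Fin k → ℂ := fun j => F j - t * (star (x j) - star σ * m)
  have hD : ∑ j, star (D j) * D j = ∑ j, star (F j) * F j
      - (∑ j, star (x j) * star (F j)) * t - star t * ∑ j, x j * F j
      + star (∑ j, F j) * t * star σ * m + star t * σ * m * (∑ j, F j)
      + star t * t * ((∑ j, star (x j) * x j) - star (∑ j, x j) * σ * m - star σ * m * (∑ j, x j)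
        + k * (star σ * σ * m * m)) := by
    simp only [star_sum, Finset.sum_mul, Finset.mul_sum, ← Finset.sum_add_distrib,
      ← Finset.sum_sub_distrib, mul_add, mul_sub]
    have hcst : star t * t * (k * (star σ * σ * m * m))
        = ∑ j : Fin k, star t * t * (star σ * σ * m * m) := by
      rw [Finset.sum_const, Finset.card_univ, Fintype.card_fin, nsmul_eq_mul]; ring
    rw [hcst]
    simp only [← Finset.sum_add_distrib]
    refine Finset.sum_congr rfl fun j _ => ?_
    simp only [D, star_sub, star_mul', star_star, hms]
    ring
  have key : star t * ∑ j, x j * F j + (∑ j, star (x j) * star (F j)) * t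
      + star (∑ j, F j) * (∑ j, F j) - ∑ j, star (F j) * F j
      = (((∑ j, Complex.normSq (x j) - Complex.normSq (∑ j, x j) / (k - 1)) * Complex.normSq t : ℝ)
        : ℂ) - ∑ j, star (D j) * D j := by
    rw [hD, hF, ← hσ]
    push_cast
    have hms' : (starRingEnd ℂ) m = m := hms
    simp only [Complex.normSq_eq_conj_mul_self, Complex.star_def, map_neg, map_mul,
      Complex.conj_conj, hms']
    rw [div_eq_mul_inv, ← hm]
    linear_combination ((starRingEnd ℂ) t * t * (starRingEnd ℂ) σ * σ * m) * hmk
  rw [key, Complex.sub_re, Complex.ofReal_re]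
  linarith [sum_star_mul_self_re_nonneg D]

end Multipartite

section KMixedInertia

variable {r k : ℕ} {q : Fin r → ℕ} {n : Fin k → ℕ} {a b c : ℕ}

/-- One functional per block allows both squares to be completed. What is left is |f(v)|² times
−r/(r − 1) plus the contribution of the second block, which the bound makes nonpositive. -/
theorem kMixed_posLe_two (hr : 2 ≤ r) (hk : 2 ≤ k)
    (h : SchurBound r fun j : Fin k => classGain a b c j) : PosLe (kMixed q n a b c).herm 2 := by
  let x : Fin r → ℂ := fun _ => 1
  let y : Fin k → ℂ := fun j => classGain a b c j
  let L : (KVertex q n → ℂ) →ₗ[ℂ] (Fin 2 → ℂ) :=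
    { toFun := fun f => ![∑ j, ∑ i, f (some (.inl ⟨j, i⟩)) + f none * (star (∑ j, x j) / (r - 1)),
        ∑ j, ∑ i, f (some (.inr ⟨j, i⟩)) + f none * (star (∑ j, y j) / (k - 1))]
      map_add' := fun f g => by
        ext i
        fin_cases i <;> simp [Finset.sum_add_distrib] <;> ring
      map_smul' := fun t f => by
        ext i
        fin_cases i <;> simp [Finset.mul_sum, mul_add] <;> ring }
  refine ⟨L, fun f hf => ?_⟩
  have h1 := multipartite_join_le hr x (fun j => ∑ i, f (some (.inl ⟨j, i⟩))) (f none)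
    (congrFun hf 0)
  have h2 := multipartite_join_le hk y (fun j => ∑ i, f (some (.inr ⟨j, i⟩))) (f none)
    (congrFun hf 1)
  have hx : ∑ j, Complex.normSq (x j) - Complex.normSq (∑ j, x j) / (r - 1)
      = - ((r : ℝ) / (r - 1)) := by
    have hr' : (r : ℝ) - 1 ≠ 0 := by
      rw [sub_ne_zero]; exact_mod_cast (by omega : r ≠ 1)
    simp only [x, Finset.sum_const, Finset.card_univ, Fintype.card_fin, nsmul_eq_mul,
      Complex.normSq_mul, Complex.normSq_natCast, map_one]
    field_simp
    ring
  have hform_eq : hform (kMixed q n a b c).herm f f =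
      (star (f none) * ∑ j, x j * (∑ i, f (some (.inl ⟨j, i⟩)))
        + (∑ j, star (x j) * star (∑ i, f (some (.inl ⟨j, i⟩)))) * f none
        + star (∑ j, ∑ i, f (some (.inl ⟨j, i⟩))) * (∑ j, ∑ i, f (some (.inl ⟨j, i⟩)))
        - ∑ j, star (∑ i, f (some (.inl ⟨j, i⟩))) * ∑ i, f (some (.inl ⟨j, i⟩)))
      + (star (f none) * ∑ j, y j * (∑ i, f (some (.inr ⟨j, i⟩)))
        + (∑ j, star (y j) * star (∑ i, f (some (.inr ⟨j, i⟩)))) * f none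
        + star (∑ j, ∑ i, f (some (.inr ⟨j, i⟩))) * (∑ j, ∑ i, f (some (.inr ⟨j, i⟩)))
        - ∑ j, star (∑ i, f (some (.inr ⟨j, i⟩))) * ∑ i, f (some (.inr ⟨j, i⟩))) := by
    have e1 := sum_multipartite fun u => f (some (.inl u))
    have e2 := sum_multipartite fun u => f (some (.inr u))
    rw [hform_eq_sum]
    simp only [Fintype.sum_option, Fintype.sum_sum_type, kMixed_herm_none_none,
      kMixed_herm_none_inl, kMixed_herm_inl_none, kMixed_herm_none_inr, kMixed_herm_inr_none,
      kMixed_herm_inl_inl, kMixed_herm_inr_inr, kMixed_herm_inl_inr, kMixed_herm_inr_inl,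
      Finset.sum_add_distrib, mul_zero, zero_mul, Finset.sum_const_zero, add_zero, zero_add]
    rw [e1, e2]
    simp only [x, y, Fintype.sum_sigma, star_sum, Finset.mul_sum, Finset.sum_mul, mul_one, one_mul,
      star_one]
    have e3 : ∑ j : Fin k, ∑ i, star (f none) * classGain a b c j * f (some (.inr ⟨j, i⟩))
        = ∑ j : Fin k, ∑ i, star (f none) * (classGain a b c j * f (some (.inr ⟨j, i⟩))) := by
      simp only [mul_assoc]
    have e4 : ∑ j : Fin k, ∑ i, star (f (some (.inr ⟨j, i⟩))) * star (classGain a b c j) * f none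
        = ∑ j : Fin k, ∑ i, star (classGain a b c j) * star (f (some (.inr ⟨j, i⟩))) * f none :=
      Finset.sum_congr rfl fun j _ => Finset.sum_congr rfl fun i _ => by ring
    rw [e3, e4]
    ring
  rw [hform_eq, Complex.add_re]
  rw [hx] at h1
  have h3 : (∑ j, Complex.normSq (y j) - Complex.normSq (∑ j, y j) / (k - 1)) * Complex.normSq (f none)
      ≤ (r : ℝ) / (r - 1) * Complex.normSq (f none) :=
    mul_le_mul_of_nonneg_right h (Complex.normSq_nonneg _)
  linarith

theorem schurBound_classGain (hr : 2 ≤ r) (hk : 2 ≤ k) {s : ℕ} (hs : a + b + c + s = k)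
    (h : ((r : ℝ) - 1) * (4 * a * b + 2 * (a + b) * c + (a + b + c) * (s - 1))
      ≤ r * (a + b + c + s - 1)) : SchurBound r fun j : Fin k => classGain a b c j := by
  have hk' : (0 : ℝ) < (k : ℝ) - 1 := by
    have : (2 : ℝ) ≤ k := by exact_mod_cast hk
    linarith
  have hr' : (0 : ℝ) < (r : ℝ) - 1 := by
    have : (2 : ℝ) ≤ r := by exact_mod_cast hr
    linarith
  have hmem : ∀ j : Fin k, classGain a b c j = 0 ∨ IsFourthRoot (classGain a b c j) :=
    fun j => classGain_mem a b c j
  obtain ⟨h1, h2, h3, h4⟩ := valueCount_classGain (k := k) (a := a) (b := b) (c := c) (by omega)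
  have htot := valueCount_total hmem
  have h5 : valueCount (fun j : Fin k => classGain a b c j) 0 = s := by omega
  have h6 := schur_eq_valueCount hmem hk
  rw [h1, h2, h3, h4, h5] at h6
  have hkr : (k : ℝ) = a + b + c + s := by exact_mod_cast hs.symm
  rw [SchurBound]
  refine le_of_mul_le_mul_right ?_ hk'
  rw [h6, div_mul_eq_mul_div, le_div_iff₀ hr', hkr]
  push_cast
  linarith

end KMixedInertia

namespace MixedGraph

/-! ### Positive inertia at most one for the glued pieces. -/

section PieceInertia

/-- The functional is the switched total sum; on its kernel the form is minus a sum of squared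
moduli. -/
theorem posLe_one_of_isBalancedOn {k : ℕ} {n : Fin k → ℕ} {M : MixedGraph (Σ j : Fin k, Fin (n j))}
    (hM : M.graph = SimpleGraph.completeMultipartiteGraph (fun j => Fin (n j)))
    (h : IsBalancedOn M.herm Set.univ) : PosLe M.herm 1 := by
  obtain ⟨s, hs, h⟩ := h
  let L : ((Σ j : Fin k, Fin (n j)) → ℂ) →ₗ[ℂ] (Fin 1 → ℂ) :=
    { toFun := fun f _ => ∑ j, ∑ i, star (s ⟨j, i⟩) * f ⟨j, i⟩
      map_add' := fun f g => by
        ext i; simp [Finset.sum_add_distrib, mul_add]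
      map_smul' := fun t f => by
        ext i; simp [Finset.mul_sum, mul_left_comm] }
  refine ⟨L, fun f hf => ?_⟩
  have hf0 : ∑ j, ∑ i, star (s ⟨j, i⟩) * f ⟨j, i⟩ = 0 := congrFun hf 0
  have hentry : ∀ u w, M.herm u w = s u * (if u.1 = w.1 then 0 else 1) * star (s w) := by
    intro u w
    have hadj : M.herm u w ≠ 0 ↔ u.1 ≠ w.1 := by rw [herm_ne_zero_iff, hM]; simp
    split_ifs with huw
    · rw [not_ne_iff.1 fun h' => (hadj.1 h') huw]; ring
    · rw [(h u trivial w trivial).resolve_left (hadj.2 huw)]; ring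
  have key := sum_multipartite fun u => star (s u) * f u
  rw [hf0, mul_zero, zero_sub] at key
  have : hform M.herm f f = -∑ j, star (∑ i, star (s ⟨j, i⟩) * f ⟨j, i⟩)
      * ∑ i, star (s ⟨j, i⟩) * f ⟨j, i⟩ := by
    rw [← key, hform_eq_sum]
    refine Finset.sum_congr rfl fun u _ => Finset.sum_congr rfl fun w _ => ?_
    rw [hentry, star_mul', star_star]
    ring
  rw [this, Complex.neg_re]
  linarith [sum_star_mul_self_re_nonneg fun j => ∑ i, star (s ⟨j, i⟩) * f ⟨j, i⟩]

variable {V : Type*} {M : MixedGraph V}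

theorem IsPositive.triangle (h : M.IsPositive) {a b c : V} (hab : M.herm a b ≠ 0)
    (hbc : M.herm b c ≠ 0) (hca : M.herm c a ≠ 0) :
    M.herm a b * M.herm b c * M.herm c a = 1 := by
  have h1 := M.herm_ne_zero_iff.1 hab
  have h2 := M.herm_ne_zero_iff.1 hbc
  have h3 := M.herm_ne_zero_iff.1 hca
  have := h a (.cons h1 (.cons h2 (.cons h3 .nil))) (by
    have e1 := h1.ne
    have e2 := h2.ne
    have e3 := h3.ne
    rw [SimpleGraph.Walk.cons_isCycle_iff]
    simp [SimpleGraph.Walk.cons_isPath_iff, e1, e2, e3, e1.symm, e3.symm])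
  simpa [mul_assoc] using this

theorem IsPositive.square (h : M.IsPositive) {a b c d : V} (hab : M.herm a b ≠ 0)
    (hbc : M.herm b c ≠ 0) (hcd : M.herm c d ≠ 0) (hda : M.herm d a ≠ 0) (hac : a ≠ c)
    (hbd : b ≠ d) : M.herm a b * M.herm b c * M.herm c d * M.herm d a = 1 := by
  have h1 := M.herm_ne_zero_iff.1 hab
  have h2 := M.herm_ne_zero_iff.1 hbc
  have h3 := M.herm_ne_zero_iff.1 hcd
  have h4 := M.herm_ne_zero_iff.1 hda
  have := h a (.cons h1 (.cons h2 (.cons h3 (.cons h4 .nil)))) (by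
    have e1 := h1.ne
    have e2 := h2.ne
    have e3 := h3.ne
    have e4 := h4.ne
    rw [SimpleGraph.Walk.cons_isCycle_iff]
    simp [SimpleGraph.Walk.cons_isPath_iff, e1, e2, e3, e4, e1.symm, e4.symm,
      hac, hbd, hac.symm])
  simpa [mul_assoc] using this

/-- Four-cycles of value 1 make vertices of the same class twins, and triangles of value 1 then give
balance; longer cycles are not needed. -/
theorem IsPositive.isBalancedOn {k : ℕ} {n : Fin k → ℕ} {M : MixedGraph (Σ j : Fin k, Fin (n j))}
    (hM : M.graph = SimpleGraph.completeMultipartiteGraph (fun j => Fin (n j)))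
    (h : M.IsPositive) : IsBalancedOn M.herm Set.univ := by
  have hH := M.isGainMatrix_herm
  have hadj : ∀ u w, M.herm u w ≠ 0 ↔ u.1 ≠ w.1 := fun u w => by
    rw [herm_ne_zero_iff, hM]; simp
  have hzero : ∀ u w, M.herm u w = 0 ↔ u.1 = w.1 := fun u w => by
    rw [← not_iff_not]; exact hadj u w
  refine hH.isBalancedOn (fun u _ w _ huw => ?_) fun u _ w _ t _ => h.triangle
  by_cases hne : u = w
  · subst hne; exact ⟨1, IsFourthRoot.one, fun x => by simp⟩
  rw [hzero] at huw
  by_cases ht : ∃ t : Σ j : Fin k, Fin (n j), u.1 ≠ t.1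
  · obtain ⟨t, ht⟩ := ht
    have hut := (hadj u t).2 ht
    have htw : M.herm t w ≠ 0 := (hadj t w).2 (huw ▸ ht.symm)
    refine ⟨M.herm u t * M.herm t w, (hH.isFourthRoot hut).mul (hH.isFourthRoot htw),
      fun x => ?_⟩
    by_cases hx : u.1 = x.1
    · rw [(hzero u x).2 hx, (hzero w x).2 (huw ▸ hx), mul_zero]
    · have hux := (hadj u x).2 hx
      have hwx : M.herm w x ≠ 0 := (hadj w x).2 (huw ▸ hx)
      have hxu : M.herm x u ≠ 0 := (hadj x u).2 (Ne.symm hx)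
      by_cases htx : t = x
      · subst htx
        linear_combination (-M.herm u t) * hH.mul_symm htw
      · have := h.square hut htw hwx hxu hne htx
        linear_combination (-M.herm u x) * this
          + M.herm u t * M.herm t w * M.herm w x * hH.mul_symm hux
  · push Not at ht
    refine ⟨1, IsFourthRoot.one, fun x => ?_⟩
    rw [(hzero u x).2 (ht x), (hzero w x).2 (huw ▸ ht x), mul_zero]

/-- Where the sums over the second and third class agree, the form vanishes identically: the terms
cancel by antisymmetry. -/
theorem c3_posLe_one (t : Fin 3 → ℕ) : PosLe (c3 t).herm 1 := by
  let L : ((Σ j : Fin 3, Fin (t j)) → ℂ) →ₗ[ℂ] (Fin 1 → ℂ) :=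
    { toFun := fun f _ => ∑ i, f ⟨1, i⟩ - ∑ i, f ⟨2, i⟩
      map_add' := fun f g => by
        ext i; simp [Finset.sum_add_distrib]; ring
      map_smul' := fun c f => by
        ext i; simp [Finset.mul_sum, mul_sub] }
  refine ⟨L, fun f hf => ?_⟩
  have hf0 : ∑ i, f ⟨1, i⟩ = ∑ i, f ⟨2, i⟩ := sub_eq_zero.1 (congrFun hf 0)
  have h1 : hform (c3 t).herm f f
      = ∑ j, ∑ l, star (∑ i, f ⟨j, i⟩) * triangleEntry Complex.I j l * ∑ i, f ⟨l, i⟩ := by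
    rw [hform_eq_sum, Fintype.sum_sigma]
    refine Finset.sum_congr rfl fun j _ => ?_
    simp only [Fintype.sum_sigma, c3_herm]
    rw [Finset.sum_comm]
    refine Finset.sum_congr rfl fun l _ => ?_
    rw [star_sum, Finset.sum_mul, Finset.sum_mul]
    refine Finset.sum_congr rfl fun i _ => ?_
    rw [Finset.mul_sum]
  refine le_of_eq ?_
  rw [h1, ← Complex.zero_re]
  congr 1
  simp only [Fin.sum_univ_three, triangleEntry, Fin.isValue, Fin.reduceAdd, Fin.reduceEq, if_true,
    if_false, hf0]
  ring

theorem IsC3Type.not_posGe_two [Fintype V] (h : M.IsC3Type) : ¬ PosGe M.herm 2 := by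
  obtain ⟨t, _, e, he⟩ := h
  exact fun h2 => (c3_posLe_one t).not_posGe (he.posGe h2)

theorem posLe_one_of_type {k : ℕ} {n : Fin k → ℕ} {M : MixedGraph (Σ j : Fin k, Fin (n j))}
    (hM : M.graph = SimpleGraph.completeMultipartiteGraph (fun j => Fin (n j)))
    (h : M.IsPositive ∨ M.IsC3Type) : PosLe M.herm 1 := by
  rcases h with h | h
  · exact posLe_one_of_isBalancedOn hM (h.isBalancedOn hM)
  · exact posLe_of_not_posGe h.not_posGe_two

end PieceInertia

/-! ### Inertia of a glued graph. -/

section Glue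

variable {A B : Type*} {M : MixedGraph A} {N : MixedGraph B} {a : A} {b : B}

theorem glue_herm_inl_inl (x y : A) : (glue M a N b).herm (.inl x) (.inl y) = M.herm x y := rfl

theorem glue_herm_inr_inr (x y : {w : B // w ≠ b}) :
    (glue M a N b).herm (.inr x) (.inr y) = N.herm x y := rfl

theorem glue_herm_inl_inr [DecidableEq A] (x : A) (y : {w : B // w ≠ b}) :
    (glue M a N b).herm (.inl x) (.inr y) = if x = a then N.herm b y else 0 := by
  by_cases h : x = a
  · by_cases h1 : N.undirected.Adj b y <;> by_cases h2 : N.arc b y <;>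
      by_cases h3 : N.arc y b <;> simp [herm, glue, h, h1, h2, h3]
  · simp [herm, glue, h]

theorem glue_herm_inr_inl [DecidableEq A] (x : A) (y : {w : B // w ≠ b}) :
    (glue M a N b).herm (.inr y) (.inl x) = if x = a then N.herm y b else 0 := by
  by_cases h : x = a
  · by_cases h1 : N.undirected.Adj y b <;> by_cases h2 : N.arc y b <;>
      by_cases h3 : N.arc b y <;> simp [herm, glue, h, h1, h2, h3]
  · simp [herm, glue, h]

variable [Fintype A] [Fintype B] [DecidableEq A] [DecidableEq B]

/-- The diagonal entry at the shared vertex is 0 on both sides, so the form is the sum of the forms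
of the restrictions; each side brings its own functional. -/
theorem glue_posLe_two (hM : PosLe M.herm 1) (hN : PosLe N.herm 1) :
    PosLe (glue M a N b).herm 2 := by
  obtain ⟨L, hL⟩ := hM
  obtain ⟨L', hL'⟩ := hN
  let i₂ : B → GlueVertex A b := fun w => if h : w = b then .inl a else .inr ⟨w, h⟩
  let T : (GlueVertex A b → ℂ) →ₗ[ℂ] (Fin 2 → ℂ) :=
    { toFun := fun f => ![L (f ∘ .inl) 0, L' (f ∘ i₂) 0]
      map_add' := fun f g => by
        have e1 : (f + g) ∘ Sum.inl = f ∘ (Sum.inl : A → GlueVertex A b) + g ∘ Sum.inl := rfl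
        have e2 : (f + g) ∘ i₂ = f ∘ i₂ + g ∘ i₂ := rfl
        ext i
        fin_cases i <;> simp [e1, e2]
      map_smul' := fun c f => by
        have e1 : (c • f) ∘ Sum.inl = c • (f ∘ (Sum.inl : A → GlueVertex A b)) := rfl
        have e2 : (c • f) ∘ i₂ = c • (f ∘ i₂) := rfl
        ext i
        fin_cases i <;> simp [e1, e2] }
  refine ⟨T, fun f hf => ?_⟩
  have h1 : (hform M.herm (f ∘ .inl) (f ∘ .inl)).re ≤ 0 := hL _ (by
    ext i
    rw [Subsingleton.elim i 0]
    exact congrFun hf 0)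
  have h2 : (hform N.herm (f ∘ i₂) (f ∘ i₂)).re ≤ 0 := hL' _ (by
    ext i
    rw [Subsingleton.elim i 0]
    exact congrFun hf 1)
  have hb : i₂ b = .inl a := by simp [i₂]
  have hw : ∀ w : {w : B // w ≠ b}, i₂ w = .inr w := fun w => by simp [i₂, w.2]
  have hsplit : ∀ F : B → ℂ, ∑ w, F w = F b + ∑ w : {w : B // w ≠ b}, F w := fun F =>
    Fintype.sum_eq_add_sum_subtype_ne F b
  have key : hform (glue M a N b).herm f f
      = hform M.herm (f ∘ .inl) (f ∘ .inl) + hform N.herm (f ∘ i₂) (f ∘ i₂) := by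
    simp only [hform_eq_sum, Fintype.sum_sum_type, hsplit, Function.comp_apply, hb, hw,
      glue_herm_inl_inl, glue_herm_inr_inr, glue_herm_inl_inr, glue_herm_inr_inl,
      N.isGainMatrix_herm.diag, Finset.sum_add_distrib, mul_ite, ite_mul, mul_zero, zero_mul,
      Finset.sum_ite_eq', Finset.mem_univ, if_true, zero_add]
    rw [Finset.sum_comm (f := fun (x : A) (y : {w : B // w ≠ b}) => _)]
    simp only [Finset.sum_ite_eq', Finset.mem_univ, if_true]
    ring
  rw [key, Complex.add_re]
  linarith

end Glue

/-! ### Every graph in the list lacks a third positive direction. -/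

section Converse

variable {V : Type*} [Fintype V] {G : MixedGraph V} {v : V}

theorem IsGlueType.not_posGe_three (h : IsGlueType G v) : ¬ PosGe G.herm 3 := by
  obtain ⟨x, y, m, m', M, M', v₁, v₂, _, _, _, _, hM, hM', _, _, hp, hp', e, _, he⟩ := h
  exact fun h3 => (glue_posLe_two (posLe_one_of_type hM hp) (posLe_one_of_type hM' hp')).not_posGe
    (he.posGe h3)

theorem IsConstantGainType.not_posGe_three (h : IsConstantGainType G v) : ¬ PosGe G.herm 3 := by
  obtain ⟨r, k, p, q, n, hr, hk, hp1, hpk, _, _, hcond, e, _, he⟩ := h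
  rw [ofSimpleGraph_kGraph] at he
  refine fun h3 => (kMixed_posLe_two hr hk ?_).not_posGe (he.posGe h3)
  obtain ⟨s, rfl⟩ : ∃ s, k = p + s := ⟨k - p, by omega⟩
  refine schurBound_classGain hr hk (s := s) (by omega) ?_
  have hr' : (2 : ℝ) ≤ r := by exact_mod_cast hr
  have hp' : (1 : ℝ) ≤ p := by exact_mod_cast hp1
  suffices h : ((r : ℝ) - 1) * (p * (s - 1)) ≤ r * (p + s - 1) by
    push_cast
    linarith
  rcases hcond with ⟨rfl, _⟩ | ⟨_, hs⟩ | ⟨_, hs, hcond⟩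
  -- For p = 1 the inequality (r − 1)(s − 1) ≤ rs always holds; the class-size condition plays no
  -- part.
  · have hs : (0 : ℝ) ≤ s := by positivity
    push_cast
    linarith
  · have hs : (s : ℝ) ≤ 1 := by exact_mod_cast (by omega : s ≤ 1)
    have hs' : (0 : ℝ) ≤ s := by positivity
    have h1 : 0 ≤ ((r : ℝ) - 1) * (p * (1 - s)) :=
      mul_nonneg (by linarith) (mul_nonneg (by linarith) (by linarith))
    have h2 : 0 ≤ (r : ℝ) * (p + s - 1) := mul_nonneg (by linarith) (by linarith)
    linarith
  · push_cast at hcond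
    have e1 : (p : ℚ) + s - p - 1 = s - 1 := by ring
    have hr0 : (0 : ℚ) < r := by exact_mod_cast (by omega : 0 < r)
    have hp0 : (0 : ℚ) < p := by exact_mod_cast (by omega : 0 < p)
    have hs0 : (0 : ℚ) < s - 1 := by
      have : (2 : ℚ) ≤ s := by exact_mod_cast (by omega : 2 ≤ s)
      linarith
    rw [e1, div_add_div _ _ hr0.ne' hp0.ne', div_add_div _ _ (by positivity) hs0.ne',
      le_div_iff₀ (by positivity)] at hcond
    have : ((r : ℚ) - 1) * (p * (s - 1)) ≤ r * (p + s - 1) := by linarith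
    exact_mod_cast this

theorem IsOppositeGainType.not_posGe_three (h : IsOppositeGainType G v) : ¬ PosGe G.herm 3 := by
  obtain ⟨r, k, a, b, s, q, n, hr, hk, _, _, hsum, _, _, ⟨rfl, rfl, rfl⟩, e, _, he⟩ := h
  refine fun h3 => (kMixed_posLe_two hr hk ?_).not_posGe (he.posGe h3)
  refine schurBound_classGain hr hk (s := s) (by omega) ?_
  push_cast
  linarith

theorem IsAdjacentGainType.not_posGe_three (h : IsAdjacentGainType G v) : ¬ PosGe G.herm 3 := by
  obtain ⟨r, k, a, c, s, q, n, hr, hk, hca, hc, hsum, _, _, hcond, e, _, he⟩ := h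
  refine fun h3 => (kMixed_posLe_two hr hk ?_).not_posGe (he.posGe h3)
  refine schurBound_classGain hr hk (s := s) (by omega) ?_
  suffices h : ((r : ℝ) - 1) * (2 * a * c + (a + c) * (s - 1)) ≤ r * (a + c + s - 1) by
    push_cast
    linarith
  have hr' : (2 : ℝ) ≤ r := by exact_mod_cast hr
  have hs' : (0 : ℝ) ≤ s := by positivity
  rcases hcond with ⟨rfl, rfl, rfl | rfl⟩ | ⟨rfl, rfl, rfl, rfl | rfl⟩ | ⟨rfl, rfl, rfl, rfl⟩ |
    ⟨rfl, rfl, _, rfl⟩ | ⟨rfl, rfl, rfl, _, hr4⟩ | ⟨rfl, rfl, rfl, rfl⟩ | ⟨rfl, rfl, rfl, rfl⟩ |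
    ⟨rfl, rfl, rfl, rfl⟩ | ⟨ha, rfl, hq⟩
  · push_cast; linarith
  · push_cast; linarith
  · norm_num
  · norm_num
  · norm_num
  · push_cast; linarith
  · have : (r : ℝ) ≤ 4 := by exact_mod_cast hr4
    push_cast; linarith
  · norm_num
  · norm_num
  · norm_num
  · have hr1 : (0 : ℚ) < (r : ℚ) - 1 := by
      have : (2 : ℚ) ≤ r := by exact_mod_cast hr
      linarith
    have has : (0 : ℚ) < (a : ℚ) + s := by
      have : (2 : ℚ) ≤ a := by exact_mod_cast ha
      have : (0 : ℚ) ≤ s := by positivity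
      linarith
    rw [div_le_div_iff₀ has hr1] at hq
    have : ((r : ℚ) - 1) * (2 * a * (1 : ℕ) + (a + (1 : ℕ)) * (s - 1))
        ≤ r * (a + (1 : ℕ) + s - 1) := by
      push_cast
      linarith
    exact_mod_cast this

end Converse

end MixedGraph

theorem theorem1p2 {V : Type*} [Fintype V] [DecidableEq V] (G : MixedGraph V) (v : V)
    (hconn : G.graph.Connected) (hcut : IsCutVertex G.graph v)
    (hpend : ∀ u, ¬ IsPendant G.graph u) :
    G.posInertia = 2 ↔
      -- (i)
      (∃ (x y : ℕ) (m : Fin x → ℕ) (m' : Fin y → ℕ)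
        (M : MixedGraph (Σ j : Fin x, Fin (m j))) (M' : MixedGraph (Σ j : Fin y, Fin (m' j)))
        (v₁ : Σ j : Fin x, Fin (m j)) (v₂ : Σ j : Fin y, Fin (m' j)),
        2 ≤ x ∧ 2 ≤ y ∧ (∀ j, 0 < m j) ∧ (∀ j, 0 < m' j) ∧
        M.graph = SimpleGraph.completeMultipartiteGraph (fun j => Fin (m j)) ∧
        M'.graph = SimpleGraph.completeMultipartiteGraph (fun j => Fin (m' j)) ∧
        ¬ M.IsMixedStar ∧ ¬ M'.IsMixedStar ∧
        (M.IsPositive ∨ M.IsC3Type) ∧ (M'.IsPositive ∨ M'.IsC3Type) ∧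
        ∃ e : V ≃ MixedGraph.GlueVertex (Σ j : Fin x, Fin (m j)) v₂, e v = Sum.inl v₁ ∧
          MixedGraph.SwitchingEquivVia e G (MixedGraph.glue M v₁ M' v₂)) ∨
      -- (ii)
      (∃ (r k p : ℕ) (q : Fin r → ℕ) (n : Fin k → ℕ) (_ : 2 ≤ r) (hk : 2 ≤ k),
        1 ≤ p ∧ p ≤ k ∧ (∀ j, 0 < q j) ∧ (∀ j, 0 < n j) ∧
        ((p = 1 ∧ ((n ⟨0, by omega⟩ = 1 ∧ p + 2 ≤ k) ∨ 2 ≤ n ⟨0, by omega⟩)) ∨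
          (2 ≤ p ∧ k ≤ p + 1) ∨
          (2 ≤ p ∧ p + 2 ≤ k ∧
            (1 : ℚ) ≤ 1 / (r : ℚ) + 1 / (p : ℚ) + 1 / ((k : ℚ) - (p : ℚ) - 1))) ∧
        ∃ e : V ≃ KVertex q n, e v = none ∧
          MixedGraph.SwitchingEquivVia e G (MixedGraph.ofSimpleGraph (kGraph q n p))) ∨
      -- (iii)
      (∃ (r k a b s : ℕ) (q : Fin r → ℕ) (n : Fin k → ℕ),
        2 ≤ r ∧ 2 ≤ k ∧ b ≤ a ∧ 1 ≤ b ∧ a + b + s = k ∧ (∀ j, 0 < q j) ∧ (∀ j, 0 < n j) ∧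
        (a = 1 ∧ b = 1 ∧ r = 2) ∧
        ∃ e : V ≃ KVertex q n, e v = none ∧
          MixedGraph.SwitchingEquivVia e G (kMixed q n a b 0)) ∨
      -- (iv)
      (∃ (r k a c s : ℕ) (q : Fin r → ℕ) (n : Fin k → ℕ),
        2 ≤ r ∧ 2 ≤ k ∧ c ≤ a ∧ 1 ≤ c ∧ a + c + s = k ∧ (∀ j, 0 < q j) ∧ (∀ j, 0 < n j) ∧
        ((a = 1 ∧ c = 1 ∧ (s = 0 ∨ s = 1)) ∨
          (a = 1 ∧ c = 1 ∧ s = 2 ∧ (r = 3 ∨ r = 4)) ∨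
          (a = 1 ∧ c = 1 ∧ s = 3 ∧ r = 3) ∨
          (a = 1 ∧ c = 1 ∧ 2 ≤ s ∧ r = 2) ∨
          (a = 2 ∧ c = 2 ∧ s = 0 ∧ 2 ≤ r ∧ r ≤ 4) ∨
          (a = 2 ∧ c = 2 ∧ s = 1 ∧ r = 2) ∨
          (a = 3 ∧ s = 0 ∧ r = 2 ∧ c = 2) ∨
          (a = 4 ∧ c = 2 ∧ r = 2 ∧ s = 0) ∨
          (2 ≤ a ∧ c = 1 ∧
            ((a : ℚ) * (s : ℚ) - 1) / ((a : ℚ) + (s : ℚ)) ≤ 1 / ((r : ℚ) - 1))) ∧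
        ∃ e : V ≃ KVertex q n, e v = none ∧
          MixedGraph.SwitchingEquivVia e G (kMixed q n a 0 c)) := by
  have h2 := MixedGraph.posGe_two hconn hcut hpend
  -- The lower bound 2 is automatic, so only the absence of a third positive direction has to be
  -- characterized.
  have hiff : G.posInertia = 2 ↔ ¬ PosGe G.herm 3 := by
    rw [MixedGraph.posGe_iff] at h2 ⊢
    omega
  rw [hiff]
  constructor
  · exact MixedGraph.type_of_not_posGe_three hconn hcut hpend
  · rintro (h | h | h | h)
    · exact MixedGraph.IsGlueType.not_posGe_three h
    · exact MixedGraph.IsConstantGainType.not_posGe_three h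
    · exact MixedGraph.IsOppositeGainType.not_posGe_three h
    · exact MixedGraph.IsAdjacentGainType.not_posGe_three h
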